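/- An admissible pair $(M,\Gamma)$ is a compact connected smooth surface $M$ without boundary together with the union $\Gamma\subset M$ of finitely many regular smooth closed curves such that all intersections and self-intersections are transversal, every point of $\Gamma$ is passed at most twice by the curves (intersections and self-intersections are counted alike; the points passed exactly twice are called crossings), $\Gamma$ is connected, and there is at least one crossing. The cells of $(M,\Gamma)$ are the connected components of $M\setminus\Gamma$. The pair $(M,\Gamma)$ is an atom if $\Gamma$ is a finite connected graph of degree $4$ in $M$, every cell is homeomorphic to an open disc, and the cells can be coloured in two colours so that each edge of the graph is incident to cells of different colours. For a simple (non-self-intersecting) closed curve $g\subset\Gamma$, let $u(g)$ be the number of crossings on $g$ at which $g$ does not turn, i.e. at which it continues along the same branch of $\Gamma$. One says that going along $g$ changes local orientation if a tangent frame of $M$ that is carried continuously once along $g$ returns with the opposite orientation. Statement. Let $(M,\Gamma)$ be an admissible pair all of whose cells are homeomorphic to open discs. Then $(M,\Gamma)$ is an atom if and only if for every simple closed curve $g\subset\Gamma$ the following holds: going along $g$ changes local orientation if and only if $u(g)$ is odd. -/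

import Mathlib

open Set Topology
open scoped Manifold ContDiff

namespace SurfaceAtom

/-- The Euclidean plane, the model space of surfaces. -/
abbrev Plane : Type := EuclideanSpace ℝ (Fin 2)

section Curves

variable {M : Type*} [TopologicalSpace M] [ChartedSpace Plane M] {ι : Type*}

/-- The velocity at time `t` of a curve on a surface, written in the coordinates of the preferred
chart at the point `c t` (this is Mathlib's tangent space at `c t`). -/
noncomputable def velocity (c : ℝ → M) (t : ℝ) : Plane :=
  mfderiv 𝓘(ℝ, ℝ) (𝓡 2) c t (1 : ℝ)

/-- The union of a family of closed curves. -/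
def support (γ : ι → UnitAddCircle → M) : Set M := ⋃ i, range (γ i)

/-- A point of intersection or self-intersection of the family: it is passed exactly twice, when
passages by different curves, or by one curve at different times, are counted separately. -/
def IsCrossing (γ : ι → UnitAddCircle → M) (p : M) : Prop :=
  {x : ι × UnitAddCircle | γ x.1 x.2 = p}.encard = 2

/-- `(M, support γ)` is an admissible pair: the closed curves are smooth and regular, all their
intersections and self-intersections are transversal and at most double, and their union is
connected and has at least one crossing. -/
structure IsAdmissible (γ : ι → UnitAddCircle → M) : Prop where
  smooth : ∀ i, ContMDiff 𝓘(ℝ, ℝ) (𝓡 2) ∞ (fun t : ℝ => γ i (t : UnitAddCircle))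
  regular : ∀ i (t : ℝ), velocity (fun s : ℝ => γ i (s : UnitAddCircle)) t ≠ 0
  transversal : ∀ i j (s t : ℝ), γ i (s : UnitAddCircle) = γ j (t : UnitAddCircle) →
    (i, (s : UnitAddCircle)) ≠ (j, (t : UnitAddCircle)) →
    LinearIndependent ℝ
      ![velocity (fun r : ℝ => γ i (r : UnitAddCircle)) s,
        velocity (fun r : ℝ => γ j (r : UnitAddCircle)) t]
  double : ∀ p, {x : ι × UnitAddCircle | γ x.1 x.2 = p}.encard ≤ 2
  connected : IsConnected (support γ)
  exists_crossing : ∃ p, IsCrossing γ p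

/-- The closed curve `g` does not turn at `p`: near `p` it follows one of the branches of the
family through `p`, that is, it contains that branch on both sides of `p`. -/
def GoesStraightAt (γ : ι → UnitAddCircle → M) (g : UnitAddCircle → M) (p : M) : Prop :=
  ∃ (i : ι) (t : UnitAddCircle), γ i t = p ∧ ∀ᶠ s in 𝓝 t, γ i s ∈ range g

/-- `u(g)`: the number of crossings on `g` at which `g` does not turn. (An admissible family has
only finitely many crossings.) -/
noncomputable def straightCount (γ : ι → UnitAddCircle → M) (g : UnitAddCircle → M) : ℕ :=
  {p : M | IsCrossing γ p ∧ p ∈ range g ∧ GoesStraightAt γ g p}.ncard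

/-- A simple closed curve contained in the union of the family. In an admissible pair it
runs along arcs of the curves of the family, and at each crossing which it meets it either goes
straight on or turns onto the other branch. -/
structure IsSimpleClosedCurveIn (γ : ι → UnitAddCircle → M) (g : UnitAddCircle → M) : Prop where
  continuous : Continuous g
  injective : Function.Injective g
  subset : range g ⊆ support γ

end Curves

section Orientation

variable {M : Type*} [TopologicalSpace M] [ChartedSpace Plane M] [IsManifold (𝓡 2) ∞ M]

/-- The determinant of two vectors of the plane. -/
def det₂ (a b : Plane) : ℝ := a 0 * b 1 - a 1 * b 0

/-- A continuous moving frame `(v, w)` of tangent vectors of the surface along `c : [0, 1] → M`. -/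
structure IsFrameAlong (c : ℝ → M) (v w : ∀ t : ℝ, TangentSpace (𝓡 2) (c t)) : Prop where
  continuous_fst :
    ContinuousOn (fun t => (⟨c t, v t⟩ : TangentBundle (𝓡 2) M)) (Icc 0 1)
  continuous_snd :
    ContinuousOn (fun t => (⟨c t, w t⟩ : TangentBundle (𝓡 2) M)) (Icc 0 1)
  independent : ∀ t ∈ Icc (0 : ℝ) 1, LinearIndependent ℝ ![v t, w t]

/-- Going once along the closed curve `g` changes the local orientation: some tangent frame
transported continuously along `g` returns with the opposite orientation. The initial and the
final frame are tangent at the same point, so both are compared in the preferred chart there.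
(A frame along a continuous curve always exists, and all of them give the same answer.) -/
def ChangesLocalOrientation (g : UnitAddCircle → M) : Prop :=
  ∃ v w : ∀ t : ℝ, TangentSpace (𝓡 2) (g (t : UnitAddCircle)),
    IsFrameAlong (fun t : ℝ => g (t : UnitAddCircle)) v w ∧
      det₂ (v 0) (w 0) * det₂ (v 1) (w 1) < 0

end Orientation

section Atoms

variable {M : Type*} [TopologicalSpace M]

/-- `K` is a finite connected graph of degree 4 in the surface `M`, with vertex set `V`: in
suitable local coordinates `K` is a cross at the points of `V` and a line at its other points. -/
structure IsFourValentGraph (K V : Set M) : Prop where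
  compact : IsCompact K
  connected : IsConnected K
  finite : V.Finite
  nonempty : V.Nonempty
  subset : V ⊆ K
  vertex : ∀ p ∈ V, ∃ e : OpenPartialHomeomorph M Plane, p ∈ e.source ∧ e p = 0 ∧
    ∀ x ∈ e.source, x ∈ K ↔ e x 0 = 0 ∨ e x 1 = 0
  edge : ∀ p ∈ K \ V, ∃ e : OpenPartialHomeomorph M Plane, p ∈ e.source ∧ e p = 0 ∧
    ∀ x ∈ e.source, x ∈ K ↔ e x 1 = 0

/-- The cells of `(M, K)`: the connected components of the complement of `K`. -/
def IsCell (K C : Set M) : Prop := ∃ x ∈ Kᶜ, C = connectedComponentIn Kᶜ x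

/-- Every cell is homeomorphic to the open disc. -/
def CellsAreDiscs (K : Set M) : Prop :=
  ∀ C, IsCell K C → Nonempty (C ≃ₜ Metric.ball (0 : Plane) 1)

/-- The cells are coloured in two colours by `χ` so that every edge is incident to cells of
different colours: every point of `K` other than a vertex lies in the closure of two cells which
have different colours. -/
def IsCheckerboard (K V : Set M) (χ : Set M → Bool) : Prop :=
  ∀ p ∈ K \ V, ∃ C C' : Set M, IsCell K C ∧ IsCell K C' ∧ p ∈ closure C ∧ p ∈ closure C' ∧
    χ C ≠ χ C'

/-- The pair `(M, K)`, for a closed surface `M`, is an atom. -/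
def IsAtom (K : Set M) : Prop :=
  CellsAreDiscs K ∧ ∃ V, IsFourValentGraph K V ∧ ∃ χ, IsCheckerboard K V χ

end Atoms

end SurfaceAtom

/-! Near a point p of the curves Γ, the sectors of a small disc cut out by Γ have exactly two
colourings in which adjacent sectors differ. These pairs form a double covering of Γ. An atom
colouring restricts to a section of this covering; conversely, a section colours a neighbourhood of
Γ, and this colouring extends over the cells because they are discs: a disc is connected near its
boundary, so one colour is seen along the whole boundary. Thus the atom property amounts to
triviality of the colour covering (`exists_good_of_isCheckerboard`,
`exists_isCheckerboard_of_good`).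

The local orientations of M along Γ form a second double covering. Coverings are handled here
through transition signs, `colorSign` and `frameSign`, and their sections (`Good`). The product of
the two, `turnSign`, has a simple meaning: for a path along Γ, a local colouring together with a
local orientation tells which colour lies on the left of the path. That colour persists along an
edge. It persists at a turn as well, since the path then runs along the boundary of one sector. It
changes when the path goes straight on through a crossing, because opposite sectors have equal
colours and adjacent ones do not. So the monodromy of the product along a simple closed curve g is
(-1)^u(g) (`exists_jump`, `monodromy_turnSign`). Hence the colour covering is trivial along g if and
only if the orientation monodromy is (-1)^u(g), which is the condition of the theorem
(`exists_good_colorSign_iff`).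

It remains to pass from all simple closed curves to Γ. As for any graph, a double covering that is
trivial along every simple cycle is trivial: Γ is built by adding edges one at a time. An edge that
joins two arc-connected classes can be matched by changing the section on one of them; an edge with
both ends in one class closes up to a simple closed curve, along which a section is given
(`HasSectionOn.union_arc`, `IsAdmissible.exists_good_support`).

All local statements are read off in straight charts: positively oriented charts in which the
branches are the coordinate axes with their own parametrizations
(`IsAdmissible.exists_straightChart`). -/

namespace SurfaceAtom

/-! ### Double coverings given by transition signs, and their sections -/

section LocalSystems

/-- A property of intervals which holds for short intervals and is inherited by concatenations
holds for all intervals. -/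
theorem interval_induction {a b : ℝ} (hab : a ≤ b) (P : ℝ → ℝ → Prop)
    (hloc : ∀ t ∈ Icc a b, ∃ ε > 0, ∀ u v, a ≤ u → u ≤ v → v ≤ b → t - ε < u → v < t + ε → P u v)
    (hcat : ∀ u v, a ≤ u → u ≤ v → v ≤ b → P a u → P u v → P a v) : P a b := by
  set S : Set ℝ := {v | v ∈ Icc a b ∧ P a v} with hS
  have haS : a ∈ S := by
    obtain ⟨ε, hε, h⟩ := hloc a ⟨le_rfl, hab⟩
    exact ⟨⟨le_rfl, hab⟩, h a a le_rfl le_rfl hab (by linarith) (by linarith)⟩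
  have hbdd : BddAbove S := ⟨b, fun v hv => hv.1.2⟩
  set s := sSup S
  have has : a ≤ s := le_csSup hbdd haS
  have hsb : s ≤ b := csSup_le ⟨a, haS⟩ fun v hv => hv.1.2
  obtain ⟨ε, hε, h⟩ := hloc s ⟨has, hsb⟩
  obtain ⟨u, huS, hu⟩ := exists_lt_of_lt_csSup ⟨a, haS⟩ (show s - ε < s by linarith)
  have hus : u ≤ s := le_csSup hbdd huS
  have key : ∀ v, u ≤ v → v ≤ b → v < s + ε → v ∈ S := fun v h1 h2 h3 =>
    ⟨⟨huS.1.1.trans h1, h2⟩, hcat u v huS.1.1 h1 h2 huS.2 (h u v huS.1.1 h1 h2 hu h3)⟩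
  by_cases hb : b < s + ε
  · exact (key b huS.1.2 le_rfl hb).2
  · have := le_csSup hbdd (key (s + ε / 2) (by linarith) (by linarith) (by linarith))
    linarith

variable {X : Type*} [TopologicalSpace X]

/-- A locally constant function on a preconnected set is constant. -/
theorem eq_of_eventually_eq {Y : Type*} {A : Set X} (hA : IsPreconnected A) {f : X → Y}
    (hf : ∀ p ∈ A, ∀ᶠ q in 𝓝[A] p, f q = f p) {p q : X} (hp : p ∈ A) (hq : q ∈ A) :
    f p = f q := by
  let : TopologicalSpace Y := ⊥
  have : DiscreteTopology Y := ⟨rfl⟩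
  refine hA.constant (f := f) (fun x hx => ?_) hp hq
  refine Filter.Tendsto.congr' (f₁ := fun _ => f x) ?_ tendsto_const_nhds
  filter_upwards [hf x hx] with y hy using hy.symm

/-- A section over `A` of the double covering described by the transition signs `δ`. -/
def Good (δ : X → X → ℤˣ) (A : Set X) (s : X → ℤˣ) : Prop :=
  ∀ p ∈ A, ∀ᶠ q in 𝓝[A] p, s q = s p * δ p q

/-- The transition signs `δ` satisfy the cocycle condition locally on `A`. -/
def IsCocycleOn (δ : X → X → ℤˣ) (A : Set X) : Prop :=
  ∀ p ∈ A, ∀ᶠ q in 𝓝[A] p, ∀ᶠ r in 𝓝[A] q, δ p r = δ p q * δ q r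

variable {δ δ' : X → X → ℤˣ} {A B : Set X} {s s' : X → ℤˣ}

theorem Good.mono (h : Good δ A s) (hBA : B ⊆ A) : Good δ B s := fun p hp =>
  (h p (hBA hp)).filter_mono (nhdsWithin_mono _ hBA)

theorem Good.mul (h : Good δ A s) (h' : Good δ' A s') :
    Good (fun p q => δ p q * δ' p q) A (fun p => s p * s' p) := fun p hp => by
  filter_upwards [h p hp, h' p hp] with q h1 h2
  rw [h1, h2]; exact mul_mul_mul_comm _ _ _ _

theorem Good.mul_locConst (h : Good δ A s) (h' : ∀ p ∈ A, ∀ᶠ q in 𝓝[A] p, s' q = s' p) :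
    Good δ A (fun p => s p * s' p) := fun p hp => by
  filter_upwards [h p hp, h' p hp] with q h1 h2
  rw [h1, h2]; exact mul_right_comm _ _ _

theorem Good.mul_const (h : Good δ A s) (c : ℤˣ) : Good δ A (fun p => s p * c) :=
  h.mul_locConst (s' := fun _ => c) fun _ _ => Filter.Eventually.of_forall fun _ => rfl

/-- The transition signs cancel in the product of two sections, which is therefore locally constant.
This is uniqueness of sections up to a global sign. -/
theorem Good.mul_eq (h : Good δ A s) (h' : Good δ A s') (hA : IsPreconnected A) {p q : X}
    (hp : p ∈ A) (hq : q ∈ A) : s p * s' p = s q * s' q := by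
  refine eq_of_eventually_eq hA (f := fun p => s p * s' p) (fun x hx => ?_) hp hq
  filter_upwards [h x hx, h' x hx] with y h1 h2
  rw [h1, h2, mul_mul_mul_comm, Int.units_mul_self, mul_one]

theorem Good.congr (h : Good δ A s) (hs : EqOn s s' A) : Good δ A s' := fun p hp => by
  filter_upwards [h p hp, self_mem_nhdsWithin] with q h1 h2
  rw [← hs h2, ← hs hp, h1]

/-- Closedness matters because a point of one set outside the other has a neighbourhood missing the
other, so only the pieces containing the point impose a condition. -/
theorem eventually_union_of_closed {P : X → X → Prop} (hA : IsClosed A) (hB : IsClosed B)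
    (hPA : ∀ p ∈ A, ∀ᶠ q in 𝓝[A] p, P p q) (hPB : ∀ p ∈ B, ∀ᶠ q in 𝓝[B] p, P p q) :
    ∀ p ∈ A ∪ B, ∀ᶠ q in 𝓝[A ∪ B] p, P p q := by
  intro p _
  rw [nhdsWithin_union, Filter.eventually_sup]
  have aux : ∀ {C : Set X}, IsClosed C → (∀ p ∈ C, ∀ᶠ q in 𝓝[C] p, P p q) →
      ∀ᶠ q in 𝓝[C] p, P p q := by
    intro C hC h
    by_cases hp : p ∈ C
    · exact h p hp
    · filter_upwards [self_mem_nhdsWithin, mem_nhdsWithin_of_mem_nhds (hC.isOpen_compl.mem_nhds hp)]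
        with q h1 h2 using absurd h1 h2
  exact ⟨aux hA hPA, aux hB hPB⟩

theorem Good.union (hA : IsClosed A) (hB : IsClosed B) (h : Good δ A s) (h' : Good δ B s) :
    Good δ (A ∪ B) s :=
  eventually_union_of_closed hA hB h h'

open Classical in
theorem Good.glue (hA : IsClosed A) (hB : IsClosed B) (h : Good δ A s) (h' : Good δ B s')
    (hs : ∀ x ∈ A ∩ B, s x = s' x) : ∃ r, Good δ (A ∪ B) r ∧ EqOn r s A ∧ EqOn r s' B := by
  have h1 : EqOn s (fun x => if x ∈ A then s x else s' x) A := fun x hx => by simp [hx]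
  have h2 : EqOn s' (fun x => if x ∈ A then s x else s' x) B := fun x hx => by
    by_cases hxA : x ∈ A
    · simp [hxA, hs x ⟨hxA, hx⟩]
    · simp [hxA]
  exact ⟨_, Good.union hA hB (h.congr h1) (h'.congr h2), h1.symm, h2.symm⟩

theorem Good.comp {Y : Type*} [TopologicalSpace Y] {f : Y → X} {K : Set Y} (h : Good δ A s)
    (hf : ContinuousOn f K) (hKA : MapsTo f K A) :
    Good (fun t t' => δ (f t) (f t')) K (fun t => s (f t)) := fun t ht =>
  ((hf t ht).tendsto_nhdsWithin hKA).eventually (h (f t) (hKA ht))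

theorem IsCocycleOn.comp {Y : Type*} [TopologicalSpace Y] {f : Y → X} {K : Set Y}
    (h : IsCocycleOn δ A) (hf : ContinuousOn f K) (hKA : MapsTo f K A) :
    IsCocycleOn (fun t t' => δ (f t) (f t')) K := fun t ht => by
  filter_upwards [((hf t ht).tendsto_nhdsWithin hKA).eventually (h (f t) (hKA ht)),
    self_mem_nhdsWithin] with t' ht' hK
  exact ((hf t' hK).tendsto_nhdsWithin hKA).eventually ht'

/-- The map need not be injective, so all parameters over p must be treated at once. The closure in
K of the parameters violating the relation contains none of them, and by compactness its image is a
closed set missing p. -/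
theorem Good.image [T2Space X] {Y : Type*} [TopologicalSpace Y] {f : Y → X} {K : Set Y}
    (hK : IsCompact K) (hf : ContinuousOn f K)
    (h : Good (fun t t' => δ (f t) (f t')) K (fun t => s (f t))) : Good δ (f '' K) s := by
  rintro p -
  set Z : Set Y := closure {t ∈ K | ¬ s (f t) = s p * δ p (f t)} ∩ K
  have hZ : IsCompact Z := hK.inter_left isClosed_closure
  have hZc : IsClosed (f '' Z) := (hZ.image_of_continuousOn (hf.mono inter_subset_right)).isClosed
  have hp : p ∉ f '' Z := by
    rintro ⟨t, ⟨ht, htK⟩, rfl⟩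
    have := h t htK
    rw [mem_closure_iff_frequently] at ht
    rw [eventually_nhdsWithin_iff] at this
    exact ht (this.mono fun x hx hx' => hx'.2 (hx hx'.1))
  filter_upwards [self_mem_nhdsWithin, mem_nhdsWithin_of_mem_nhds (hZc.isOpen_compl.mem_nhds hp)]
  rintro _ ⟨t, ht, rfl⟩ htZ
  by_contra hne
  exact htZ ⟨t, ⟨subset_closure ⟨ht, hne⟩, ht⟩, rfl⟩

/-- Near t the function `δ t` is itself a section, by the cocycle condition. Sections on adjacent
intervals meet in one point only and match there after a change of sign. -/
theorem exists_good_Icc {δ : ℝ → ℝ → ℤˣ} {a b : ℝ} (hab : a ≤ b) (h : IsCocycleOn δ (Icc a b)) :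
    ∃ s, Good δ (Icc a b) s := by
  refine interval_induction hab (fun u v => ∃ s, Good δ (Icc u v) s) ?_ ?_
  · intro t ht
    have := h t ht
    rw [eventually_nhdsWithin_iff, Metric.eventually_nhds_iff] at this
    obtain ⟨ε, hε, h⟩ := this
    refine ⟨ε, hε, fun u v hau huv hvb h1 h2 => ⟨δ t, fun x hx => ?_⟩⟩
    have := h (y := x) (by rw [Real.dist_eq, abs_lt]; constructor <;> linarith [hx.1, hx.2])
      ⟨hau.trans hx.1, hx.2.trans hvb⟩
    exact this.filter_mono (nhdsWithin_mono _ (Icc_subset_Icc hau hvb))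
  · rintro u v hau huv hvb ⟨s, hs⟩ ⟨s', hs'⟩
    obtain ⟨r, hr, -⟩ := Good.glue isClosed_Icc isClosed_Icc hs (hs'.mul_const (s' u * s u))
      (by
        rintro x ⟨h1, h2⟩
        obtain rfl : x = u := le_antisymm h1.2 h2.1
        rw [← mul_assoc, Int.units_mul_self, one_mul])
    rw [Icc_union_Icc_eq_Icc hau huv] at hr
    exact ⟨r, hr⟩

theorem exists_good_image_of_injOn [T2Space X] {f : ℝ → X} {a b : ℝ} (hab : a ≤ b)
    (hf : ContinuousOn f (Icc a b)) (hinj : InjOn f (Icc a b)) (hδ : IsCocycleOn δ A)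
    (hfA : MapsTo f (Icc a b) A) : ∃ s, Good δ (f '' Icc a b) s := by
  obtain ⟨s, hs⟩ := exists_good_Icc hab (hδ.comp hf hfA)
  refine ⟨fun x => s (Function.invFunOn f (Icc a b) x), Good.image isCompact_Icc hf ?_⟩
  exact hs.congr fun t ht => by simp only [hinj.leftInvOn_invFunOn ht]

/-- A section along a closed path with trivial monodromy descends to the image of the path. -/
theorem Good.exists_image_of_closed [T2Space X] {f : ℝ → X} {a b : ℝ} (hab : a < b)
    (hf : ContinuousOn f (Icc a b)) (hinj : InjOn f (Ico a b)) (hclosed : f a = f b)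
    {s : ℝ → ℤˣ} (hs : Good (fun t t' => δ (f t) (f t')) (Icc a b) s) (hsab : s a = s b) :
    ∃ s', Good δ (f '' Icc a b) s' := by
  refine ⟨fun x => s (Function.invFunOn f (Ico a b) x), Good.image isCompact_Icc hf ?_⟩
  refine hs.congr fun t ht => ?_
  rcases ht.2.lt_or_eq with h | rfl
  · simp only [hinj.leftInvOn_invFunOn ⟨ht.1, h⟩]
  · simp only [← hclosed, hinj.leftInvOn_invFunOn (left_mem_Ico.2 hab), hsab]

/-- A function of one real variable with values in signs which has one-sided limits everywhere and
no jump outside a finite set changes between `a` and `b` by the product of its jumps. -/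
theorem mul_eq_prod_jumps {a b : ℝ} (hab : a < b) {F L R : ℝ → ℤˣ} (T : Finset ℝ)
    (hT : ∀ t ∈ T, t ∈ Ioo a b)
    (hL : ∀ t ∈ Icc a b, ∀ᶠ t' in 𝓝[<] t, F t' = L t)
    (hR : ∀ t ∈ Icc a b, ∀ᶠ t' in 𝓝[>] t, F t' = R t)
    (hLR : ∀ t ∈ Icc a b, t ∉ T → L t = R t) :
    R a * L b = ∏ t ∈ T, (L t * R t) := by
  classical
  -- `P x` collects the jumps up to and including x. Multiplying the right limit by it compensates
  -- every jump, so `R * P` is locally constant.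
  set P : ℝ → ℤˣ := fun x => ∏ t ∈ T with t ≤ x, (L t * R t)
  have hPR : ∀ x, ∀ᶠ y in 𝓝[>] x, P y = P x := by
    intro x
    have : ∀ᶠ y in 𝓝[>] x, ∀ t ∈ T, (t ≤ y ↔ t ≤ x) := by
      rw [Filter.eventually_all_finset]
      intro t _
      by_cases h : t ≤ x
      · filter_upwards [self_mem_nhdsWithin] with y hy
        exact ⟨fun _ => h, fun _ => h.trans (le_of_lt hy)⟩
      · filter_upwards [mem_nhdsWithin_of_mem_nhds (Iio_mem_nhds (not_le.1 h))] with y hy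
        exact ⟨fun h' => absurd h' (not_le.2 hy), fun h' => absurd h' h⟩
    filter_upwards [this] with y hy
    exact Finset.prod_congr (Finset.filter_congr hy) fun _ _ => rfl
  have hPL : ∀ x ∈ Icc a b, ∀ᶠ y in 𝓝[<] x, P y = P x * (L x * R x) := by
    intro x hx
    have : ∀ᶠ y in 𝓝[<] x, ∀ t ∈ T, (t ≤ y ↔ t < x) := by
      rw [Filter.eventually_all_finset]
      intro t _
      by_cases h : t < x
      · filter_upwards [mem_nhdsWithin_of_mem_nhds (Ioi_mem_nhds h)] with y hy
        exact ⟨fun _ => h, fun _ => le_of_lt hy⟩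
      · filter_upwards [self_mem_nhdsWithin] with y hy
        exact ⟨fun h' => lt_of_le_of_lt h' hy, fun h' => absurd h' h⟩
    filter_upwards [this] with y hy
    have h1 : P y = ∏ t ∈ T with t < x, (L t * R t) :=
      Finset.prod_congr (Finset.filter_congr hy) fun _ _ => rfl
    rw [h1]
    by_cases hxT : x ∈ T
    · have : T.filter (· ≤ x) = insert x (T.filter (· < x)) := by
        ext t; simp only [Finset.mem_filter, Finset.mem_insert, le_iff_eq_or_lt]
        constructor
        · rintro ⟨h, rfl | h'⟩
          · exact Or.inl rfl
          · exact Or.inr ⟨h, h'⟩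
        · rintro (rfl | h)
          · exact ⟨hxT, Or.inl rfl⟩
          · exact ⟨h.1, Or.inr h.2⟩
      show _ = (∏ t ∈ T with t ≤ x, (L t * R t)) * _
      rw [this, Finset.prod_insert (by simp), mul_comm, ← mul_assoc, Int.units_mul_self, one_mul]
    · have : T.filter (· ≤ x) = T.filter (· < x) := by
        refine Finset.filter_congr fun t ht => ⟨fun h => h.lt_of_ne ?_, le_of_lt⟩
        rintro rfl; exact hxT ht
      show _ = (∏ t ∈ T with t ≤ x, (L t * R t)) * _
      rw [this, hLR x hx hxT, Int.units_mul_self, mul_one]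
  have key : R a * P a = R b * P b := by
    refine eq_of_eventually_eq (isPreconnected_Icc (a := a) (b := b)) (f := fun x => R x * P x)
      (fun x hx => ?_) ⟨le_rfl, hab.le⟩ ⟨hab.le, le_rfl⟩
    have hl : ∀ᶠ y in 𝓝[<] x, y ∈ Icc a b → R y * P y = R x * P x := by
      have h := hL x hx
      rw [eventually_nhdsWithin_iff, eventually_nhds_iff] at h
      obtain ⟨U, hU, hUo, hxU⟩ := h
      filter_upwards [hPL x hx, self_mem_nhdsWithin, mem_nhdsWithin_of_mem_nhds (hUo.mem_nhds hxU)]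
        with y h1 h2 h3 hy
      -- The right limit at y is a value of F at some point between y and x, and those values are
      -- all `L x`.
      have : R y = L x := by
        have e1 : ∀ᶠ z in 𝓝[>] y, z ∈ U := mem_nhdsWithin_of_mem_nhds (hUo.mem_nhds h3)
        have e2 : ∀ᶠ z in 𝓝[>] y, z < x := mem_nhdsWithin_of_mem_nhds (Iio_mem_nhds h2)
        obtain ⟨z, hz, hz2, hz3⟩ := ((hR y hy).and (e1.and e2)).exists
        rw [← hz, hU z hz2 hz3]
      rw [this, h1, mul_comm (P x), ← mul_assoc, ← mul_assoc, Int.units_mul_self, one_mul]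
    have hr : ∀ᶠ y in 𝓝[>] x, y ∈ Icc a b → R y * P y = R x * P x := by
      have h := hR x hx
      rw [eventually_nhdsWithin_iff, eventually_nhds_iff] at h
      obtain ⟨U, hU, hUo, hxU⟩ := h
      filter_upwards [hPR x, self_mem_nhdsWithin, mem_nhdsWithin_of_mem_nhds (hUo.mem_nhds hxU)]
        with y h1 h2 h3 hy
      have : R y = R x := by
        have e1 : ∀ᶠ z in 𝓝[>] y, z ∈ U := mem_nhdsWithin_of_mem_nhds (hUo.mem_nhds h3)
        have e2 : ∀ᶠ z in 𝓝[>] y, y < z := self_mem_nhdsWithin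
        obtain ⟨z, hz, hz2, hz1⟩ := ((hR y hy).and (e1.and e2)).exists
        rw [← hz, hU z hz2 (lt_trans h2 hz1)]
      rw [this, h1]
    have hall : ∀ᶠ y in 𝓝 x, y ∈ Icc a b → R y * P y = R x * P x := by
      rw [← nhdsWithin_univ, ← Iic_union_Ioi (a := x), nhdsWithin_union, ← Iio_insert,
        nhdsWithin_insert]
      simp only [Filter.eventually_sup]
      exact ⟨⟨by simp, hl⟩, hr⟩
    exact eventually_nhdsWithin_iff.2 hall
  have hPa : P a = 1 := by
    refine Finset.prod_eq_one fun t ht => ?_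
    rw [Finset.mem_filter] at ht
    exact absurd ht.2 (not_le.2 (hT t ht.1).1)
  have hPb : P b = ∏ t ∈ T, (L t * R t) :=
    Finset.prod_congr (Finset.filter_true_of_mem fun t ht => (hT t ht).2.le) fun _ _ => rfl
  have hb : L b = R b := hLR b ⟨hab.le, le_rfl⟩ fun h => lt_irrefl _ (hT b h).2
  rw [hPa, mul_one, hPb] at key
  rw [key, hb, mul_comm (R b), mul_assoc, Int.units_mul_self, mul_one]

end LocalSystems

/-! ### Determinants and straightening of transversal curves in the plane -/

section PlaneGeometry

/-- The point `z` of the coordinate axis with index `k`. -/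
noncomputable abbrev axis (k : Fin 2) (z : ℝ) : Plane := EuclideanSpace.single k z

@[simp] theorem axis_zero (k : Fin 2) : axis k 0 = 0 := by
  ext i; fin_cases k <;> fin_cases i <;> simp [axis]

@[simp] theorem axis_apply_self (k : Fin 2) (z : ℝ) : axis k z k = z := by simp [axis]

@[simp] theorem axis_zero_one (z : ℝ) : axis 0 z 1 = 0 := by simp [axis]

/-- The determinant of an endomorphism of the plane. -/
noncomputable def jac (L : Plane →L[ℝ] Plane) : ℝ := det₂ (L (axis 0 1)) (L (axis 1 1))

theorem eq_axis_add_axis (v : Plane) : v = v 0 • axis 0 1 + v 1 • axis 1 1 := by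
  ext i; fin_cases i <;> simp [axis]

theorem det₂_map (L : Plane →L[ℝ] Plane) (v w : Plane) :
    det₂ (L v) (L w) = jac L * det₂ v w := by
  conv_lhs => rw [eq_axis_add_axis v, eq_axis_add_axis w]
  simp only [map_add, map_smul, jac, det₂, PiLp.add_apply, PiLp.smul_apply, smul_eq_mul]
  ring

theorem jac_comp (L L' : Plane →L[ℝ] Plane) : jac (L.comp L') = jac L * jac L' := by
  rw [jac, ContinuousLinearMap.comp_apply, ContinuousLinearMap.comp_apply, det₂_map, ← jac]

@[simp] theorem jac_id : jac (ContinuousLinearMap.id ℝ Plane) = 1 := by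
  simp [jac, det₂, axis]

theorem jac_symm (L : Plane ≃L[ℝ] Plane) :
    jac (L : Plane →L[ℝ] Plane) * jac (L.symm : Plane →L[ℝ] Plane) = 1 := by
  rw [← jac_comp]; simp

theorem exists_equiv_of_jac_ne_zero (L : Plane →L[ℝ] Plane) (h : jac L ≠ 0) :
    ∃ L' : Plane ≃L[ℝ] Plane, (L' : Plane →L[ℝ] Plane) = L := by
  have hinj : Function.Injective (L : Plane →ₗ[ℝ] Plane) := by
    rw [← LinearMap.ker_eq_bot, LinearMap.ker_eq_bot']
    intro v hv
    have hv : L v = 0 := hv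
    have h0 := det₂_map L v (axis 1 1)
    have h1 := det₂_map L (axis 0 1) v
    rw [hv] at h0 h1
    ext i; fin_cases i
    · simpa [det₂, axis, h, eq_comm] using h0
    · simpa [det₂, axis, h, eq_comm] using h1
  refine ⟨(LinearEquiv.ofInjectiveEndo (L : Plane →ₗ[ℝ] Plane) hinj).toContinuousLinearEquiv, ?_⟩
  ext v : 1; rfl

theorem det₂_ne_zero_iff {v w : Plane} : det₂ v w ≠ 0 ↔ LinearIndependent ℝ ![v, w] := by
  rw [LinearIndependent.pair_iff]
  constructor
  · intro h s t hst
    have h0 := congrArg (fun x : Plane => x 0) hst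
    have h1 := congrArg (fun x : Plane => x 1) hst
    simp only [PiLp.add_apply, PiLp.smul_apply, smul_eq_mul, PiLp.zero_apply] at h0 h1
    constructor
    · have : s * det₂ v w = 0 := by unfold det₂; linear_combination w 1 * h0 - w 0 * h1
      exact (mul_eq_zero.1 this).resolve_right h
    · have : t * det₂ v w = 0 := by unfold det₂; linear_combination v 0 * h1 - v 1 * h0
      exact (mul_eq_zero.1 this).resolve_right h
  · intro h hd
    unfold det₂ at hd
    have h1 := h (w 1) (-v 1) (by
      ext i; fin_cases i
      · simp; linear_combination hd
      · simp; ring)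
    have h2 := h (w 0) (-v 0) (by
      ext i; fin_cases i
      · simp; ring
      · simp; linear_combination -hd)
    have := h 1 0 (by
      ext i; fin_cases i
      · simpa using h2.2
      · simpa using h1.2)
    exact one_ne_zero this.1

theorem continuous_det₂ : Continuous fun x : Plane × Plane => det₂ x.1 x.2 := by
  unfold det₂; fun_prop

theorem continuous_jac : Continuous jac := by
  unfold jac
  exact continuous_det₂.comp (f := fun L : Plane →L[ℝ] Plane => (L (axis 0 1), L (axis 1 1)))
    (by fun_prop)

/-- Two transversal curves in the plane can be straightened to the coordinate axes. -/
theorem exists_straightening (c : Fin 2 → ℝ → Plane) (hc : ∀ k, ContDiffAt ℝ 1 (c k) 0)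
    (hdet : 0 < det₂ (deriv (c 0) 0) (deriv (c 1) 0)) :
    ∃ H : OpenPartialHomeomorph Plane Plane, (0 : Plane) ∈ H.source ∧
      (∀ y, H y = c 0 (y 0) + c 1 (y 1)) ∧
      ∀ᶠ y in 𝓝 (0 : Plane), ∃ L : Plane ≃L[ℝ] Plane,
        HasFDerivAt H (L : Plane →L[ℝ] Plane) y ∧ 0 < jac (L : Plane →L[ℝ] Plane) := by
  -- The Jacobian of G at 0 is the determinant of the two velocities, so the inverse function
  -- theorem applies, and positivity of the Jacobian persists nearby.
  set G : Plane → Plane := fun y => c 0 (y 0) + c 1 (y 1) with hG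
  have hG1 : ContDiffAt ℝ 1 G 0 := by
    refine ContDiffAt.add ?_ ?_
    · exact ContDiffAt.comp (g := c 0) (f := fun y : Plane => y 0) 0 (hc 0) (by fun_prop)
    · exact ContDiffAt.comp (g := c 1) (f := fun y : Plane => y 1) 0 (hc 1) (by fun_prop)
  have hjac0 : jac (fderiv ℝ G 0) = det₂ (deriv (c 0) 0) (deriv (c 1) 0) := by
    have hd : ∀ k, HasDerivAt (c k) (deriv (c k) 0) ((0 : Plane) k) := fun k =>
      ((hc k).differentiableAt (by simp)).hasDerivAt
    have hproj : ∀ k : Fin 2, HasFDerivAt (fun y : Plane => y k)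
      (EuclideanSpace.proj k : Plane →L[ℝ] ℝ) 0 := fun k =>
        (EuclideanSpace.proj k : Plane →L[ℝ] ℝ).hasFDerivAt
    have h : HasFDerivAt G _ 0 := ((hd 0).hasFDerivAt.comp (0 : Plane) (hproj 0)).add
      ((hd 1).hasFDerivAt.comp (0 : Plane) (hproj 1))
    rw [h.fderiv]
    simp [jac, axis]
  have hev : ∀ᶠ y in 𝓝 (0 : Plane), DifferentiableAt ℝ G y ∧ 0 < jac (fderiv ℝ G y) := by
    have h1 : ∀ᶠ y in 𝓝 (0 : Plane), ContDiffAt ℝ 1 G y := hG1.eventually (by simp)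
    have h2 : ContinuousAt (fun y => jac (fderiv ℝ G y)) 0 :=
      continuous_jac.continuousAt.comp
        ((hG1.fderiv_right (m := 0) (by simp)).continuousAt)
    have h3 := h2.eventually (lt_mem_nhds (hjac0 ▸ hdet))
    filter_upwards [h1, h3] with y h1 h3
    exact ⟨h1.differentiableAt (by simp), h3⟩
  obtain ⟨L, hL⟩ := exists_equiv_of_jac_ne_zero _ hev.self_of_nhds.2.ne'
  have hstrict : HasStrictFDerivAt G (L : Plane →L[ℝ] Plane) 0 := by
    rw [hL]; exact hG1.hasStrictFDerivAt (by simp)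
  refine ⟨hstrict.toOpenPartialHomeomorph G, hstrict.mem_toOpenPartialHomeomorph_source,
    fun y => rfl, ?_⟩
  filter_upwards [hev] with y hy
  obtain ⟨L, hL⟩ := exists_equiv_of_jac_ne_zero _ hy.2.ne'
  exact ⟨L, by rw [hL]; exact hy.1.hasFDerivAt, by rw [hL]; exact hy.2⟩

theorem det₂_rot_pos {v : Plane} (hv : v ≠ 0) : 0 < det₂ v !₂[-v 1, v 0] := by
  have h : det₂ v !₂[-v 1, v 0] = v 0 ^ 2 + v 1 ^ 2 := by simp [det₂]; ring
  rw [h]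
  by_contra hle
  apply hv
  have h0 : v 0 = 0 := by nlinarith [sq_nonneg (v 0), sq_nonneg (v 1)]
  have h1 : v 1 = 0 := by nlinarith [sq_nonneg (v 0), sq_nonneg (v 1)]
  ext i; fin_cases i
  · exact h0
  · exact h1

theorem abs_lt_of_axis_mem_ball {k : Fin 2} {z r : ℝ} :
    axis k z ∈ Metric.ball (0 : Plane) r ↔ |z| < r := by
  simp [axis]

end PlaneGeometry

/-! ### Velocities read in charts -/

section Velocity

variable {M : Type*} [TopologicalSpace M] [ChartedSpace Plane M]

theorem velocity_eq_deriv {c : ℝ → M} {t : ℝ} (hc : ContMDiffAt 𝓘(ℝ, ℝ) (𝓡 2) ∞ c t) :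
    velocity c t = deriv (fun s => chartAt Plane (c t) (c s)) t := by
  unfold velocity
  rw [(hc.mdifferentiableAt (by simp)).mfderiv]
  simp [writtenInExtChartAt, extChartAt, Function.comp_def, chartAt_self_eq]
  rfl

theorem contDiffAt_chart_comp [IsManifold (𝓡 2) ∞ M] {c : ℝ → M} {t : ℝ} (hc : ContMDiffAt 𝓘(ℝ, ℝ) (𝓡 2) ∞ c t) {p : M}
    (hp : c t ∈ (chartAt Plane p).source) :
    ContDiffAt ℝ ∞ (fun s => chartAt Plane p (c s)) t := by
  have h : ContMDiffAt (𝓡 2) 𝓘(ℝ, Plane) ∞ (extChartAt (𝓡 2) p) (c t) :=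
    contMDiffAt_extChartAt' hp
  have := (h.comp t hc).contDiffAt
  simpa [extChartAt, Function.comp_def] using this

end Velocity

/-! ### Charts in which the branches are the coordinate axes -/

section StraightCharts

variable {M : Type*} [TopologicalSpace M] [ChartedSpace Plane M]
  {ι : Type*} {γ : ι → UnitAddCircle → M}

/-- The coordinate axis with index `k` belongs to the local picture at `p`: both axes do at a
crossing, and only the first one at other points. -/
def IsAxisAt (γ : ι → UnitAddCircle → M) (p : M) (k : Fin 2) : Prop := k = 0 ∨ IsCrossing γ p

/-- A chart `e` near `p` onto a disc of radius `r`, in which the branches of the family become the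
coordinate axes, with their parametrizations, and which agrees in orientation with the preferred
chart at `p`. -/
structure IsStraightChart (γ : ι → UnitAddCircle → M) (p : M) (e : OpenPartialHomeomorph M Plane)
    (r : ℝ) (b : Fin 2 → ι × ℝ) : Prop where
  pos : 0 < r
  mem : p ∈ e.source
  map_self : e p = 0
  target : e.target = Metric.ball 0 r
  source_subset : e.source ⊆ (chartAt Plane p).source
  branch : ∀ k, IsAxisAt γ p k → ∀ z : ℝ, |z| < r →
    γ (b k).1 (((b k).2 + z : ℝ) : UnitAddCircle) = e.symm (axis k z)
  of_mem : ∀ j (t : UnitAddCircle), γ j t ∈ e.source → ∃ k, IsAxisAt γ p k ∧ ∃ z : ℝ, |z| < r ∧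
    j = (b k).1 ∧ t = (((b k).2 + z : ℝ) : UnitAddCircle)
  deriv : ∀ y ∈ Metric.ball (0 : Plane) r, ∃ L : Plane ≃L[ℝ] Plane,
    HasFDerivAt (fun y => chartAt Plane p (e.symm y)) (L : Plane →L[ℝ] Plane) y ∧
      0 < jac (L : Plane →L[ℝ] Plane)

theorem IsAdmissible.continuous (hγ : IsAdmissible γ) (i : ι) : Continuous (γ i) :=
  continuous_coinduced_dom.2 (hγ.smooth i).continuous

variable [IsManifold (𝓡 2) ∞ M]

theorem IsAdmissible.deriv_chart_branch (hγ : IsAdmissible γ) {p : M} {i : ι} {t : ℝ}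
    (h : γ i t = p) :
    ContDiffAt ℝ 1 (fun z : ℝ => chartAt Plane p (γ i ((t + z : ℝ) : UnitAddCircle))) 0 ∧
    deriv (fun z : ℝ => chartAt Plane p (γ i ((t + z : ℝ) : UnitAddCircle))) 0 =
      velocity (fun s : ℝ => γ i (s : UnitAddCircle)) t := by
  subst h
  constructor
  · have h1 := (contDiffAt_chart_comp ((hγ.smooth i).contMDiffAt (x := t + 0))
      (p := γ i t) (by simp)).of_le (m := 1) (by simp)
    exact ContDiffAt.comp (g := fun s : ℝ => chartAt Plane (γ i t) (γ i (s : UnitAddCircle)))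
      (f := fun z : ℝ => t + z) 0 h1 (by fun_prop)
  · rw [velocity_eq_deriv (hγ.smooth i).contMDiffAt,
      deriv_comp_const_add (fun s : ℝ => chartAt Plane (γ i t) (γ i (s : UnitAddCircle))) t 0,
      add_zero]

/-- The branches through a point, as curves in the preferred chart there; at points other than
crossings a transversal line is added. -/
theorem IsAdmissible.exists_branches (hγ : IsAdmissible γ) {p : M} (hp : p ∈ support γ) :
    ∃ (b : Fin 2 → ι × ℝ) (c : Fin 2 → ℝ → Plane),
      (∀ k, ContDiffAt ℝ 1 (c k) 0) ∧ 0 < det₂ (deriv (c 0) 0) (deriv (c 1) 0) ∧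
      (∀ k, IsAxisAt γ p k → ∀ z : ℝ, c 0 (axis k z 0) + c 1 (axis k z 1) =
        chartAt Plane p (γ (b k).1 (((b k).2 + z : ℝ) : UnitAddCircle))) ∧
      (∀ k, IsAxisAt γ p k → γ (b k).1 ((b k).2 : UnitAddCircle) = p) ∧
      ∀ j (t : UnitAddCircle), γ j t = p → ∃ k, IsAxisAt γ p k ∧ j = (b k).1 ∧ t = (b k).2 := by
  by_cases hc : IsCrossing γ p
  · have hpair : ∃ x y : ι × ℝ, {x : ι × UnitAddCircle | γ x.1 x.2 = p} =
        {(x.1, (x.2 : UnitAddCircle)), (y.1, (y.2 : UnitAddCircle))} ∧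
        0 < det₂ (velocity (fun s : ℝ => γ x.1 (s : UnitAddCircle)) x.2)
          (velocity (fun s : ℝ => γ y.1 (s : UnitAddCircle)) y.2) := by
      obtain ⟨⟨i, s'⟩, ⟨j, t'⟩, hne, hset⟩ := Set.encard_eq_two.1 hc
      obtain ⟨s, rfl⟩ := QuotientAddGroup.mk_surjective s'
      obtain ⟨t, rfl⟩ := QuotientAddGroup.mk_surjective t'
      have h1 : γ i (s : UnitAddCircle) = p := by
        have : ((i, (s : UnitAddCircle)) : ι × UnitAddCircle) ∈ {x | γ x.1 x.2 = p} := by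
          rw [hset]; exact Or.inl rfl
        exact this
      have h2 : γ j (t : UnitAddCircle) = p := by
        have : ((j, (t : UnitAddCircle)) : ι × UnitAddCircle) ∈ {x | γ x.1 x.2 = p} := by
          rw [hset]; exact Or.inr rfl
        exact this
      have hd := det₂_ne_zero_iff.2 (hγ.transversal i j s t (h1.trans h2.symm) hne)
      -- The two passages are ordered so that their velocities form a positive frame.
      rcases hd.lt_or_gt with h | h
      · refine ⟨(j, t), (i, s), by rw [hset, Set.pair_comm], ?_⟩
        have : ∀ v w : Plane, det₂ v w = - det₂ w v := fun v w => by unfold det₂; ring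
        rw [this]; exact neg_pos.2 h
      · exact ⟨(i, s), (j, t), hset, h⟩
    obtain ⟨x, y, hset, hd⟩ := hpair
    have hx : γ x.1 (x.2 : UnitAddCircle) = p := by
      have : (x.1, (x.2 : UnitAddCircle)) ∈ {x : ι × UnitAddCircle | γ x.1 x.2 = p} := by
        rw [hset]; exact Or.inl rfl
      exact this
    have hy : γ y.1 (y.2 : UnitAddCircle) = p := by
      have : (y.1, (y.2 : UnitAddCircle)) ∈ {x : ι × UnitAddCircle | γ x.1 x.2 = p} := by
        rw [hset]; exact Or.inr rfl
      exact this
    have hall : ∀ k : Fin 2, γ (![x, y] k).1 ((![x, y] k).2 : UnitAddCircle) = p := by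
      intro k; fin_cases k
      · exact hx
      · exact hy
    -- Half of the base point is subtracted from each branch, so that the sum of the two curves is
    -- exactly one branch when the parameter of the other is 0.
    refine ⟨![x, y], fun k z => chartAt Plane p
      (γ (![x, y] k).1 (((![x, y] k).2 + z : ℝ) : UnitAddCircle)) - (1 / 2 : ℝ) • chartAt Plane p p,
      ?_, ?_, ?_, fun k _ => hall k, ?_⟩
    · exact fun k => (hγ.deriv_chart_branch (hall k)).1.sub contDiffAt_const
    · simp only [deriv_sub_const]
      rw [(hγ.deriv_chart_branch (hall 0)).2, (hγ.deriv_chart_branch (hall 1)).2]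
      exact hd
    · intro k _ z
      fin_cases k
      · simp only [axis, Fin.zero_eta, Matrix.cons_val_zero, Matrix.cons_val_one,
          PiLp.single_apply, if_true, one_ne_zero, if_false, add_zero, hy]
        module
      · simp only [axis, Fin.mk_one, Matrix.cons_val_zero, Matrix.cons_val_one,
          PiLp.single_apply, if_true, zero_ne_one, if_false, add_zero, hx]
        module
    · intro j t h
      have : (j, t) ∈ {x : ι × UnitAddCircle | γ x.1 x.2 = p} := h
      rw [hset] at this
      rcases this with h | h
      · exact ⟨0, Or.inl rfl, congrArg Prod.fst h, congrArg Prod.snd h⟩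
      · exact ⟨1, Or.inr hc, congrArg Prod.fst h, congrArg Prod.snd h⟩
  · obtain ⟨i, t', ht'⟩ := mem_iUnion.1 hp
    obtain ⟨t, rfl⟩ := QuotientAddGroup.mk_surjective t'
    have hb := hγ.deriv_chart_branch ht'
    set X := velocity (fun s : ℝ => γ i (s : UnitAddCircle)) t
    have hk : ∀ k, IsAxisAt γ p k → k = 0 := fun k h => h.resolve_right hc
    -- The added line points along the velocity rotated by a right angle, which completes it to a
    -- positive frame.
    refine ⟨fun _ => (i, t), ![fun z => chartAt Plane p (γ i ((t + z : ℝ) : UnitAddCircle)),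
      fun z => z • !₂[-X 1, X 0]], ?_, ?_, ?_, fun k _ => ht', ?_⟩
    · intro k; fin_cases k
      · exact hb.1
      · show ContDiffAt ℝ 1 (fun z : ℝ => z • (!₂[-X 1, X 0] : Plane)) 0
        fun_prop
    · have h1 : deriv (fun z : ℝ => z • (!₂[-X 1, X 0] : Plane)) 0 = !₂[-X 1, X 0] := by
        simpa using ((hasDerivAt_id (0 : ℝ)).smul_const (!₂[-X 1, X 0] : Plane)).deriv
      simp only [Matrix.cons_val_zero, Matrix.cons_val_one]
      rw [hb.2, h1]
      exact det₂_rot_pos (hγ.regular i t)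
    · intro k hk' z
      obtain rfl := hk k hk'
      simp [axis]
    · intro j s hs
      refine ⟨0, Or.inl rfl, ?_⟩
      have hle : {x : ι × UnitAddCircle | γ x.1 x.2 = p}.encard ≤ 1 := by
        have h2 := hγ.double p
        exact Order.le_of_lt_succ (lt_of_le_of_ne h2 hc)
      have := Set.encard_le_one_iff.1 hle (j, s) (i, t) hs ht'
      exact ⟨congrArg Prod.fst this, congrArg Prod.snd this⟩

variable [T2Space M] [Finite ι]

/-- The straightening map, composed with the preferred chart, gives a chart with the right axes, but
other portions of the curves might still enter it. The times away from the chosen branches form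
compact sets whose images miss p, so a smaller disc avoids them. -/
theorem IsAdmissible.exists_straightChart (hγ : IsAdmissible γ) {p : M} (hp : p ∈ support γ) :
    ∃ e r b, IsStraightChart γ p e r b := by
  obtain ⟨b, c, hc, hdet, hbr, hb0, hall⟩ := hγ.exists_branches hp
  obtain ⟨H, hH0, hH, hHd⟩ := exists_straightening c hc hdet
  have hHax : ∀ k, IsAxisAt γ p k → ∀ z, H (axis k z) =
      chartAt Plane p (γ (b k).1 (((b k).2 + z : ℝ) : UnitAddCircle)) := fun k hk z => by
    rw [hH, hbr k hk]
  have hHp : H 0 = chartAt Plane p p := by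
    have := hHax 0 (Or.inl rfl) 0
    rw [add_zero, hb0 0 (Or.inl rfl)] at this
    rwa [axis_zero] at this
  set φ := chartAt Plane p
  set e₁ : OpenPartialHomeomorph M Plane := φ.trans H.symm with he₁
  have hpe : p ∈ e₁.source := by
    rw [he₁, OpenPartialHomeomorph.trans_source]
    refine ⟨mem_chart_source _ _, ?_⟩
    show φ p ∈ H.target
    rw [← hHp]; exact H.map_source hH0
  have hep : e₁ p = 0 := by
    show H.symm (φ p) = 0
    rw [← hHp]; exact H.left_inv hH0
  have hsymm : ∀ y, e₁.symm y = φ.symm (H y) := fun y => rfl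
  have htgt : ∀ y ∈ e₁.target, y ∈ H.source ∧ H y ∈ φ.target := fun y hy => by
    rw [he₁, OpenPartialHomeomorph.trans_target] at hy
    exact hy
  -- the first choice of the radius
  have hev : ∀ᶠ r in 𝓝[>] (0 : ℝ), 0 < r ∧ Metric.ball (0 : Plane) r ⊆ e₁.target ∧
      (∀ k, IsAxisAt γ p k → ∀ z : ℝ, |z| < r →
        γ (b k).1 (((b k).2 + z : ℝ) : UnitAddCircle) ∈ φ.source) ∧
      ∀ y ∈ Metric.ball (0 : Plane) r, ∃ L : Plane ≃L[ℝ] Plane,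
        HasFDerivAt H (L : Plane →L[ℝ] Plane) y ∧ 0 < jac (L : Plane →L[ℝ] Plane) := by
    have small : ∀ {E : Type} [SeminormedAddCommGroup E] {P : E → Prop}, (∀ᶠ y in 𝓝 (0 : E), P y) →
        ∀ᶠ r in 𝓝[>] (0 : ℝ), ∀ y : E, ‖y‖ < r → P y := by
      intro E _ P h
      obtain ⟨ε, hε, h⟩ := Metric.eventually_nhds_iff.1 h
      filter_upwards [mem_nhdsWithin_of_mem_nhds (Iio_mem_nhds hε)] with r hr y hy
      exact h (by rw [dist_zero_right]; exact hy.trans hr)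
    have h1 : ∀ᶠ y in 𝓝 (0 : Plane), y ∈ e₁.target :=
      e₁.open_target.mem_nhds (hep ▸ e₁.map_source hpe)
    have h2 : ∀ᶠ z in 𝓝 (0 : ℝ), ∀ k, IsAxisAt γ p k →
        γ (b k).1 (((b k).2 + z : ℝ) : UnitAddCircle) ∈ φ.source := by
      rw [Filter.eventually_all]
      intro k
      by_cases hk : IsAxisAt γ p k
      · have hcont : Continuous fun z : ℝ => γ (b k).1 (((b k).2 + z : ℝ) : UnitAddCircle) :=
          (hγ.continuous _).comp (continuous_quotient_mk'.comp (by fun_prop))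
        have := (hcont.tendsto 0).eventually (p := fun x => x ∈ φ.source)
          (φ.open_source.mem_nhds (by
            rw [add_zero, hb0 k hk]; exact mem_chart_source _ _))
        exact this.mono fun z hz _ => hz
      · exact Filter.Eventually.of_forall fun z h => absurd h hk
    filter_upwards [small h1, small h2, small hHd, self_mem_nhdsWithin] with r a1 a2 a3 a4
    refine ⟨a4, fun y hy => a1 y (by simpa using hy), fun k hk z hz => a2 z hz k hk,
      fun y hy => a3 y (by simpa using hy)⟩
  obtain ⟨r, hr, hball, hsrc, hder⟩ := hev.exists
  have hax : ∀ k, IsAxisAt γ p k → ∀ z : ℝ, |z| < r →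
      γ (b k).1 (((b k).2 + z : ℝ) : UnitAddCircle) = e₁.symm (axis k z) := fun k hk z hz => by
    rw [hsymm, hHax k hk, φ.left_inv (hsrc k hk z hz)]
  -- The times that belong to the branches shown on the axes. They form an open set, so the
  -- remaining times have a compact, hence closed, image.
  set K : ι → Set UnitAddCircle := fun j => {t | ∃ k, IsAxisAt γ p k ∧ ∃ z : ℝ, |z| < r ∧
    j = (b k).1 ∧ t = (((b k).2 + z : ℝ) : UnitAddCircle)} with hK
  have hKo : ∀ j, IsOpen (K j) := by
    intro j
    have : K j = ⋃ k, ⋃ (_ : IsAxisAt γ p k ∧ j = (b k).1),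
        (QuotientAddGroup.mk : ℝ → UnitAddCircle) '' ((fun z => (b k).2 + z) '' Metric.ball 0 r) := by
      ext t
      simp only [hK, mem_ofPred_eq, mem_iUnion, mem_image, Metric.mem_ball, dist_zero_right,
        Real.norm_eq_abs, exists_exists_and_eq_and, exists_prop]
      constructor
      · rintro ⟨k, hk, z, hz, hj, rfl⟩
        exact ⟨k, ⟨hk, hj⟩, z, hz, rfl⟩
      · rintro ⟨k, ⟨hk, hj⟩, z, hz, rfl⟩
        exact ⟨k, hk, z, hz, hj, rfl⟩
    rw [this]
    exact isOpen_iUnion fun k => isOpen_iUnion fun _ => QuotientAddGroup.isOpenMap_coe _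
      ((Homeomorph.addLeft (b k).2).isOpenMap _ Metric.isOpen_ball)
  have hC : IsClosed (⋃ j, γ j '' (K j)ᶜ) := isClosed_iUnion_of_finite fun j =>
    ((hKo j).isClosed_compl.isCompact.image (hγ.continuous j)).isClosed
  have hpC : e₁.symm 0 ∈ (⋃ j, γ j '' (K j)ᶜ)ᶜ := by
    rw [← hep, e₁.left_inv hpe]
    intro h
    obtain ⟨j, t, ht, hjt⟩ := mem_iUnion.1 h
    obtain ⟨k, hk, h1, h2⟩ := hall j t hjt
    exact ht ⟨k, hk, 0, by simpa using hr, h1, by simpa using h2⟩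
  have h0 : (0 : Plane) ∈ e₁.target := hep ▸ e₁.map_source hpe
  obtain ⟨r₀, hr₀, hr₀'⟩ := Metric.eventually_nhds_iff.1
    ((e₁.continuousAt_symm h0).eventually (hC.isOpen_compl.mem_nhds hpC))
  set ρ := min r r₀ with hρ
  have hρr : Metric.ball (0 : Plane) ρ ⊆ Metric.ball 0 r := Metric.ball_subset_ball (min_le_left _ _)
  set e₂ : OpenPartialHomeomorph M Plane := (e₁.symm.restrOpen (Metric.ball 0 ρ) Metric.isOpen_ball).symm
    with he₂
  have hs₂ : ∀ y, e₂.symm y = e₁.symm y := fun y => rfl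
  have hco : ∀ y, e₂ y = e₁ y := fun y => rfl
  have ht₂ : e₂.target = Metric.ball 0 ρ :=
    inter_eq_right.2 (hρr.trans hball)
  have hsub : e₂.source ⊆ e₁.source := fun x hx => by
    rw [← e₂.left_inv hx, hs₂]
    exact e₁.map_target (hball (hρr (ht₂ ▸ e₂.map_source hx)))
  refine ⟨e₂, ρ, b, lt_min hr hr₀, ?_, hep, ht₂, ?_, ?_, ?_, ?_⟩
  · have : (0 : Plane) ∈ e₂.target := by rw [ht₂]; simp [hρ, hr, hr₀]
    have := e₂.map_target this
    rwa [hs₂, ← hep, e₁.left_inv hpe] at this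
  · exact fun x hx => ((OpenPartialHomeomorph.trans_source φ H.symm) ▸ hsub hx).1
  · exact fun k hk z hz => hax k hk z (hz.trans_le (min_le_left _ _))
  · intro j t hjt
    have hmem : e₁ (γ j t) ∈ Metric.ball (0 : Plane) ρ := ht₂ ▸ e₂.map_source hjt
    have htK : t ∈ K j := by
      by_contra h
      refine hr₀' (y := e₁ (γ j t)) ((Metric.mem_ball.1 hmem).trans_le (min_le_right _ _)) ?_
      rw [e₁.left_inv (hsub hjt)]
      exact mem_iUnion.2 ⟨j, t, h, rfl⟩
    obtain ⟨k, hk, z, hz, rfl, rfl⟩ := htK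
    refine ⟨k, hk, z, ?_, rfl, rfl⟩
    rw [hax k hk z hz, e₁.right_inv (hball (abs_lt_of_axis_mem_ball.2 hz)),
      abs_lt_of_axis_mem_ball] at hmem
    exact hmem
  · intro y hy
    obtain ⟨L, hL, hpos⟩ := hder y (hρr hy)
    refine ⟨L, hL.congr_of_eventuallyEq ?_, hpos⟩
    filter_upwards [Metric.isOpen_ball.mem_nhds hy] with x hx
    rw [hs₂, hsymm]
    exact φ.right_inv (htgt x (hball (hρr hx))).2

end StraightCharts

/-! ### Signs of real numbers -/

section Signs

open Classical in
/-- The sign of a real number, as a unit of `ℤ` (the value at `0` is `-1`). -/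
noncomputable def sgn (x : ℝ) : ℤˣ := if 0 < x then 1 else -1

theorem sgn_of_pos {x : ℝ} (h : 0 < x) : sgn x = 1 := if_pos h

theorem sgn_of_neg {x : ℝ} (h : x < 0) : sgn x = -1 := if_neg h.not_gt

theorem sgn_mul {x y : ℝ} (hx : x ≠ 0) (hy : y ≠ 0) : sgn (x * y) = sgn x * sgn y := by
  rcases hx.lt_or_gt with h1 | h1 <;> rcases hy.lt_or_gt with h2 | h2
  · rw [sgn_of_neg h1, sgn_of_neg h2, sgn_of_pos (mul_pos_of_neg_of_neg h1 h2)]; rfl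
  · rw [sgn_of_neg h1, sgn_of_pos h2, sgn_of_neg (mul_neg_of_neg_of_pos h1 h2)]; rfl
  · rw [sgn_of_pos h1, sgn_of_neg h2, sgn_of_neg (mul_neg_of_pos_of_neg h1 h2)]; rfl
  · rw [sgn_of_pos h1, sgn_of_pos h2, sgn_of_pos (mul_pos h1 h2)]; rfl

theorem sgn_neg {x : ℝ} (hx : x ≠ 0) : sgn (-x) = -sgn x := by
  rcases hx.lt_or_gt with h1 | h1
  · rw [sgn_of_neg h1, sgn_of_pos (neg_pos.2 h1)]; rfl
  · rw [sgn_of_pos h1, sgn_of_neg (neg_neg_iff_pos.2 h1)]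

theorem sgn_eq_sgn_iff {x y : ℝ} (hx : x ≠ 0) (hy : y ≠ 0) : sgn x = sgn y ↔ 0 < x * y := by
  rcases hx.lt_or_gt with h1 | h1 <;> rcases hy.lt_or_gt with h2 | h2
  · simp [sgn_of_neg h1, sgn_of_neg h2, mul_pos_of_neg_of_neg h1 h2]
  · simp [sgn_of_neg h1, sgn_of_pos h2, (mul_neg_of_neg_of_pos h1 h2).le]
  · simp [sgn_of_pos h1, sgn_of_neg h2, (mul_neg_of_pos_of_neg h1 h2).le]
  · simp [sgn_of_pos h1, sgn_of_pos h2, mul_pos h1 h2]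

theorem eventually_sgn_eq {X : Type*} [TopologicalSpace X] {f : X → ℝ} {l : Filter X} {a : ℝ}
    (hf : Filter.Tendsto f l (𝓝 a)) (ha : a ≠ 0) : ∀ᶠ y in l, sgn (f y) = sgn a := by
  rcases ha.lt_or_gt with h | h
  · filter_upwards [hf.eventually (gt_mem_nhds h)] with y hy
    rw [sgn_of_neg h, sgn_of_neg hy]
  · filter_upwards [hf.eventually (lt_mem_nhds h)] with y hy
    rw [sgn_of_pos h, sgn_of_pos hy]

/-- Here f is the slope times y, and the slope has the sign of d near 0. This turns a derivative
into information about sides of a curve. -/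
theorem eventually_sgn_eq_of_hasDerivAt {f : ℝ → ℝ} {d : ℝ} (hf : HasDerivAt f d 0) (h0 : f 0 = 0)
    (hd : d ≠ 0) : ∀ᶠ y in 𝓝[≠] (0 : ℝ), sgn (f y) = sgn d * sgn y ∧ f y ≠ 0 := by
  have h := hasDerivAt_iff_tendsto_slope.1 hf
  filter_upwards [eventually_sgn_eq h hd, h.eventually_ne hd, self_mem_nhdsWithin] with y h1 h2 hy
  have hy : y ≠ 0 := hy
  have hs : f y = slope f 0 y * y := by
    rw [slope_def_field, h0, sub_zero, sub_zero, div_mul_cancel₀ _ hy]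
  rw [hs]
  exact ⟨by rw [sgn_mul h2 hy, h1], mul_ne_zero h2 hy⟩

end Signs

/-! ### Local picture of the curves in a straight chart -/

section Transition

variable {M : Type*} [TopologicalSpace M] [ChartedSpace Plane M]
  {ι : Type*} {γ : ι → UnitAddCircle → M}

/-- A choice of straight charts at all points of the union of the curves. -/
structure StraightAtlas (γ : ι → UnitAddCircle → M) where
  /-- the chart at a point -/
  e : M → OpenPartialHomeomorph M Plane
  /-- its radius -/
  r : M → ℝ
  /-- its branches -/
  b : M → Fin 2 → ι × ℝ
  isStraight : ∀ p ∈ support γ, IsStraightChart γ p (e p) (r p) (b p)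

theorem IsAdmissible.nonempty_straightAtlas [IsManifold (𝓡 2) ∞ M] [T2Space M] [Finite ι]
    (hγ : IsAdmissible γ) : Nonempty (StraightAtlas γ) := by
  classical
  obtain ⟨p₀, hp₀⟩ := hγ.connected.nonempty
  have h : ∀ p, ∃ (e : OpenPartialHomeomorph M Plane) (r : ℝ) (b : Fin 2 → ι × ℝ),
      p ∈ support γ → IsStraightChart γ p e r b := by
    intro p
    by_cases hp : p ∈ support γ
    · obtain ⟨e, r, b, h⟩ := hγ.exists_straightChart hp
      exact ⟨e, r, b, fun _ => h⟩
    · obtain ⟨e, r, b, h⟩ := hγ.exists_straightChart hp₀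
      exact ⟨e, r, b, fun h => absurd h hp⟩
  choose e r b h using h
  exact ⟨⟨e, r, b, h⟩⟩

theorem IsAdmissible.eq_of_not_isCrossing (hγ : IsAdmissible γ) {p : M} (hp : ¬ IsCrossing γ p)
    {i j : ι} {s t : UnitAddCircle} (hs : γ i s = p) (ht : γ j t = p) : i = j ∧ s = t := by
  have hle : {x : ι × UnitAddCircle | γ x.1 x.2 = p}.encard ≤ 1 :=
    Order.le_of_lt_succ (lt_of_le_of_ne (hγ.double p) hp)
  have := Set.encard_le_one_iff.1 hle (i, s) (j, t) hs ht
  exact ⟨congrArg Prod.fst this, congrArg Prod.snd this⟩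

theorem axis_injective {k k' : Fin 2} {z z' : ℝ} (hz : z ≠ 0) (h : axis k z = axis k' z') :
    k = k' ∧ z = z' := by
  have h0 := congrArg (fun v : Plane => v 0) h
  have h1 := congrArg (fun v : Plane => v 1) h
  clear h
  fin_cases k <;> fin_cases k' <;> simp_all

namespace IsStraightChart

variable {p : M} {e : OpenPartialHomeomorph M Plane} {r : ℝ} {b : Fin 2 → ι × ℝ}
  (h : IsStraightChart γ p e r b)

include h

theorem axis_mem_target {k : Fin 2} {z : ℝ} (hz : |z| < r) : axis k z ∈ e.target := by
  rw [h.target]; exact abs_lt_of_axis_mem_ball.2 hz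

theorem apply_branch {k : Fin 2} (hk : IsAxisAt γ p k) {z : ℝ} (hz : |z| < r) :
    e (γ (b k).1 (((b k).2 + z : ℝ) : UnitAddCircle)) = axis k z := by
  rw [h.branch k hk z hz, e.right_inv (h.axis_mem_target hz)]

theorem symm_axis_mem_support {k : Fin 2} (hk : IsAxisAt γ p k) {z : ℝ} (hz : |z| < r) :
    e.symm (axis k z) ∈ support γ := by
  rw [← h.branch k hk z hz]; exact mem_iUnion.2 ⟨_, mem_range_self _⟩

theorem symm_zero : e.symm 0 = p := by
  rw [← h.map_self, e.left_inv h.mem]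

theorem exists_axis {x : M} (hx : x ∈ e.source) (hxs : x ∈ support γ) :
    ∃ k, IsAxisAt γ p k ∧ ∃ z, |z| < r ∧ e x = axis k z := by
  obtain ⟨j, t, rfl⟩ := mem_iUnion.1 hxs
  obtain ⟨k, hk, z, hz, rfl, rfl⟩ := h.of_mem j t hx
  exact ⟨k, hk, z, hz, h.apply_branch hk hz⟩

theorem mem_support_iff {x : M} (hx : x ∈ e.source) :
    x ∈ support γ ↔ e x 1 = 0 ∨ (IsCrossing γ p ∧ e x 0 = 0) := by
  constructor
  · intro hxs
    obtain ⟨k, hk, z, hz, hxz⟩ := h.exists_axis hx hxs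
    rw [hxz]
    rcases Fin.exists_fin_two.1 ⟨k, rfl⟩ with rfl | rfl
    · left; simp
    · right; exact ⟨hk.resolve_left (by simp), by simp⟩
  · have key : ∀ k, IsAxisAt γ p k → e x = axis k (e x k) → x ∈ support γ := by
      intro k hk hxk
      have hz : |e x k| < r := by
        rw [← abs_lt_of_axis_mem_ball (k := k), ← hxk, ← h.target]; exact e.map_source hx
      rw [← e.left_inv hx, hxk]
      exact h.symm_axis_mem_support hk hz
    rintro (hx1 | ⟨hc, hx0⟩)
    · refine key 0 (Or.inl rfl) ?_
      ext i; fin_cases i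
      · simp
      · simpa using hx1
    · refine key 1 (Or.inr hc) ?_
      ext i; fin_cases i
      · simpa using hx0
      · simp

/-- A point of the chart other than its centre lies on one axis at one nonzero coordinate, and these
determine the curve and the time. So crossings are isolated. -/
theorem not_isCrossing {q : M} (hq : q ∈ e.source) (hqp : q ≠ p) : ¬ IsCrossing γ q := by
  intro hc
  obtain ⟨⟨i, s⟩, ⟨j, t⟩, hne, hset⟩ := Set.encard_eq_two.1 hc
  have h1 : γ i s = q := by
    have : ((i, s) : ι × UnitAddCircle) ∈ {x | γ x.1 x.2 = q} := by rw [hset]; exact Or.inl rfl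
    exact this
  have h2 : γ j t = q := by
    have : ((j, t) : ι × UnitAddCircle) ∈ {x | γ x.1 x.2 = q} := by rw [hset]; exact Or.inr rfl
    exact this
  obtain ⟨k, hk, z, hz, rfl, rfl⟩ := h.of_mem i s (h1 ▸ hq)
  obtain ⟨k', hk', z', hz', rfl, rfl⟩ := h.of_mem j t (h2 ▸ hq)
  have e1 : e q = axis k z := by rw [← h1, h.apply_branch hk hz]
  have e2 : e q = axis k' z' := by rw [← h2, h.apply_branch hk' hz']
  have hz0 : z ≠ 0 := by
    rintro rfl
    rw [axis_zero] at e1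
    exact hqp (e.injOn hq h.mem (e1.trans h.map_self.symm))
  obtain ⟨rfl, rfl⟩ := axis_injective hz0 (e1.symm.trans e2)
  exact hne rfl

theorem eventually_mem : ∀ᶠ x in 𝓝 p, x ∈ e.source := e.open_source.mem_nhds h.mem

theorem exists_norm_lt {P : M → Prop} (hP : ∀ᶠ x in 𝓝 p, P x) :
    ∃ ρ > 0, ρ ≤ r ∧ ∀ y, ‖y‖ < ρ → P (e.symm y) := by
  have h0 : (0 : Plane) ∈ e.target := by rw [h.target]; simpa using h.pos
  have := (e.continuousAt_symm h0).eventually (p := P) (by rwa [h.symm_zero])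
  obtain ⟨ρ, hρ, hρ'⟩ := Metric.eventually_nhds_iff.1 this
  exact ⟨min ρ r, lt_min hρ h.pos, min_le_right _ _, fun y hy =>
    hρ' (by rw [dist_zero_right]; exact hy.trans_le (min_le_left _ _))⟩

theorem eventually_norm_lt {ρ : ℝ} (hρ : 0 < ρ) : ∀ᶠ x in 𝓝 p, x ∈ e.source ∧ ‖e x‖ < ρ := by
  refine h.eventually_mem.and ?_
  have := (e.continuousAt h.mem).norm
  rw [ContinuousAt, h.map_self, norm_zero] at this
  exact this.eventually (gt_mem_nhds hρ)

/-- A function which is locally constant off the curves near `p` is constant on the sectors of a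
small disc around `p`. -/
theorem eq_on_sectors {Y : Type*} {f : M → Y}
    (hf : ∀ᶠ x in 𝓝 p, x ∉ support γ → ∀ᶠ y in 𝓝 x, f y = f x) :
    ∃ ρ > 0, ρ ≤ r ∧ ∀ S : Set Plane, S ⊆ Metric.ball 0 ρ → Convex ℝ S →
      (∀ y ∈ S, e.symm y ∉ support γ) → ∀ y ∈ S, ∀ y' ∈ S, f (e.symm y) = f (e.symm y') := by
  obtain ⟨ρ, hρ, hρr, hP⟩ := h.exists_norm_lt hf
  refine ⟨ρ, hρ, hρr, fun S hS hconv hSs y hy y' hy' => ?_⟩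
  refine eq_of_eventually_eq hconv.isPreconnected (f := fun y => f (e.symm y)) (fun x hx => ?_)
    hy hy'
  have hxn : ‖x‖ < ρ := by simpa using hS hx
  have hxt : x ∈ e.target := by rw [h.target]; simpa using hxn.trans_le hρr
  exact ((e.continuousAt_symm hxt).eventually (hP x hxn (hSs x hx))).filter_mono
    nhdsWithin_le_nhds

/-- At a point which is not a crossing, a function which is locally constant off the curves has
one value on each side. -/
theorem exists_sides {Y : Type*} {f : M → Y} (hp : ¬ IsCrossing γ p)
    (hf : ∀ᶠ x in 𝓝 p, x ∉ support γ → ∀ᶠ y in 𝓝 x, f y = f x) :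
    ∃ u v : Y, ∃ ρ > 0, ρ ≤ r ∧ ∀ x ∈ e.source, ‖e x‖ < ρ →
      (0 < e x 1 → f x = u) ∧ (e x 1 < 0 → f x = v) := by
  obtain ⟨ρ, hρ, hρr, hS⟩ := h.eq_on_sectors hf
  have hproj : IsLinearMap ℝ (fun y : Plane => y 1) := ⟨fun _ _ => rfl, fun _ _ => rfl⟩
  have hne : ∀ y : Plane, ‖y‖ < ρ → y 1 ≠ 0 → e.symm y ∉ support γ := by
    intro y hy hy1 hmem
    have hyt : y ∈ e.target := by rw [h.target]; simpa using hy.trans_le hρr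
    rw [h.mem_support_iff (e.map_target hyt), e.right_inv hyt] at hmem
    exact hmem.elim hy1 fun h => hp h.1
  have hhalf : |ρ / 2| < ρ := by rw [abs_of_pos (by linarith)]; linarith
  have hhalf' : |-(ρ / 2)| < ρ := by rw [abs_neg]; exact hhalf
  refine ⟨f (e.symm (axis 1 (ρ / 2))), f (e.symm (axis 1 (-(ρ / 2)))), ρ, hρ, hρr,
    fun x hx hxρ => ⟨fun h1 => ?_, fun h1 => ?_⟩⟩
  · have := hS (Metric.ball 0 ρ ∩ {y : Plane | 0 < y 1}) inter_subset_left
      ((convex_ball _ _).inter (convex_halfSpace_gt hproj 0))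
      (fun y hy => hne y (by simpa using hy.1) hy.2.ne') (e x) ⟨by simpa using hxρ, h1⟩
      (axis 1 (ρ / 2)) ⟨abs_lt_of_axis_mem_ball.2 hhalf, by simpa using hρ⟩
    rwa [e.left_inv hx] at this
  · have := hS (Metric.ball 0 ρ ∩ {y : Plane | y 1 < 0}) inter_subset_left
      ((convex_ball _ _).inter (convex_halfSpace_lt hproj 0))
      (fun y hy => hne y (by simpa using hy.1) hy.2.ne) (e x) ⟨by simpa using hxρ, h1⟩
      (axis 1 (-(ρ / 2))) ⟨abs_lt_of_axis_mem_ball.2 hhalf', by simpa using hρ⟩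
    rwa [e.left_inv hx] at this

/-- There are points off the curves near every point of the curves. -/
theorem frequently_notMem : ∃ᶠ x in 𝓝 p, x ∉ support γ := by
  rw [Filter.frequently_iff]
  intro U hU
  obtain ⟨ρ, hρ, hρr, hP⟩ := h.exists_norm_lt (P := fun x => x ∈ U) hU
  -- A point on the diagonal is off both axes; the value ρ / 3 keeps the sum of the two norms below
  -- ρ.
  set y : Plane := axis 0 (ρ / 3) + axis 1 (ρ / 3)
  have hy : ‖y‖ < ρ := by
    refine (norm_add_le _ _).trans_lt ?_
    simp only [axis, PiLp.norm_single, Real.norm_eq_abs, abs_of_pos (show 0 < ρ / 3 by linarith)]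
    linarith
  have hyt : y ∈ e.target := by rw [h.target]; simpa using hy.trans_le hρr
  refine ⟨e.symm y, hP y hy, ?_⟩
  rw [h.mem_support_iff (e.map_target hyt), e.right_inv hyt]
  have h0 : y 0 = ρ / 3 := by simp [y]
  have h1 : y 1 = ρ / 3 := by simp [y]
  rw [h0, h1]
  rintro (h | ⟨-, h⟩) <;> linarith

end IsStraightChart

end Transition

/-! ### The double covering of local orientations -/

section FrameSign

variable {M : Type*} [TopologicalSpace M] [ChartedSpace Plane M] [IsManifold (𝓡 2) ∞ M]

/-- The derivative of the transition map from the preferred chart at `q` to the one at `p`, at a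
point `x`. -/
noncomputable def coordChange (q p x : M) : Plane →L[ℝ] Plane := tangentCoordChange (𝓡 2) q p x

/-- The sign which compares the orientations of the preferred charts at `p` and at `q`. -/
noncomputable def frameSign (p q : M) : ℤˣ := sgn (jac (coordChange q p q))

theorem coordChange_comp {w x y z : M} (hw : z ∈ (chartAt Plane w).source)
    (hx : z ∈ (chartAt Plane x).source) (hy : z ∈ (chartAt Plane y).source) :
    (coordChange x y z).comp (coordChange w x z) = coordChange w y z := by
  ext1 v
  exact tangentCoordChange_comp (I := 𝓡 2) (v := v)
    ⟨⟨by simpa using hw, by simpa using hx⟩, by simpa using hy⟩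

theorem coordChange_self {x z : M} (hx : z ∈ (chartAt Plane x).source) :
    coordChange x x z = ContinuousLinearMap.id ℝ Plane := by
  ext1 v
  exact tangentCoordChange_self (I := 𝓡 2) (v := v) (by simpa using hx)

theorem jac_coordChange_ne_zero {x y z : M}
    (hx : z ∈ (chartAt Plane x).source) (hy : z ∈ (chartAt Plane y).source) :
    jac (coordChange x y z) ≠ 0 := by
  have h := congrArg jac ((coordChange_comp hy hx hy).trans (coordChange_self hy))
  rw [jac_comp, jac_id] at h
  exact left_ne_zero_of_mul_eq_one h

theorem hasFDerivAt_coordChange {x y z : M}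
    (hx : z ∈ (chartAt Plane x).source) (hy : z ∈ (chartAt Plane y).source) :
    HasFDerivAt (fun v => chartAt Plane y ((chartAt Plane x).symm v)) (coordChange x y z)
      (chartAt Plane x z) := by
  have := hasFDerivWithinAt_tangentCoordChange (I := 𝓡 2) (x := x) (y := y) (z := z)
    ⟨by simpa using hx, by simpa using hy⟩
  rw [ModelWithCorners.range_eq_univ, hasFDerivWithinAt_univ] at this
  exact this

@[simp] theorem frameSign_self (p : M) : frameSign p p = 1 := by
  rw [frameSign, coordChange_self (mem_chart_source _ _), jac_id, sgn_of_pos one_pos]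

end FrameSign

/-! ### The double covering of local colourings and its transition signs -/

section Transition

theorem eventually_lt_of_continuousAt {X : Type*} [TopologicalSpace X] {f : X → ℝ} {x : X} {a : ℝ}
    (hf : ContinuousAt f x) (h : f x < a) : ∀ᶠ y in 𝓝 x, f y < a :=
  hf.eventually (gt_mem_nhds h)

variable {M : Type*} [TopologicalSpace M] [ChartedSpace Plane M]
  {ι : Type*} {γ : ι → UnitAddCircle → M} (𝒜 : StraightAtlas γ)

open Classical in
/-- The local colouring near `p` of the complement of the curves. -/
noncomputable def localColor (p x : M) : ℤˣ :=
  sgn (𝒜.e p x 1) * if IsCrossing γ p then sgn (𝒜.e p x 0) else 1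

open Classical in
/-- The product of the transition signs of local colourings and of local orientations. -/
noncomputable def turnSign (p q : M) : ℤˣ :=
  if q = p then 1
  else if 𝒜.e p q 1 = 0 then (if IsCrossing γ p then sgn (𝒜.e p q 0) else 1)
  -- For a branch running along axis 0 the left side is that of positive second coordinate, whereas
  -- for one running along axis 1 it is that of negative first coordinate. This accounts for the
  -- minus sign.
  else -sgn (𝒜.e p q 1)

@[simp] theorem turnSign_self (p : M) : turnSign 𝒜 p p = 1 := if_pos rfl

/-- Near a point `q` of a branch through `p` the straight chart at `q` is a translate of the
straight chart at `p`, up to the choice of the axis. -/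
theorem eventually_symm_axis_eq (hγ : IsAdmissible γ) {p q : M} (hp : p ∈ support γ)
    (hq : q ∈ support γ)
    (hqp : q ≠ p) (hqs : q ∈ (𝒜.e p).source) {k : Fin 2} (hk : IsAxisAt γ p k) {z : ℝ}
    (hz : 𝒜.e p q = axis k z) :
    ∀ᶠ w in 𝓝 (0 : ℝ), (𝒜.e q).symm (axis 0 w) = (𝒜.e p).symm (axis k (z + w)) := by
  have hP := 𝒜.isStraight p hp
  have hQ := 𝒜.isStraight q hq
  have hzr : |z| < 𝒜.r p := by
    rw [← abs_lt_of_axis_mem_ball (k := k), ← hz, ← hP.target]; exact (𝒜.e p).map_source hqs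
  have h1 : γ (𝒜.b q 0).1 (((𝒜.b q 0).2 + 0 : ℝ) : UnitAddCircle) = q := by
    rw [hQ.branch 0 (Or.inl rfl) 0 (by simpa using hQ.pos), axis_zero, hQ.symm_zero]
  have h2 : γ (𝒜.b p k).1 (((𝒜.b p k).2 + z : ℝ) : UnitAddCircle) = q := by
    rw [hP.branch k hk z hzr, ← hz, (𝒜.e p).left_inv hqs]
  obtain ⟨hi, ht⟩ := hγ.eq_of_not_isCrossing (hP.not_isCrossing hqs hqp) h1 h2
  have e1 : ∀ᶠ w in 𝓝 (0 : ℝ), |w| < 𝒜.r q :=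
    eventually_lt_of_continuousAt continuous_abs.continuousAt (by simpa using hQ.pos)
  have e2 : ∀ᶠ w in 𝓝 (0 : ℝ), |z + w| < 𝒜.r p := by
    have : Continuous fun w : ℝ => |z + w| := by fun_prop
    exact eventually_lt_of_continuousAt this.continuousAt (by simpa using hzr)
  filter_upwards [e1, e2] with w hw1 hw2
  rw [← hQ.branch 0 (Or.inl rfl) w hw1, ← hP.branch k hk _ hw2, hi]
  congr 1
  rw [add_zero] at ht
  rw [AddCircle.coe_add, ht, ← AddCircle.coe_add, add_assoc]

/-- Near q, which is not a crossing, Γ is only the first axis of the chart at q. The translation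
relation therefore becomes a formula for coordinates, through which monotonicity along a branch
passes from one chart to the other. -/
theorem eventually_apply_eq_axis (hγ : IsAdmissible γ) {p q : M} (hp : p ∈ support γ)
    (hq : q ∈ support γ)
    (hqp : q ≠ p) (hqs : q ∈ (𝒜.e p).source) {k : Fin 2} (hk : IsAxisAt γ p k) {z : ℝ}
    (hz : 𝒜.e p q = axis k z) :
    ∀ᶠ x in 𝓝 q, x ∈ support γ → 𝒜.e p x = axis k (z + 𝒜.e q x 0) := by
  have hP := 𝒜.isStraight p hp
  have hQ := 𝒜.isStraight q hq
  have hcont : ContinuousAt (fun x => 𝒜.e q x 0) q := by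
    have h0 : Continuous fun y : Plane => y 0 := by fun_prop
    exact h0.continuousAt.comp ((𝒜.e q).continuousAt hQ.mem)
  have h0 : 𝒜.e q q 0 = 0 := by rw [hQ.map_self]; rfl
  have hzr : |z| < 𝒜.r p := by
    rw [← abs_lt_of_axis_mem_ball (k := k), ← hz, ← hP.target]; exact (𝒜.e p).map_source hqs
  have e1 := hcont.eventually (p := fun w => (𝒜.e q).symm (axis 0 w) =
    (𝒜.e p).symm (axis k (z + w))) (by
      simp only [h0]; exact eventually_symm_axis_eq 𝒜 hγ hp hq hqp hqs hk hz)
  have e2 : ∀ᶠ x in 𝓝 q, |z + 𝒜.e q x 0| < 𝒜.r p := by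
    have : ContinuousAt (fun x => |z + 𝒜.e q x 0|) q := (continuousAt_const.add hcont).abs
    exact eventually_lt_of_continuousAt this (by rw [h0, add_zero]; exact hzr)
  filter_upwards [e1, e2, hQ.eventually_mem] with x h1 h2 h3 hx
  obtain ⟨k', hk', w, hw, hxw⟩ := hQ.exists_axis h3 hx
  obtain rfl : k' = 0 := hk'.resolve_right (hP.not_isCrossing hqs hqp)
  have hw0 : 𝒜.e q x 0 = w := by rw [hxw]; simp
  rw [hw0] at h1 h2 ⊢
  rw [← (𝒜.e q).left_inv h3, hxw, h1, (𝒜.e p).right_inv (hP.axis_mem_target h2)]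

theorem localColor_locConst {p : M} (hp : p ∈ support γ) {x : M} (hx : x ∈ (𝒜.e p).source)
    (hxs : x ∉ support γ) : ∀ᶠ y in 𝓝 x, localColor 𝒜 p y = localColor 𝒜 p x := by
  have hP := 𝒜.isStraight p hp
  rw [hP.mem_support_iff hx] at hxs
  push Not at hxs
  have hcont : ∀ k : Fin 2, ContinuousAt (fun x => 𝒜.e p x k) x := fun k => by
    have h0 : Continuous fun y : Plane => y k := by fun_prop
    exact h0.continuousAt.comp ((𝒜.e p).continuousAt hx)
  unfold localColor
  have h1 := eventually_sgn_eq (hcont 1) hxs.1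
  by_cases hc : IsCrossing γ p
  · filter_upwards [h1, eventually_sgn_eq (hcont 0) (hxs.2 hc)] with y hy1 hy0
    simp only [hc, if_true, hy1, hy0]
  · filter_upwards [h1] with y hy1
    simp only [hc, if_false, hy1]

/-- At a point which is not a crossing, a locally constant function which takes opposite values on
the two sides is up to a sign the local colouring. -/
theorem eventually_eq_mul_localColor {q : M} (hq : q ∈ support γ) (hqc : ¬ IsCrossing γ q)
    {f : M → ℤˣ} (hf : ∀ᶠ x in 𝓝 q, x ∉ support γ → ∀ᶠ y in 𝓝 x, f y = f x) {c : ℤˣ}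
    (hc : ∀ᶠ y in 𝓝[≠] (0 : ℝ), f ((𝒜.e q).symm (axis 1 y)) = c * sgn y) :
    ∀ᶠ x in 𝓝 q, x ∉ support γ → f x = c * localColor 𝒜 q x := by
  have hQ := 𝒜.isStraight q hq
  obtain ⟨u, v, ρ, hρ, hρr, h⟩ := hQ.exists_sides hqc hf
  have hball : ∀ᶠ y in 𝓝 (0 : ℝ), |y| < ρ :=
    eventually_lt_of_continuousAt continuous_abs.continuousAt (by simpa using hρ)
  have hax : ∀ y : ℝ, |y| < ρ → axis 1 y ∈ (𝒜.e q).target := fun y hy =>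
    hQ.axis_mem_target (hy.trans_le hρr)
  have hu : u = c := by
    obtain ⟨y, ⟨h1, h2⟩, h3⟩ := (((hc.filter_mono (nhdsWithin_mono 0
      (fun y hy => ne_of_gt hy : Ioi (0 : ℝ) ⊆ {0}ᶜ))).and
      (hball.filter_mono nhdsWithin_le_nhds)).and self_mem_nhdsWithin).exists
    have h3 : 0 < y := h3
    rw [← (h _ ((𝒜.e q).map_target (hax y h2)) (by
      rw [(𝒜.e q).right_inv (hax y h2)]; simpa [axis] using h2)).1 (by
      rw [(𝒜.e q).right_inv (hax y h2)]; simpa using h3), h1, sgn_of_pos h3, mul_one]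
  have hv : v = -c := by
    obtain ⟨y, ⟨h1, h2⟩, h3⟩ := (((hc.filter_mono (nhdsWithin_mono 0
      (fun y hy => ne_of_lt hy : Iio (0 : ℝ) ⊆ {0}ᶜ))).and
      (hball.filter_mono nhdsWithin_le_nhds)).and self_mem_nhdsWithin).exists
    have h3 : y < 0 := h3
    rw [← (h _ ((𝒜.e q).map_target (hax y h2)) (by
      rw [(𝒜.e q).right_inv (hax y h2)]; simpa [axis] using h2)).2 (by
      rw [(𝒜.e q).right_inv (hax y h2)]; simpa using h3), h1, sgn_of_neg h3, mul_neg, mul_one]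
  filter_upwards [hQ.eventually_norm_lt hρ] with x hx hxs
  rw [hQ.mem_support_iff hx.1] at hxs
  push Not at hxs
  simp only [localColor, hqc, if_false, mul_one]
  rcases hxs.1.lt_or_gt with h1 | h1
  · rw [(h x hx.1 hx.2).2 h1, hv, sgn_of_neg h1, mul_neg, mul_one]
  · rw [(h x hx.1 hx.2).1 h1, hu, sgn_of_pos h1, mul_one]

variable [IsManifold (𝓡 2) ∞ M]

/-- The transition sign of the local colourings. -/
noncomputable def colorSign (p q : M) : ℤˣ := turnSign 𝒜 p q * frameSign p q

theorem colorSign_mul_frameSign (p q : M) :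
    colorSign 𝒜 p q * frameSign p q = turnSign 𝒜 p q := by
  rw [colorSign, mul_assoc, Int.units_mul_self, mul_one]

/-- The transition factors through the preferred charts at q and p. The outer factors have positive
Jacobian since straight charts are positively oriented, so only the sign of the coordinate change
remains. -/
theorem exists_hasFDerivAt_transition {p q : M} (hp : p ∈ support γ) (hq : q ∈ support γ)
    (hqs : q ∈ (𝒜.e p).source) :
    ∃ L : Plane →L[ℝ] Plane, HasFDerivAt (fun y => 𝒜.e p ((𝒜.e q).symm y)) L 0 ∧ jac L ≠ 0 ∧
      sgn (jac L) = frameSign p q := by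
  have hP := 𝒜.isStraight p hp
  have hQ := 𝒜.isStraight q hq
  have hqp : q ∈ (chartAt Plane p).source := hP.source_subset hqs
  have hqq : q ∈ (chartAt Plane q).source := mem_chart_source _ _
  obtain ⟨Lq, hLq, hLqpos⟩ := hQ.deriv 0 (by simpa using hQ.pos)
  obtain ⟨Lp, hLp, hLppos⟩ := hP.deriv (𝒜.e p q) (by
    rw [← hP.target]; exact (𝒜.e p).map_source hqs)
  have hT := hasFDerivAt_coordChange hqq hqp
  have hcont : ContinuousAt (chartAt Plane p).symm (chartAt Plane p q) :=
    (chartAt Plane p).continuousAt_symm ((chartAt Plane p).map_source hqp)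
  have hback : (chartAt Plane p).symm (chartAt Plane p q) = q := (chartAt Plane p).left_inv hqp
  have hinv : HasFDerivAt (fun v => 𝒜.e p ((chartAt Plane p).symm v))
      (Lp.symm : Plane →L[ℝ] Plane) (chartAt Plane p q) := by
    refine HasFDerivAt.of_local_left_inverse (f := fun y => chartAt Plane p ((𝒜.e p).symm y))
      ?_ ?_ ?_
    · refine ContinuousAt.comp ?_ hcont
      rw [hback]; exact (𝒜.e p).continuousAt hqs
    · rw [hback]; exact hLp
    · have h1 := hcont.eventually (p := fun x => x ∈ (𝒜.e p).source)
        (by rw [hback]; exact (𝒜.e p).open_source.mem_nhds hqs)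
      filter_upwards [h1, (chartAt Plane p).open_target.mem_nhds ((chartAt Plane p).map_source hqp)]
        with v h1 h2
      rw [(𝒜.e p).left_inv h1, (chartAt Plane p).right_inv h2]
  have hsp : 0 < jac (Lp.symm : Plane →L[ℝ] Plane) :=
    pos_of_mul_pos_right (by rw [jac_symm]; exact one_pos) hLppos.le
  have hTq : HasFDerivAt (fun v => chartAt Plane p ((chartAt Plane q).symm v))
      (coordChange q p q) (chartAt Plane q ((𝒜.e q).symm 0)) := by
    rw [hQ.symm_zero]; exact hT
  have h2 := hTq.comp (0 : Plane) hLq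
  have hval : chartAt Plane p ((chartAt Plane q).symm (chartAt Plane q ((𝒜.e q).symm 0))) =
      chartAt Plane p q := by
    rw [hQ.symm_zero, (chartAt Plane q).left_inv hqq]
  have h3 := HasFDerivAt.comp (g := fun v => 𝒜.e p ((chartAt Plane p).symm v)) (0 : Plane)
    (by rw [← hval] at hinv; exact hinv) h2
  have hj : jac ((Lp.symm : Plane →L[ℝ] Plane).comp ((coordChange q p q).comp
      (Lq : Plane →L[ℝ] Plane))) = (jac (Lp.symm : Plane →L[ℝ] Plane) *
        jac (Lq : Plane →L[ℝ] Plane)) * jac (coordChange q p q) := by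
    rw [jac_comp, jac_comp]; ring
  have hTne := jac_coordChange_ne_zero hqq hqp
  refine ⟨_, h3.congr_of_eventuallyEq ?_, ?_, ?_⟩
  · have h0 : (0 : Plane) ∈ (𝒜.e q).target := by rw [hQ.target]; simpa using hQ.pos
    have e1 := ((𝒜.e q).continuousAt_symm h0).eventually (p := fun x => x ∈ (chartAt Plane p).source ∧
      x ∈ (chartAt Plane q).source) (by
        rw [hQ.symm_zero]
        exact Filter.inter_mem ((chartAt Plane p).open_source.mem_nhds hqp)
          ((chartAt Plane q).open_source.mem_nhds hqq))
    filter_upwards [e1] with y hy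
    simp only [Function.comp_apply]
    rw [(chartAt Plane q).left_inv hy.2, (chartAt Plane p).left_inv hy.1]
  · rw [hj]
    exact mul_ne_zero (mul_pos hsp hLqpos).ne' hTne
  · rw [hj, sgn_mul (mul_pos hsp hLqpos).ne' hTne, sgn_of_pos (mul_pos hsp hLqpos), one_mul]
    rfl

/-- Local colourings at different points agree up to the sign `colorSign`. -/
theorem localColor_transition (hγ : IsAdmissible γ) {p q : M} (hp : p ∈ support γ)
    (hq : q ∈ support γ) (hqs : q ∈ (𝒜.e p).source) :
    ∀ᶠ x in 𝓝 q, x ∉ support γ → localColor 𝒜 p x = colorSign 𝒜 p q * localColor 𝒜 q x := by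
  by_cases hqp : q = p
  · subst hqp
    exact Filter.Eventually.of_forall fun x _ => by simp [colorSign]
  have hP := 𝒜.isStraight p hp
  have hQ := 𝒜.isStraight q hq
  have hqc := hP.not_isCrossing hqs hqp
  refine eventually_eq_mul_localColor 𝒜 hq hqc ?_ ?_
  · filter_upwards [(𝒜.e p).open_source.mem_nhds hqs] with x hx hxs
    exact localColor_locConst 𝒜 hp hx hxs
  obtain ⟨L, hL, hjac, hsgn⟩ := exists_hasFDerivAt_transition 𝒜 hp hq hqs
  obtain ⟨k, hk, z, hzr, hz⟩ := hP.exists_axis hqs hq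
  have hz0 : z ≠ 0 := by
    rintro rfl
    rw [axis_zero] at hz
    exact hqp ((𝒜.e p).injOn hqs hP.mem (hz.trans hP.map_self.symm))
  have hline : ∀ j : Fin 2, HasDerivAt (fun w : ℝ => 𝒜.e p ((𝒜.e q).symm (axis j w)))
      (L (axis j 1)) 0 := by
    intro j
    have h1 : HasDerivAt (fun w : ℝ => axis j w) (axis j 1) 0 := by
      have : (fun w : ℝ => axis j w) = fun w => w • axis j 1 := by
        funext w; ext i; simp [axis, PiLp.single_apply]
      rw [this]
      simpa using (hasDerivAt_id (0 : ℝ)).smul_const (axis j 1)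
    exact HasFDerivAt.comp_hasDerivAt (0 : ℝ) (by rw [axis_zero]; exact hL) h1
  -- The first axis at q is a translate of axis k at p, with the same parametrization. Hence `jac L`
  -- is, up to the sign belonging to k, the component of `L (axis 1 1)` across the branch, and its
  -- sign tells how the two sides correspond.
  have hL0 : L (axis 0 1) = axis k 1 := by
    refine (hline 0).unique ?_
    have h1 : HasDerivAt (fun w : ℝ => axis k (z + w)) (axis k 1) 0 := by
      have : (fun w : ℝ => axis k (z + w)) = fun w => (z + w) • axis k 1 := by
        funext w; ext i; simp [axis, PiLp.single_apply]
      rw [this]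
      simpa using ((hasDerivAt_id (0 : ℝ)).const_add z).smul_const (axis k 1)
    refine h1.congr_of_eventuallyEq ?_
    have e2 : ∀ᶠ w in 𝓝 (0 : ℝ), |z + w| < 𝒜.r p := by
      have : Continuous fun w : ℝ => |z + w| := by fun_prop
      exact eventually_lt_of_continuousAt this.continuousAt (by simpa using hzr)
    filter_upwards [eventually_symm_axis_eq 𝒜 hγ hp hq hqp hqs hk hz, e2] with w hw hw2
    rw [hw, (𝒜.e p).right_inv (hP.axis_mem_target hw2)]
  have hcoord : ∀ i : Fin 2, HasDerivAt (fun w : ℝ => 𝒜.e p ((𝒜.e q).symm (axis 1 w)) i)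
      (L (axis 1 1) i) 0 := fun i => by
    have := (EuclideanSpace.proj i : Plane →L[ℝ] ℝ).hasFDerivAt.comp_hasDerivAt (0 : ℝ) (hline 1)
    exact this
  have h0 : ∀ i : Fin 2, 𝒜.e p ((𝒜.e q).symm (axis 1 0)) i = axis k z i := fun i => by
    rw [axis_zero, hQ.symm_zero, hz]
  have hle : 𝓝[≠] (0 : ℝ) ≤ 𝓝 0 := nhdsWithin_le_nhds
  rcases Fin.exists_fin_two.1 ⟨k, rfl⟩ with rfl | rfl
  · have hj : jac L = L (axis 1 1) 1 := by
      rw [jac, hL0, det₂]; simp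
    rw [hj] at hjac hsgn
    have e1 := eventually_sgn_eq_of_hasDerivAt (hcoord 1) (by simpa using h0 1) hjac
    have e0 := eventually_sgn_eq (hcoord 0).continuousAt
      (by simp only [h0 0, axis_apply_self]; exact hz0)
    filter_upwards [e1, hle e0] with w hw1 hw0
    simp only [localColor, hw1.1, hw0, h0, colorSign, turnSign, hqp, if_false, hz, axis_zero_one,
      if_true, axis_apply_self, hsgn]
    split_ifs
    · rw [mul_comm, mul_assoc]
    · rw [one_mul, mul_one]
  · have hcr : IsCrossing γ p := hk.resolve_left (by simp)
    have hj : jac L = - L (axis 1 1) 0 := by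
      rw [jac, hL0, det₂]; simp
    have hne : L (axis 1 1) 0 ≠ 0 := by
      intro h; rw [hj, h, neg_zero] at hjac; exact hjac rfl
    rw [hj, sgn_neg hne] at hsgn
    have e1 := eventually_sgn_eq_of_hasDerivAt (hcoord 0) (by simpa using h0 0) hne
    have e0 := eventually_sgn_eq (hcoord 1).continuousAt
      (by simp only [h0 1, axis_apply_self]; exact hz0)
    filter_upwards [e1, hle e0] with w hw1 hw0
    simp only [localColor, hw1.1, hw0, h0, colorSign, turnSign, hqp, if_false, hz, hz0,
      if_true, axis_apply_self, hcr, ← hsgn]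
    rw [neg_mul_neg, mul_assoc]

/-- Three local colourings are compared at one point off the curves near r. Such points exist, and
cancelling the common colour leaves the cocycle relation. -/
theorem isCocycleOn_colorSign (hγ : IsAdmissible γ) :
    IsCocycleOn (colorSign 𝒜) (support γ) := by
  intro p hp
  have hP := 𝒜.isStraight p hp
  filter_upwards [mem_nhdsWithin_of_mem_nhds (hP.eventually_mem), self_mem_nhdsWithin] with q hqs hq
  have hQ := 𝒜.isStraight q hq
  have e1 := (localColor_transition 𝒜 hγ hp hq hqs).eventually_nhds
  filter_upwards [mem_nhdsWithin_of_mem_nhds (hQ.eventually_mem), self_mem_nhdsWithin,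
    mem_nhdsWithin_of_mem_nhds ((𝒜.e p).open_source.mem_nhds hqs),
    e1.filter_mono nhdsWithin_le_nhds] with r hrs hr hrp h1
  have h2 := localColor_transition 𝒜 hγ hq hr hrs
  have h3 := localColor_transition 𝒜 hγ hp hr hrp
  obtain ⟨x, hx, h1, h2, h3⟩ :=
    ((𝒜.isStraight r hr).frequently_notMem.and_eventually (h1.and (h2.and h3))).exists
  have h := h3 hx
  rw [h1 hx, h2 hx, ← mul_assoc] at h
  exact (mul_right_cancel h).symm

end Transition

/-! ### Frames along paths and the orientation monodromy -/

section Frames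

variable {M : Type*} [TopologicalSpace M] [ChartedSpace Plane M] [IsManifold (𝓡 2) ∞ M]

/-- Continuity in the tangent bundle at t₀ is tested in the trivialization at `c t₀`, where the
fibre coordinate is given by a coordinate change. -/
theorem continuousWithinAt_vectorField_iff {c : ℝ → M} (hc : Continuous c) {v : ℝ → Plane}
    {S : Set ℝ} {t₀ : ℝ} :
    ContinuousWithinAt (fun t => (⟨c t, v t⟩ : TangentBundle (𝓡 2) M)) S t₀ ↔
      ContinuousWithinAt (fun t => coordChange (c t) (c t₀) (c t) (v t)) S t₀ := by
  rw [FiberBundle.continuousWithinAt_totalSpace]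
  exact and_iff_right hc.continuousWithinAt

theorem continuousAt_coordChange {x y z : M}
    (hx : z ∈ (chartAt Plane x).source) (hy : z ∈ (chartAt Plane y).source) :
    ContinuousAt (fun z' => coordChange x y z') z :=
  (continuousOn_tangentCoordChange (I := 𝓡 2) (M := M) x y).continuousAt
    (Filter.inter_mem (extChartAt_source_mem_nhds' (by simpa using hx))
      (extChartAt_source_mem_nhds' (by simpa using hy)))

/-- A vector at the initial point of a short path extends to a continuous vector field, by a
constant in a chart. -/
theorem continuousOn_constant_vectorField {c : ℝ → M} (hc : Continuous c) {x : M} {S : Set ℝ}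
    (hS : ∀ t ∈ S, c t ∈ (chartAt Plane x).source) (a : Plane) :
    ContinuousOn (fun t => (⟨c t, coordChange x (c t) (c t) a⟩ : TangentBundle (𝓡 2) M)) S := by
  intro t₀ ht₀
  rw [continuousWithinAt_vectorField_iff hc]
  have h1 : ContinuousWithinAt (fun t => coordChange x (c t₀) (c t) a) S t₀ :=
    (((continuousAt_coordChange (hS t₀ ht₀) (mem_chart_source _ _)).comp
      hc.continuousAt).clm_apply continuousAt_const).continuousWithinAt
  refine h1.congr_of_eventuallyEq ?_ ?_
  · filter_upwards [self_mem_nhdsWithin, mem_nhdsWithin_of_mem_nhds (hc.continuousAt.preimage_mem_nhds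
      ((chartAt Plane (c t₀)).open_source.mem_nhds (mem_chart_source _ _)))] with t ht ht'
    rw [← ContinuousLinearMap.comp_apply,
      coordChange_comp (hS t ht) (mem_chart_source _ _) ht']
  · rw [← ContinuousLinearMap.comp_apply,
      coordChange_comp (hS t₀ ht₀) (mem_chart_source _ _) (mem_chart_source _ _)]

/-- A continuous frame along a path on an interval. -/
structure IsFrameOn (c : ℝ → M) (v w : ℝ → Plane) (S : Set ℝ) : Prop where
  continuous_fst : ContinuousOn (fun t => (⟨c t, v t⟩ : TangentBundle (𝓡 2) M)) S
  continuous_snd : ContinuousOn (fun t => (⟨c t, w t⟩ : TangentBundle (𝓡 2) M)) S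
  det_ne_zero : ∀ t ∈ S, det₂ (v t) (w t) ≠ 0

theorem IsFrameOn.congr {c : ℝ → M} {v w v' w' : ℝ → Plane} {S : Set ℝ} (h : IsFrameOn c v w S)
    (hv : EqOn v' v S) (hw : EqOn w' w S) : IsFrameOn c v' w' S where
  continuous_fst := h.continuous_fst.congr fun t ht => by rw [hv ht]
  continuous_snd := h.continuous_snd.congr fun t ht => by rw [hw ht]
  det_ne_zero t ht := by rw [hv ht, hw ht]; exact h.det_ne_zero t ht

theorem exists_isFrameOn {c : ℝ → M} (hc : Continuous c) {a b : ℝ} (hab : a ≤ b) :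
    ∃ v w, IsFrameOn c v w (Icc a b) := by
  -- Prescribing the initial frame strengthens the claim enough for frames on adjacent intervals to
  -- be concatenated.
  suffices h : ∀ x y : Plane, det₂ x y ≠ 0 → ∃ v w, IsFrameOn c v w (Icc a b) ∧ v a = x ∧ w a = y by
    obtain ⟨v, w, h, -⟩ := h (axis 0 1) (axis 1 1) (by simp [det₂])
    exact ⟨v, w, h⟩
  refine interval_induction hab (fun a b => ∀ x y : Plane, det₂ x y ≠ 0 →
    ∃ v w, IsFrameOn c v w (Icc a b) ∧ v a = x ∧ w a = y) ?_ ?_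
  · intro t _
    obtain ⟨ε, hε, h⟩ := Metric.eventually_nhds_iff.1 (hc.continuousAt.preimage_mem_nhds
      ((chartAt Plane (c t)).open_source.mem_nhds (mem_chart_source _ _)))
    refine ⟨ε, hε, fun u u' _ huu' _ h1 h2 x y hxy => ?_⟩
    have hS : ∀ s ∈ Icc u u', c s ∈ (chartAt Plane (c t)).source := fun s hs =>
      h (by rw [Real.dist_eq, abs_lt]; constructor <;> linarith [hs.1, hs.2])
    set T := coordChange (c u) (c t) (c u)
    have hu := hS u ⟨le_rfl, huu'⟩
    have hback : ∀ z, coordChange (c t) (c u) (c u) (T z) = z := fun z => by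
      rw [← ContinuousLinearMap.comp_apply, coordChange_comp (mem_chart_source _ _) hu
        (mem_chart_source _ _), coordChange_self (mem_chart_source _ _)]
      rfl
    refine ⟨fun s => coordChange (c t) (c s) (c s) (T x), fun s => coordChange (c t) (c s) (c s) (T y),
      ⟨continuousOn_constant_vectorField hc hS _, continuousOn_constant_vectorField hc hS _,
        fun s hs => ?_⟩, hback x, hback y⟩
    rw [det₂_map, det₂_map]
    exact mul_ne_zero (jac_coordChange_ne_zero (hS s hs) (mem_chart_source _ _))
      (mul_ne_zero (jac_coordChange_ne_zero (mem_chart_source _ _) hu) hxy)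
  · intro u u' hau huu' _ h1 h2 x y hxy
    obtain ⟨v, w, hvw, hv, hw⟩ := h1 x y hxy
    obtain ⟨v', w', hvw', hv', hw'⟩ := h2 (v u) (w u) (hvw.det_ne_zero u ⟨hau, le_rfl⟩)
    have hglue : ∀ f f' : ℝ → Plane, f' u = f u →
        EqOn (fun t => if t ≤ u then f t else f' t) f (Icc a u) ∧
        EqOn (fun t => if t ≤ u then f t else f' t) f' (Icc u u') := by
      refine fun f f' hf => ⟨fun t ht => by simp [ht.2], fun t ht => ?_⟩
      rcases ht.1.eq_or_lt with rfl | h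
      · simp [hf]
      · simp [not_le.2 h]
    have g1 := hvw.congr (hglue v v' hv').1 (hglue w w' hw').1
    have g2 := hvw'.congr (hglue v v' hv').2 (hglue w w' hw').2
    refine ⟨fun t => if t ≤ u then v t else v' t, fun t => if t ≤ u then w t else w' t, ?_,
      (if_pos hau).trans hv, (if_pos hau).trans hw⟩
    rw [← Icc_union_Icc_eq_Icc hau huu']
    exact ⟨g1.continuous_fst.union_of_isClosed g2.continuous_fst isClosed_Icc isClosed_Icc,
      g1.continuous_snd.union_of_isClosed g2.continuous_snd isClosed_Icc isClosed_Icc,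
      fun t ht => ht.elim (g1.det_ne_zero t) (g2.det_ne_zero t)⟩

/-- The sign of the determinant of a continuous frame is a section along the path. -/
theorem IsFrameOn.good {c : ℝ → M} (hc : Continuous c) {v w : ℝ → Plane} {S : Set ℝ}
    (h : IsFrameOn c v w S) :
    Good (fun t t' => frameSign (c t) (c t')) S (fun t => sgn (det₂ (v t) (w t))) := by
  intro t₀ ht₀
  have hv := (continuousWithinAt_vectorField_iff hc).1 (h.continuous_fst t₀ ht₀)
  have hw := (continuousWithinAt_vectorField_iff hc).1 (h.continuous_snd t₀ ht₀)
  have hd : ContinuousWithinAt (fun t => det₂ (coordChange (c t) (c t₀) (c t) (v t))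
      (coordChange (c t) (c t₀) (c t) (w t))) S t₀ :=
    continuous_det₂.continuousAt.comp_continuousWithinAt (hv.prodMk hw)
  simp only [det₂_map] at hd
  have h0 : jac (coordChange (c t₀) (c t₀) (c t₀)) * det₂ (v t₀) (w t₀) = det₂ (v t₀) (w t₀) := by
    rw [coordChange_self (mem_chart_source _ _), jac_id, one_mul]
  have hev := eventually_sgn_eq hd (by simp only [h0]; exact h.det_ne_zero t₀ ht₀)
  simp only [h0] at hev
  filter_upwards [hev, self_mem_nhdsWithin, mem_nhdsWithin_of_mem_nhds
    (hc.continuousAt.preimage_mem_nhds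
      ((chartAt Plane (c t₀)).open_source.mem_nhds (mem_chart_source _ _)))] with t h1 h2 h3
  rw [sgn_mul (jac_coordChange_ne_zero (mem_chart_source _ _) h3) (h.det_ne_zero t h2)] at h1
  rw [← h1, frameSign, mul_right_comm, Int.units_mul_self, one_mul]

theorem injOn_coe_unitAddCircle : InjOn (fun t : ℝ => (t : UnitAddCircle)) (Ico 0 1) := by
  intro s hs t ht hst
  have h : (s : UnitAddCircle) = t := hst
  have := (AddCircle.coe_eq_coe_iff_of_mem_Ico (p := 1) (a := (0 : ℝ)) (by simpa using hs)
    (by simpa using ht)).1 h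
  exact this

theorem image_coe_Icc : (fun t : ℝ => (t : UnitAddCircle)) '' Icc (0 : ℝ) 1 = univ := by
  have := AddCircle.coe_image_Icc_eq (p := (1 : ℝ)) 0
  simpa using this

variable {X : Type*} {g : UnitAddCircle → X}

theorem injOn_closedCurve (hg : Function.Injective g) :
    InjOn (fun t : ℝ => g (t : UnitAddCircle)) (Ico 0 1) := fun _ hs _ ht h =>
  injOn_coe_unitAddCircle hs ht (hg h)

theorem image_closedCurve (g : UnitAddCircle → X) :
    (fun t : ℝ => g (t : UnitAddCircle)) '' Icc (0 : ℝ) 1 = range g := by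
  rw [← image_univ, ← image_coe_Icc, image_image]

theorem continuous_closedCurve [TopologicalSpace X] (hg : Continuous g) :
    Continuous fun t : ℝ => g (t : UnitAddCircle) :=
  hg.comp continuous_quotient_mk'

theorem closedCurve_zero_eq_one (g : UnitAddCircle → X) :
    g ((0 : ℝ) : UnitAddCircle) = g ((1 : ℝ) : UnitAddCircle) := by
  congr 1
  have := AddCircle.coe_period (1 : ℝ)
  rw [this]; rfl

/-- A local system along a simple closed curve has a section if and only if its monodromy is
trivial. -/
theorem exists_good_range_iff [TopologicalSpace X] [T2Space X] (hg : Continuous g)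
    (hinj : Function.Injective g) {δ : X → X → ℤˣ} {s : ℝ → ℤˣ}
    (hs : Good (fun t t' : ℝ => δ (g (t : UnitAddCircle)) (g (t' : UnitAddCircle))) (Icc (0 : ℝ) 1) s) :
    (∃ s', Good δ (range g) s') ↔ s 0 = s 1 := by
  have hc := continuous_closedCurve hg
  constructor
  · rintro ⟨s', hs'⟩
    have h := hs.mul_eq (hs'.comp (K := Icc (0 : ℝ) 1) hc.continuousOn
      (fun t _ => mem_range_self _)) isPreconnected_Icc
      (left_mem_Icc.2 zero_le_one) (right_mem_Icc.2 zero_le_one)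
    rw [closedCurve_zero_eq_one g] at h
    exact mul_right_cancel h
  · intro h
    rw [← image_closedCurve g]
    exact hs.exists_image_of_closed zero_lt_one hc.continuousOn (injOn_closedCurve hinj)
      (closedCurve_zero_eq_one g) h

variable [T2Space M]

/-- The determinant sign of any frame along g is a section over [0, 1]. It descends to the image of
g precisely when its end values agree, so one frame decides the question for all. -/
theorem changesLocalOrientation_iff {g : UnitAddCircle → M} (hg : Continuous g)
    (hinj : Function.Injective g) :
    ChangesLocalOrientation g ↔ ¬ ∃ s, Good frameSign (range g) s := by
  have hc := continuous_closedCurve hg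
  constructor
  · rintro ⟨v, w, hvw, hneg⟩ hex
    have hf : IsFrameOn (fun t : ℝ => g (t : UnitAddCircle)) v w (Icc 0 1) :=
      ⟨hvw.continuous_fst, hvw.continuous_snd, fun t ht => det₂_ne_zero_iff.2 (hvw.independent t ht)⟩
    rw [exists_good_range_iff hg hinj (hf.good hc), sgn_eq_sgn_iff] at hex
    · exact absurd hex hneg.not_gt
    · exact hf.det_ne_zero 0 (by simp)
    · exact hf.det_ne_zero 1 (by simp)
  · intro h
    obtain ⟨v, w, hf⟩ := exists_isFrameOn hc (zero_le_one (α := ℝ))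
    rw [exists_good_range_iff hg hinj (hf.good hc), sgn_eq_sgn_iff
      (hf.det_ne_zero 0 (by simp)) (hf.det_ne_zero 1 (by simp)), not_lt] at h
    exact ⟨v, w, ⟨hf.continuous_fst, hf.continuous_snd, fun t ht =>
      det₂_ne_zero_iff.1 (hf.det_ne_zero t ht)⟩, h.lt_of_ne (mul_ne_zero
        (hf.det_ne_zero 0 (by simp)) (hf.det_ne_zero 1 (by simp)))⟩

end Frames

/-! ### Paths in the curves: axes followed, direction, and jumps -/

section Branches

variable {M : Type*} [TopologicalSpace M] [ChartedSpace Plane M]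
  {ι : Type*} {γ : ι → UnitAddCircle → M} (𝒜 : StraightAtlas γ)

/-- A path follows the half-branches with axis `k` of the straight chart at `p` during `S`. -/
def FollowsAxis (p : M) (c : ℝ → M) (k : Fin 2) (S : Set ℝ) : Prop :=
  ∀ t ∈ S, c t ∈ (𝒜.e p).source ∧ 𝒜.e p (c t) = axis k (𝒜.e p (c t) k)

theorem FollowsAxis.injOn {p : M} {c : ℝ → M} {k : Fin 2} {S : Set ℝ}
    (h : FollowsAxis 𝒜 p c k S) (hc : InjOn c S) : InjOn (fun t => 𝒜.e p (c t) k) S := by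
  intro s hs t ht hst
  have hst : 𝒜.e p (c s) k = 𝒜.e p (c t) k := hst
  refine hc hs ht ((𝒜.e p).injOn (h s hs).1 (h t ht).1 ?_)
  rw [(h s hs).2, (h t ht).2, hst]

theorem continuousAt_chart_coord {p : M} {c : ℝ → M} (hc : Continuous c) {t : ℝ}
    (h : c t ∈ (𝒜.e p).source) (k : Fin 2) : ContinuousAt (fun t => 𝒜.e p (c t) k) t := by
  have h0 : Continuous fun y : Plane => y k := by fun_prop
  exact h0.continuousAt.comp (((𝒜.e p).continuousAt h).comp hc.continuousAt)

theorem FollowsAxis.strictMonoOn_or {p : M} {c : ℝ → M} {k : Fin 2} {a b : ℝ}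
    (h : FollowsAxis 𝒜 p c k (Icc a b)) (hab : a ≤ b) (hc : Continuous c)
    (hinj : InjOn c (Icc a b)) :
    StrictMonoOn (fun t => 𝒜.e p (c t) k) (Icc a b) ∨
      StrictAntiOn (fun t => 𝒜.e p (c t) k) (Icc a b) :=
  ContinuousOn.strictMonoOn_of_injOn_Icc' hab
    (fun t ht => (continuousAt_chart_coord 𝒜 hc (h t ht).1 k).continuousWithinAt)
    (h.injOn 𝒜 hinj)

/-- By injectivity the path avoids the centre of the chart after t₀, so it stays in the two axes
without the origin. Each of them is relatively open there, and by connectedness the path cannot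
switch. -/
theorem exists_followsAxis_right {c : ℝ → M} (hc : Continuous c) (hcs : ∀ t, c t ∈ support γ)
    {t₀ η : ℝ} (hη : 0 < η) (hinj : InjOn c (Icc t₀ (t₀ + η))) :
    ∃ k, IsAxisAt γ (c t₀) k ∧ ∃ ε, 0 < ε ∧ ε ≤ η ∧
      FollowsAxis 𝒜 (c t₀) c k (Icc t₀ (t₀ + ε)) := by
  set p := c t₀
  have hP := 𝒜.isStraight p (hcs t₀)
  obtain ⟨ε₀, hε₀, h₀⟩ := Metric.eventually_nhds_iff.1
    (hc.continuousAt.preimage_mem_nhds ((𝒜.e p).open_source.mem_nhds hP.mem))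
  set ε := min (ε₀ / 2) η
  have hε : 0 < ε := lt_min (by linarith) hη
  have hsrc : ∀ t ∈ Icc t₀ (t₀ + ε), c t ∈ (𝒜.e p).source := fun t ht => h₀ (by
    rw [Real.dist_eq, abs_of_nonneg (by linarith [ht.1])]
    linarith [ht.2, min_le_left (ε₀ / 2) η])
  have hax : ∀ t ∈ Ioc t₀ (t₀ + ε), ∃ k, IsAxisAt γ p k ∧ ∃ z, z ≠ 0 ∧ 𝒜.e p (c t) = axis k z := by
    intro t ht
    have hts := hsrc t ⟨ht.1.le, ht.2⟩
    obtain ⟨k, hk, z, -, hz⟩ := hP.exists_axis hts (hcs t)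
    refine ⟨k, hk, z, ?_, hz⟩
    rintro rfl
    rw [axis_zero, ← hP.map_self] at hz
    have := hinj ⟨ht.1.le, by linarith [ht.2, min_le_right (ε₀ / 2) η]⟩ ⟨le_rfl, by linarith⟩
      ((𝒜.e p).injOn hts hP.mem hz)
    exact ht.1.ne' this
  have hconst : ∀ t ∈ Ioc t₀ (t₀ + ε), (𝒜.e p (c t) 0 ≠ 0) = (𝒜.e p (c (t₀ + ε)) 0 ≠ 0) := by
    intro t ht
    refine eq_of_eventually_eq isPreconnected_Ioc (f := fun t => 𝒜.e p (c t) 0 ≠ 0)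
      (fun t ht => ?_) ht ⟨by linarith, le_rfl⟩
    have hts := hsrc t ⟨ht.1.le, ht.2⟩
    obtain ⟨k, hk, z, hz0, hz⟩ := hax t ht
    have hcont := continuousAt_chart_coord 𝒜 hc hts k
    have hne : ∀ᶠ t' in 𝓝[Ioc t₀ (t₀ + ε)] t, 𝒜.e p (c t') k ≠ 0 :=
      (hcont.eventually_ne (by rw [hz]; simpa using hz0)).filter_mono nhdsWithin_le_nhds
    filter_upwards [hne, self_mem_nhdsWithin] with t' h1 h2
    obtain ⟨k', -, z', hz0', hz'⟩ := hax t' h2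
    rw [hz'] at h1
    rw [hz, hz']
    rcases Fin.exists_fin_two.1 ⟨k, rfl⟩ with rfl | rfl <;>
      rcases Fin.exists_fin_two.1 ⟨k', rfl⟩ with rfl | rfl <;> simp_all
  obtain ⟨k, hk, z, hz0, hz⟩ := hax (t₀ + ε) ⟨by linarith, le_rfl⟩
  refine ⟨k, hk, ε, hε, min_le_right _ _, fun t ht => ⟨hsrc t ht, ?_⟩⟩
  rcases ht.1.eq_or_lt with rfl | hlt
  · rw [hP.map_self]; simp
  · obtain ⟨k', -, z', hz0', hz'⟩ := hax t ⟨hlt, ht.2⟩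
    have h := hconst t ⟨hlt, ht.2⟩
    rw [hz, hz'] at h
    rw [hz']
    rcases Fin.exists_fin_two.1 ⟨k, rfl⟩ with rfl | rfl <;>
      rcases Fin.exists_fin_two.1 ⟨k', rfl⟩ with rfl | rfl <;> simp_all

theorem exists_followsAxis_left {c : ℝ → M} (hc : Continuous c) (hcs : ∀ t, c t ∈ support γ)
    {t₀ η : ℝ} (hη : 0 < η) (hinj : InjOn c (Icc (t₀ - η) t₀)) :
    ∃ k, IsAxisAt γ (c t₀) k ∧ ∃ ε, 0 < ε ∧ ε ≤ η ∧
      FollowsAxis 𝒜 (c t₀) c k (Icc (t₀ - ε) t₀) := by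
  have h := exists_followsAxis_right 𝒜 (c := fun t => c (-t)) (hc.comp continuous_neg)
    (fun t => hcs _) (t₀ := -t₀) hη (by
      intro s hs t ht hst
      exact neg_injective (hinj ⟨by linarith [hs.2], by linarith [hs.1]⟩
        ⟨by linarith [ht.2], by linarith [ht.1]⟩ hst))
  simp only [neg_neg] at h
  obtain ⟨k, hk, ε, hε, hεη, h⟩ := h
  refine ⟨k, hk, ε, hε, hεη, fun t ht => ?_⟩
  have := h (-t) ⟨by linarith [ht.2], by linarith [ht.1]⟩
  simpa only [neg_neg] using this

open Classical in
/-- The direction of a path with respect to the parametrization of the curve of the family which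
it follows, at points other than crossings. -/
noncomputable def direction (c : ℝ → M) (t : ℝ) : ℤˣ :=
  if ∃ ε > 0, ∀ u ∈ Ioo 0 ε, 0 < 𝒜.e (c t) (c (t + u)) 0 then 1 else -1

theorem direction_of_neg {c : ℝ → M} {t : ℝ}
    (h : ∃ ε > 0, ∀ u ∈ Ioo 0 ε, 𝒜.e (c t) (c (t + u)) 0 < 0) : direction 𝒜 c t = -1 := by
  refine if_neg ?_
  rintro ⟨ε, hε, h1⟩
  obtain ⟨ε', hε', h2⟩ := h
  have h3 : min ε ε' / 2 < min ε ε' := by linarith [lt_min hε hε']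
  exact (h1 (min ε ε' / 2) ⟨by linarith [lt_min hε hε'], h3.trans_le (min_le_left _ _)⟩).not_gt
    (h2 (min ε ε' / 2) ⟨by linarith [lt_min hε hε'], h3.trans_le (min_le_right _ _)⟩)

theorem direction_add_one {g : UnitAddCircle → M} (t : ℝ) :
    direction 𝒜 (fun t : ℝ => g (t : UnitAddCircle)) (t + 1) =
      direction 𝒜 (fun t : ℝ => g (t : UnitAddCircle)) t := by
  have h : ∀ x : ℝ, ((x + 1 : ℝ) : UnitAddCircle) = x := fun x => AddCircle.coe_add_period 1 x
  have h' : ∀ u : ℝ, ((t + 1 + u : ℝ) : UnitAddCircle) = (t + u : ℝ) := fun u => by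
    rw [← h (t + u)]; congr 1; ring
  have h'' : ∀ u : ℝ, g ((t + 1 + u : ℝ) : UnitAddCircle) = g ((t + u : ℝ) : UnitAddCircle) :=
    fun u => congrArg g (h' u)
  have h₁ : g ((t + 1 : ℝ) : UnitAddCircle) = g (t : UnitAddCircle) := congrArg g (h t)
  classical
  refine if_congr (exists_congr fun ε => and_congr_right fun _ => forall₂_congr fun u _ => ?_) rfl rfl
  show 0 < 𝒜.e (g ((t + 1 : ℝ) : UnitAddCircle)) (g ((t + 1 + u : ℝ) : UnitAddCircle)) 0 ↔ _
  rw [h₁, h'' u]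

/-- A path along an axis of the chart at `p` has the direction in which it moves there. -/
theorem FollowsAxis.direction_eq (hγ : IsAdmissible γ) {p : M} (hp : p ∈ support γ) {c : ℝ → M}
    (hc : Continuous c) (hcs : ∀ t, c t ∈ support γ) {k : Fin 2} (hk : IsAxisAt γ p k) {a b t : ℝ}
    (h : FollowsAxis 𝒜 p c k (Icc a b)) (ht : t ∈ Ico a b) (htp : c t = p → k = 0) :
    (StrictMonoOn (fun t => 𝒜.e p (c t) k) (Icc a b) → direction 𝒜 c t = 1) ∧
      (StrictAntiOn (fun t => 𝒜.e p (c t) k) (Icc a b) → direction 𝒜 c t = -1) := by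
  have htI : t ∈ Icc a b := ⟨ht.1, ht.2.le⟩
  -- On the branch, the coordinate at p and the first coordinate at `c t` differ by a constant, so
  -- monotonicity in one decides the direction in the other. At the centre itself this needs the
  -- axis to be the first one.
  have key : ∃ ε > 0, ∀ u ∈ Ioo 0 ε, t + u ∈ Icc a b ∧
      𝒜.e p (c (t + u)) k = 𝒜.e p (c t) k + 𝒜.e (c t) (c (t + u)) 0 := by
    have hev : ∀ᶠ x in 𝓝 t, 𝒜.e p (c x) k = 𝒜.e p (c t) k + 𝒜.e (c t) (c x) 0 := by
      by_cases hcp : c t = p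
      · have := htp hcp
        subst this
        refine Filter.Eventually.of_forall fun x => ?_
        rw [hcp, (𝒜.isStraight p hp).map_self]; simp
      · filter_upwards [hc.continuousAt.eventually (eventually_apply_eq_axis 𝒜 hγ hp (hcs t) hcp
          (h t htI).1 hk (h t htI).2)] with x hx
        rw [hx (hcs x)]; simp
    obtain ⟨ε, hε, hε'⟩ := Metric.eventually_nhds_iff.1 hev
    refine ⟨min ε (b - t), lt_min hε (by linarith [ht.2]), fun u hu => ⟨⟨?_, ?_⟩, hε' ?_⟩⟩
    · linarith [hu.1, ht.1]
    · linarith [hu.2, min_le_right ε (b - t)]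
    · rw [Real.dist_eq, add_sub_cancel_left, abs_of_pos hu.1]
      exact hu.2.trans_le (min_le_left _ _)
  obtain ⟨ε, hε, hkey⟩ := key
  constructor
  · intro hm
    refine if_pos ⟨ε, hε, fun u hu => ?_⟩
    have := hm htI (hkey u hu).1 (by linarith [hu.1])
    simp only [(hkey u hu).2] at this
    linarith
  · intro hm
    refine direction_of_neg 𝒜 ⟨ε, hε, fun u hu => ?_⟩
    have := hm htI (hkey u hu).1 (by linarith [hu.1])
    simp only [(hkey u hu).2] at this
    linarith

theorem turnSign_of_axis {p q : M} (hqp : q ≠ p) {k : Fin 2} (hk : IsAxisAt γ p k) {z : ℝ}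
    (hz0 : z ≠ 0) (hz : 𝒜.e p q = axis k z) :
    (IsCrossing γ p → turnSign 𝒜 p q = (if k = 0 then 1 else -1) * sgn z) ∧
      (¬ IsCrossing γ p → turnSign 𝒜 p q = 1) := by
  rcases Fin.exists_fin_two.1 ⟨k, rfl⟩ with rfl | rfl
  · exact ⟨fun hc => by simp [turnSign, hqp, hz, hc], fun hc => by simp [turnSign, hqp, hz, hc]⟩
  · exact ⟨fun hc => by simp [turnSign, hqp, hz, hz0],
      fun hc => absurd (hk.resolve_left (by simp)) hc⟩

open Classical in
/-- How the product of a section along a path and of the direction of the path changes at a time: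
it changes its sign if the path goes straight on through a crossing, and not otherwise. -/
theorem exists_jump (hγ : IsAdmissible γ) {c : ℝ → M} (hc : Continuous c)
    (hcs : ∀ t, c t ∈ support γ) {t₀ η : ℝ} (hη : 0 < η)
    (hinj : InjOn c (Icc (t₀ - η) (t₀ + η))) {s : ℝ → ℤˣ}
    (hs : ∀ᶠ t in 𝓝 t₀, s t = s t₀ * turnSign 𝒜 (c t₀) (c t)) :
    ∃ l r : ℤˣ, ∃ k k' : Fin 2, ∃ ε ε' : ℝ, IsAxisAt γ (c t₀) k ∧ IsAxisAt γ (c t₀) k' ∧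
      0 < ε ∧ 0 < ε' ∧ ε ≤ η ∧ ε' ≤ η ∧
      FollowsAxis 𝒜 (c t₀) c k (Icc t₀ (t₀ + ε)) ∧ FollowsAxis 𝒜 (c t₀) c k' (Icc (t₀ - ε') t₀) ∧
      (∀ᶠ t in 𝓝[<] t₀, s t * direction 𝒜 c t = l) ∧
      (∀ᶠ t in 𝓝[>] t₀, s t * direction 𝒜 c t = r) ∧
      (IsCrossing γ (c t₀) → l * r = if k = k' then -1 else 1) ∧
      (¬ IsCrossing γ (c t₀) → l = s t₀ * direction 𝒜 c t₀ ∧ r = s t₀ * direction 𝒜 c t₀) := by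
  set p := c t₀ with hp_def
  have hP := 𝒜.isStraight p (hcs t₀)
  have hinjR : InjOn c (Icc t₀ (t₀ + η)) := hinj.mono (Icc_subset_Icc (by linarith) le_rfl)
  have hinjL : InjOn c (Icc (t₀ - η) t₀) := hinj.mono (Icc_subset_Icc le_rfl (by linarith))
  obtain ⟨k, hk, ε, hε, hεη, hR⟩ := exists_followsAxis_right 𝒜 hc hcs hη hinjR
  obtain ⟨k', hk', ε', hε', hεη', hL⟩ := exists_followsAxis_left 𝒜 hc hcs hη hinjL
  have hR' := hR.strictMonoOn_or 𝒜 (by linarith) hc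
    (hinjR.mono (Icc_subset_Icc le_rfl (by linarith)))
  have hL' := hL.strictMonoOn_or 𝒜 (by linarith) hc
    (hinjL.mono (Icc_subset_Icc (by linarith) le_rfl))
  have h0 : ∀ j : Fin 2, 𝒜.e p (c t₀) j = 0 := fun j => by rw [← hp_def, hP.map_self]; rfl
  have hinj2 : InjOn c (Icc (t₀ - ε') (t₀ + ε)) := hinj.mono
    (Icc_subset_Icc (by linarith) (by linarith))
  have ht₀R : t₀ ∈ Icc t₀ (t₀ + ε) := ⟨le_rfl, by linarith⟩
  have ht₀L : t₀ ∈ Icc (t₀ - ε') t₀ := ⟨by linarith, le_rfl⟩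
  have hneR : ∀ t ∈ Ioo t₀ (t₀ + ε), c t ≠ p := fun t ht h =>
    ht.1.ne' (hinj2 ⟨by linarith [ht.1], ht.2.le⟩ ⟨by linarith, by linarith⟩ h)
  have hneL : ∀ t ∈ Ioo (t₀ - ε') t₀, c t ≠ p := fun t ht h =>
    ht.2.ne (hinj2 ⟨ht.1.le, by linarith [ht.2]⟩ ⟨by linarith, by linarith⟩ h)
  -- the direction on the right and on the left
  obtain ⟨d, hd, hdmono⟩ : ∃ d : ℤˣ, (∀ t ∈ Ioo t₀ (t₀ + ε), direction 𝒜 c t = d ∧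
      𝒜.e p (c t) k ≠ 0 ∧ sgn (𝒜.e p (c t) k) = d) ∧
      ((StrictMonoOn (fun t => 𝒜.e p (c t) k) (Icc t₀ (t₀ + ε)) ∧ d = 1) ∨
        (StrictAntiOn (fun t => 𝒜.e p (c t) k) (Icc t₀ (t₀ + ε)) ∧ d = -1)) := by
    rcases hR' with hm | hm
    · refine ⟨1, fun t ht => ?_, Or.inl ⟨hm, rfl⟩⟩
      have h1 : 0 < 𝒜.e p (c t) k := (h0 k).symm.trans_lt
        (hm ht₀R ⟨ht.1.le, ht.2.le⟩ ht.1)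
      exact ⟨(hR.direction_eq 𝒜 hγ (hcs t₀) hc hcs hk ⟨ht.1.le, ht.2⟩
        fun h => absurd h (hneR t ht)).1 hm, h1.ne', sgn_of_pos h1⟩
    · refine ⟨-1, fun t ht => ?_, Or.inr ⟨hm, rfl⟩⟩
      have h1 : 𝒜.e p (c t) k < 0 := (hm ht₀R ⟨ht.1.le, ht.2.le⟩ ht.1).trans_eq (h0 k)
      exact ⟨(hR.direction_eq 𝒜 hγ (hcs t₀) hc hcs hk ⟨ht.1.le, ht.2⟩
        fun h => absurd h (hneR t ht)).2 hm, h1.ne, sgn_of_neg h1⟩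
  obtain ⟨d', hd', hdmono'⟩ : ∃ d : ℤˣ, (∀ t ∈ Ioo (t₀ - ε') t₀, direction 𝒜 c t = d ∧
      𝒜.e p (c t) k' ≠ 0 ∧ sgn (𝒜.e p (c t) k') = -d) ∧
      ((StrictMonoOn (fun t => 𝒜.e p (c t) k') (Icc (t₀ - ε') t₀) ∧ d = 1) ∨
        (StrictAntiOn (fun t => 𝒜.e p (c t) k') (Icc (t₀ - ε') t₀) ∧ d = -1)) := by
    rcases hL' with hm | hm
    · refine ⟨1, fun t ht => ?_, Or.inl ⟨hm, rfl⟩⟩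
      have h1 : 𝒜.e p (c t) k' < 0 := (hm ⟨ht.1.le, ht.2.le⟩ ht₀L ht.2).trans_eq (h0 k')
      exact ⟨(hL.direction_eq 𝒜 hγ (hcs t₀) hc hcs hk' ⟨ht.1.le, ht.2⟩
        fun h => absurd h (hneL t ht)).1 hm, h1.ne, sgn_of_neg h1⟩
    · refine ⟨-1, fun t ht => ?_, Or.inr ⟨hm, rfl⟩⟩
      have h1 : 0 < 𝒜.e p (c t) k' := (h0 k').symm.trans_lt
        (hm ⟨ht.1.le, ht.2.le⟩ ht₀L ht.2)
      exact ⟨(hL.direction_eq 𝒜 hγ (hcs t₀) hc hcs hk' ⟨ht.1.le, ht.2⟩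
        fun h => absurd h (hneL t ht)).2 hm, h1.ne', by rw [sgn_of_pos h1, neg_neg]⟩
  have hevR : ∀ᶠ t in 𝓝[>] t₀, t ∈ Ioo t₀ (t₀ + ε) := Ioo_mem_nhdsGT (by linarith)
  have hevL : ∀ᶠ t in 𝓝[<] t₀, t ∈ Ioo (t₀ - ε') t₀ := Ioo_mem_nhdsLT (by linarith)
  have hsR : ∀ᶠ t in 𝓝[>] t₀, s t = s t₀ * turnSign 𝒜 p (c t) := hs.filter_mono nhdsWithin_le_nhds
  have hsL : ∀ᶠ t in 𝓝[<] t₀, s t = s t₀ * turnSign 𝒜 p (c t) := hs.filter_mono nhdsWithin_le_nhds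
  by_cases hcr : IsCrossing γ p
  · refine ⟨-(s t₀ * if k' = 0 then 1 else -1), s t₀ * if k = 0 then 1 else -1, k, k', ε, ε', hk, hk',
      hε, hε', hεη, hεη', hR, hL, ?_, ?_, fun _ => ?_, fun h => absurd hcr h⟩
    · filter_upwards [hevL, hsL] with t ht hst
      obtain ⟨h1, h2, h3⟩ := hd' t ht
      rw [hst, h1, (turnSign_of_axis 𝒜 (hneL t ht) hk' h2 (hL t ⟨ht.1.le, ht.2.le⟩).2).1 hcr, h3,
        mul_neg, mul_neg, neg_mul, ← mul_assoc, mul_assoc _ d' d', Int.units_mul_self, mul_one]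
    · filter_upwards [hevR, hsR] with t ht hst
      obtain ⟨h1, h2, h3⟩ := hd t ht
      rw [hst, h1, (turnSign_of_axis 𝒜 (hneR t ht) hk h2 (hR t ⟨ht.1.le, ht.2.le⟩).2).1 hcr, h3,
        ← mul_assoc, mul_assoc _ d d, Int.units_mul_self, mul_one]
    · rw [neg_mul, mul_mul_mul_comm, Int.units_mul_self, one_mul]
      rcases Fin.exists_fin_two.1 ⟨k, rfl⟩ with rfl | rfl <;>
        rcases Fin.exists_fin_two.1 ⟨k', rfl⟩ with rfl | rfl <;> simp
  · obtain rfl : k = 0 := hk.resolve_right hcr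
    obtain rfl : k' = 0 := hk'.resolve_right hcr
    have hall : FollowsAxis 𝒜 p c 0 (Icc (t₀ - ε') (t₀ + ε)) := by
      rw [← Icc_union_Icc_eq_Icc (b := t₀) (by linarith) (by linarith)]
      exact fun t ht => ht.elim (hL t) (hR t)
    have hsubR : Icc t₀ (t₀ + ε) ⊆ Icc (t₀ - ε') (t₀ + ε) := Icc_subset_Icc (by linarith) le_rfl
    have hsubL : Icc (t₀ - ε') t₀ ⊆ Icc (t₀ - ε') (t₀ + ε) := Icc_subset_Icc le_rfl (by linarith)
    have hmem0 : t₀ ∈ Ico (t₀ - ε') (t₀ + ε) := ⟨by linarith, by linarith⟩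
    have hend : t₀ + ε ∈ Icc t₀ (t₀ + ε) := ⟨by linarith, le_rfl⟩
    have hstart : t₀ - ε' ∈ Icc (t₀ - ε') t₀ := ⟨le_rfl, by linarith⟩
    have hdir := hall.direction_eq 𝒜 hγ (hcs t₀) hc hcs hk hmem0 fun _ => rfl
    -- Off the crossings the path is monotone on a single axis through t₀, so its direction is the
    -- same before, at and after t₀.
    have hdd : direction 𝒜 c t₀ = d ∧ direction 𝒜 c t₀ = d' := by
      rcases hall.strictMonoOn_or 𝒜 (by linarith) hc hinj2 with hm | hm
      · rw [hdir.1 hm]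
        refine ⟨hdmono.elim (fun h => h.2.symm) fun h => ?_,
          hdmono'.elim (fun h => h.2.symm) fun h => ?_⟩
        · exact absurd (h.1 ht₀R hend (by linarith))
            (hm.mono hsubR ht₀R hend (by linarith)).not_gt
        · exact absurd (h.1 hstart ht₀L (by linarith))
            (hm.mono hsubL hstart ht₀L (by linarith)).not_gt
      · rw [hdir.2 hm]
        refine ⟨hdmono.elim (fun h => ?_) (fun h => h.2.symm),
          hdmono'.elim (fun h => ?_) fun h => h.2.symm⟩
        · exact absurd (h.1 ht₀R hend (by linarith))
            (hm.mono hsubR ht₀R hend (by linarith)).not_gt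
        · exact absurd (h.1 hstart ht₀L (by linarith))
            (hm.mono hsubL hstart ht₀L (by linarith)).not_gt
    refine ⟨s t₀ * d', s t₀ * d, 0, 0, ε, ε', hk, hk', hε, hε', hεη, hεη', hR, hL, ?_, ?_,
      fun h => absurd h hcr, fun _ => ⟨by rw [← hdd.2], by rw [← hdd.1]⟩⟩
    · filter_upwards [hevL, hsL] with t ht hst
      obtain ⟨h1, h2, h3⟩ := hd' t ht
      rw [hst, h1, (turnSign_of_axis 𝒜 (hneL t ht) hk' h2 (hL t ⟨ht.1.le, ht.2.le⟩).2).2 hcr,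
        mul_one]
    · filter_upwards [hevR, hsR] with t ht hst
      obtain ⟨h1, h2, h3⟩ := hd t ht
      rw [hst, h1, (turnSign_of_axis 𝒜 (hneR t ht) hk h2 (hR t ⟨ht.1.le, ht.2.le⟩).2).2 hcr,
        mul_one]

end Branches

/-! ### Monodromy of the product covering along a simple closed curve -/

section Monodromy

theorem eq_of_coe_eq_of_abs_sub_lt {s t : ℝ} (h : (s : UnitAddCircle) = t) (hst : |s - t| < 1) :
    s = t := by
  rw [abs_lt] at hst
  exact (AddCircle.coe_eq_coe_iff_of_mem_Ico (p := 1) (a := min s t)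
    ⟨min_le_left _ _, by rcases min_choice s t with h | h <;> rw [h] <;> linarith⟩
    ⟨min_le_right _ _, by rcases min_choice s t with h | h <;> rw [h] <;> linarith⟩).1 h

variable {M : Type*} [TopologicalSpace M] {ι : Type*} {γ : ι → UnitAddCircle → M}

theorem IsSimpleClosedCurveIn.mem_support {g : UnitAddCircle → M}
    (hg : IsSimpleClosedCurveIn γ g) (x : UnitAddCircle) : g x ∈ support γ :=
  hg.subset (mem_range_self x)

theorem IsAdmissible.eq_of_curve_eq [ChartedSpace Plane M] (hγ : IsAdmissible γ) {i : ι} {s t : ℝ}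
    (hs : ¬ IsCrossing γ (γ i (s : UnitAddCircle)))
    (h : γ i (t : UnitAddCircle) = γ i (s : UnitAddCircle)) (hst : |t - s| < 1) : t = s :=
  eq_of_coe_eq_of_abs_sub_lt (hγ.eq_of_not_isCrossing hs h rfl).2 hst

/-- A continuous injection of the compact circle is a homeomorphism onto its image: the times
outside the open interval have a closed image that misses the given point. -/
theorem eventually_mem_range_exists_mem_Ioo [T2Space M] {g : UnitAddCircle → M} (hg : Continuous g)
    (hinj : Function.Injective g) {a b t : ℝ} (ht : t ∈ Ioo a b) :
    ∀ᶠ x in 𝓝 (g (t : UnitAddCircle)), x ∈ range g → ∃ u ∈ Ioo a b, g (u : UnitAddCircle) = x := by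
  set K : Set UnitAddCircle := ((fun t : ℝ => (t : UnitAddCircle)) '' Ioo a b)ᶜ
  have hK : IsClosed K := (QuotientAddGroup.isOpenMap_coe _ isOpen_Ioo).isClosed_compl
  have hgK : IsClosed (g '' K) := (hK.isCompact.image hg).isClosed
  have hp : g (t : UnitAddCircle) ∉ g '' K := by
    rintro ⟨x, hx, hxt⟩
    exact hx ⟨t, ht, (hinj hxt).symm⟩
  filter_upwards [hgK.isOpen_compl.mem_nhds hp]
  rintro _ hx ⟨y, rfl⟩
  by_cases hy : y ∈ K
  · exact absurd ⟨y, hy, rfl⟩ hx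
  · obtain ⟨u, hu, rfl⟩ := not_not.1 hy
    exact ⟨u, hu, rfl⟩

variable [ChartedSpace Plane M] [T2Space M] (𝒜 : StraightAtlas γ)

/-- A curve goes straight on through a crossing if and only if it arrives and leaves on the same
axis of the straight chart. -/
theorem goesStraightAt_iff {g : UnitAddCircle → M} (hg : IsSimpleClosedCurveIn γ g) {t₀ η ε ε' : ℝ}
    {k k' : Fin 2} (hη : η < 1 / 2) (hε : 0 < ε) (hε' : 0 < ε') (hεη : ε ≤ η) (hεη' : ε' ≤ η)
    (hk : IsAxisAt γ (g t₀) k)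
    (hR : FollowsAxis 𝒜 (g t₀) (fun t : ℝ => g t) k (Icc t₀ (t₀ + ε)))
    (hL : FollowsAxis 𝒜 (g t₀) (fun t : ℝ => g t) k' (Icc (t₀ - ε') t₀)) :
    GoesStraightAt γ g (g t₀) ↔ k = k' := by
  set p := g t₀ with hp_def
  have hc := continuous_closedCurve hg.continuous
  have hps : p ∈ support γ := hg.mem_support _
  have hP := 𝒜.isStraight p hps
  have h0 : ∀ j : Fin 2, 𝒜.e p (g t₀) j = 0 := fun j => by rw [← hp_def, hP.map_self]; rfl
  have hinj : InjOn (fun t : ℝ => g t) (Icc (t₀ - ε') (t₀ + ε)) := fun s hs t ht hst =>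
    eq_of_coe_eq_of_abs_sub_lt (hg.injective hst)
      (abs_lt.2 ⟨by linarith [hs.1, ht.2], by linarith [hs.2, ht.1]⟩)
  constructor
  · rintro ⟨i, x, hix, hx⟩
    have hxs : γ i x ∈ (𝒜.e p).source := by rw [hix]; exact hP.mem
    obtain ⟨j, hj, z, hz, rfl, rfl⟩ := hP.of_mem i x hxs
    have hz0 : z = 0 := by
      have h1 := hP.apply_branch hj hz
      rw [hix, hP.map_self] at h1
      have := congrArg (fun v : Plane => v j) h1
      simpa using this.symm
    subst hz0
    clear hz
    have hcont : Continuous fun z : ℝ => (((𝒜.b p j).2 + z : ℝ) : UnitAddCircle) :=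
      continuous_quotient_mk'.comp (by fun_prop)
    have hev1 : ∀ᶠ z in 𝓝 (0 : ℝ), γ (𝒜.b p j).1 (((𝒜.b p j).2 + z : ℝ) : UnitAddCircle) ∈ range g :=
      (hcont.tendsto 0).eventually hx
    have hev2 : ∀ᶠ z in 𝓝 (0 : ℝ), |z| < 𝒜.r p :=
      eventually_lt_of_continuousAt continuous_abs.continuousAt (by simpa using hP.pos)
    have hev3 : ∀ᶠ z in 𝓝 (0 : ℝ), (𝒜.e p).symm (axis j z) ∈ range g →
        ∃ u ∈ Ioo (t₀ - ε') (t₀ + ε), g (u : UnitAddCircle) = (𝒜.e p).symm (axis j z) := by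
      have h1 := eventually_mem_range_exists_mem_Ioo hg.continuous hg.injective
        (show t₀ ∈ Ioo (t₀ - ε') (t₀ + ε) from ⟨by linarith, by linarith⟩)
      have h2 : ContinuousAt (fun z : ℝ => (𝒜.e p).symm (axis j z)) 0 := by
        have h3 : Continuous fun z : ℝ => axis j z := by
          have : (fun w : ℝ => axis j w) = fun w => w • axis j 1 := by
            funext w; ext i; simp [axis, PiLp.single_apply]
          rw [this]; fun_prop
        refine ContinuousAt.comp ?_ h3.continuousAt
        exact (𝒜.e p).continuousAt_symm (hP.axis_mem_target (by simpa using hP.pos))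
      refine h2.eventually (p := fun x => x ∈ range g →
        ∃ u ∈ Ioo (t₀ - ε') (t₀ + ε), g (u : UnitAddCircle) = x) ?_
      simp only [axis_zero, hP.symm_zero]
      exact h1
    -- points of the axis near `0` are reached from one side only, unless both sides have its index
    have key : ∀ᶠ z in 𝓝 (0 : ℝ), z ≠ 0 →
        (∃ u ∈ Ioc t₀ (t₀ + ε), k = j ∧ 𝒜.e p (g u) k = z) ∨
        (∃ u ∈ Ico (t₀ - ε') t₀, k' = j ∧ 𝒜.e p (g u) k' = z) := by
      filter_upwards [hev1, hev2, hev3] with z h1 h2 h3 hz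
      rw [hP.branch j hj z h2] at h1
      obtain ⟨u, hu, hgu⟩ := h3 h1
      have hex : 𝒜.e p (g u) = axis j z := by
        rw [hgu, (𝒜.e p).right_inv (hP.axis_mem_target h2)]
      rcases lt_trichotomy u t₀ with hlt | rfl | hlt
      · right
        have h4 := (hL u ⟨hu.1.le, hlt.le⟩).2
        simp only [hex] at h4
        obtain ⟨h5, h6⟩ := axis_injective hz h4
        exact ⟨u, ⟨hu.1.le, hlt⟩, h5.symm, by rw [hex, ← h5, axis_apply_self]⟩
      · rw [← hp_def, hP.map_self] at hex
        have := congrArg (fun v : Plane => v j) hex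
        exact absurd (by simpa using this.symm) hz
      · left
        have h4 := (hR u ⟨hlt.le, hu.2.le⟩).2
        simp only [hex] at h4
        obtain ⟨h5, h6⟩ := axis_injective hz h4
        exact ⟨u, ⟨hlt, hu.2.le⟩, h5.symm, by rw [hex, ← h5, axis_apply_self]⟩
    obtain ⟨δ, hδ, hkey⟩ := Metric.eventually_nhds_iff.1 key
    have hpos := hkey (y := δ / 2) (by rw [Real.dist_eq, sub_zero, abs_of_pos] <;> linarith)
      (by linarith)
    have hneg := hkey (y := -(δ / 2)) (by rw [Real.dist_eq, sub_zero, abs_neg, abs_of_pos] <;> linarith)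
      (by linarith)
    -- If the axes differ, the points with coordinates δ / 2 and -δ / 2 are both reached on the same
    -- side of t₀. There the coordinate is monotone and vanishes at t₀, so it cannot take both
    -- signs.
    by_contra hkk
    rcases hpos with ⟨u, hu, hkj, huz⟩ | ⟨u, hu, hkj, huz⟩ <;>
      rcases hneg with ⟨v, hv, hkj', hvz⟩ | ⟨v, hv, hkj', hvz⟩
    · have hu' : u ∈ Icc t₀ (t₀ + ε) := ⟨hu.1.le, hu.2⟩
      have hv' : v ∈ Icc t₀ (t₀ + ε) := ⟨hv.1.le, hv.2⟩
      have ht' : t₀ ∈ Icc t₀ (t₀ + ε) := ⟨le_rfl, by linarith⟩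
      rcases hR.strictMonoOn_or 𝒜 (by linarith) hc
        (hinj.mono (Icc_subset_Icc (by linarith) le_rfl)) with hm | hm
      · have : 𝒜.e p (g t₀) k < 𝒜.e p (g v) k := hm ht' hv' hv.1
        rw [h0, hvz] at this; linarith
      · have : 𝒜.e p (g u) k < 𝒜.e p (g t₀) k := hm ht' hu' hu.1
        rw [h0, huz] at this; linarith
    · exact hkk (hkj.trans hkj'.symm)
    · exact hkk (hkj'.trans hkj.symm)
    · have hu' : u ∈ Icc (t₀ - ε') t₀ := ⟨hu.1, hu.2.le⟩
      have hv' : v ∈ Icc (t₀ - ε') t₀ := ⟨hv.1, hv.2.le⟩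
      have ht' : t₀ ∈ Icc (t₀ - ε') t₀ := ⟨by linarith, le_rfl⟩
      rcases hL.strictMonoOn_or 𝒜 (by linarith) hc
        (hinj.mono (Icc_subset_Icc le_rfl (by linarith))) with hm | hm
      · have : 𝒜.e p (g u) k' < 𝒜.e p (g t₀) k' := hm hu' ht' hu.2
        rw [h0, huz] at this; linarith
      · have : 𝒜.e p (g t₀) k' < 𝒜.e p (g v) k' := hm hv' ht' hv.2
        rw [h0, hvz] at this; linarith
  · rintro rfl
    have hall : FollowsAxis 𝒜 p (fun t : ℝ => g t) k (Icc (t₀ - ε') (t₀ + ε)) := by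
      rw [← Icc_union_Icc_eq_Icc (b := t₀) (by linarith) (by linarith)]
      exact fun t ht => ht.elim (hL t) (hR t)
    have hcont : ContinuousOn (fun t : ℝ => 𝒜.e p (g t) k) (Icc (t₀ - ε') (t₀ + ε)) := fun t ht =>
      (continuousAt_chart_coord 𝒜 hc (hall t ht).1 k).continuousWithinAt
    have hl : t₀ - ε' ∈ Icc (t₀ - ε') (t₀ + ε) := ⟨le_rfl, by linarith⟩
    have hr : t₀ + ε ∈ Icc (t₀ - ε') (t₀ + ε) := ⟨by linarith, le_rfl⟩
    have hm0 : t₀ ∈ Icc (t₀ - ε') (t₀ + ε) := ⟨by linarith, by linarith⟩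
    -- The coordinate is monotone through its zero at t₀, so by the intermediate value theorem g
    -- covers a whole interval of the branch around the crossing.
    have hsurj : ∀ᶠ z in 𝓝 (0 : ℝ), ∃ t ∈ Icc (t₀ - ε') (t₀ + ε), 𝒜.e p (g t) k = z := by
      rcases hall.strictMonoOn_or 𝒜 (by linarith) hc hinj with hm | hm
      · have h1 : 𝒜.e p (g (t₀ - ε' : ℝ)) k < 𝒜.e p (g t₀) k := hm hl hm0 (by linarith)
        have h2 : 𝒜.e p (g t₀) k < 𝒜.e p (g (t₀ + ε : ℝ)) k := hm hm0 hr (by linarith)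
        rw [h0] at h1 h2
        filter_upwards [Icc_mem_nhds h1 h2] with z hz
        exact intermediate_value_Icc (by linarith) hcont hz
      · have h1 : 𝒜.e p (g t₀) k < 𝒜.e p (g (t₀ - ε' : ℝ)) k := hm hl hm0 (by linarith)
        have h2 : 𝒜.e p (g (t₀ + ε : ℝ)) k < 𝒜.e p (g t₀) k := hm hm0 hr (by linarith)
        rw [h0] at h1 h2
        filter_upwards [Icc_mem_nhds h2 h1] with z hz
        exact intermediate_value_Icc' (by linarith) hcont hz
    refine ⟨(𝒜.b p k).1, ((𝒜.b p k).2 : UnitAddCircle), ?_, ?_⟩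
    · have := hP.branch k hk 0 (by simpa using hP.pos)
      rwa [add_zero, axis_zero, hP.symm_zero] at this
    · have hev2 : ∀ᶠ z in 𝓝 (0 : ℝ), |z| < 𝒜.r p :=
        eventually_lt_of_continuousAt continuous_abs.continuousAt (by simpa using hP.pos)
      have hopen : IsOpenMap fun z : ℝ => (((𝒜.b p k).2 + z : ℝ) : UnitAddCircle) :=
        (QuotientAddGroup.isOpenMap_coe).comp (Homeomorph.addLeft (𝒜.b p k).2).isOpenMap
      have := hopen.image_mem_nhds (Filter.inter_mem hsurj hev2)
      simp only [add_zero] at this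
      filter_upwards [this]
      rintro _ ⟨z, ⟨⟨t, ht, hz⟩, hzr⟩, rfl⟩
      refine ⟨t, ?_⟩
      have e1 : 𝒜.e p (g t) = axis k (𝒜.e p (g t) k) := (hall t ht).2
      have e2 : (𝒜.e p).symm (𝒜.e p (g t)) = g t := (𝒜.e p).left_inv (hall t ht).1
      have e3 := hP.branch k hk z hzr
      rw [← hz, ← e1, e2] at e3
      rw [← hz]; exact e3.symm

/-- A straight chart contains no crossing except possibly its centre, and finitely many charts cover
the compact set Γ. -/
theorem finite_setOf_isCrossing [Finite ι] [IsManifold (𝓡 2) ∞ M] (hγ : IsAdmissible γ) :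
    {p : M | IsCrossing γ p}.Finite := by
  obtain ⟨𝒜⟩ := hγ.nonempty_straightAtlas
  have hsub : ∀ p, IsCrossing γ p → p ∈ support γ := by
    intro p hp
    obtain ⟨x, y, -, hset⟩ := Set.encard_eq_two.1 hp
    have : x ∈ {x : ι × UnitAddCircle | γ x.1 x.2 = p} := by rw [hset]; exact Or.inl rfl
    exact mem_iUnion.2 ⟨x.1, x.2, this⟩
  have hcomp : IsCompact (support γ) :=
    isCompact_iUnion fun i => isCompact_range (hγ.continuous i)
  obtain ⟨T, hT⟩ := hcomp.elim_nhds_subcover' (fun p _ => (𝒜.e p).source)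
    (fun p hp => (𝒜.isStraight p hp).eventually_mem)
  refine (T.finite_toSet.image Subtype.val).subset fun q hq => ?_
  obtain ⟨p, hpT, hqp⟩ := mem_iUnion₂.1 (hT (hsub q hq))
  refine ⟨p, hpT, ?_⟩
  by_contra hne
  exact (𝒜.isStraight p p.2).not_isCrossing hqp (fun h => hne h.symm) hq

open Classical in
/-- The monodromy of the product of the two local systems along a simple closed curve. -/
theorem monodromy_turnSign [Finite ι] [IsManifold (𝓡 2) ∞ M] (hγ : IsAdmissible γ)
    {g : UnitAddCircle → M} (hg : IsSimpleClosedCurveIn γ g)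
    (hg0 : ¬ IsCrossing γ (g ((0 : ℝ) : UnitAddCircle))) {s : ℝ → ℤˣ}
    (hs : Good (fun t t' : ℝ => turnSign 𝒜 (g (t : UnitAddCircle)) (g (t' : UnitAddCircle)))
      (Icc (-1) 2) s) :
    s 0 * s 1 = (-1) ^ straightCount γ g := by
  set c : ℝ → M := fun t => g (t : UnitAddCircle) with hc_def
  have hc : Continuous c := continuous_closedCurve hg.continuous
  have hcs : ∀ t, c t ∈ support γ := fun t => hg.mem_support _
  have hinj : ∀ t : ℝ, InjOn c (Icc (t - 1 / 3) (t + 1 / 3)) := fun t x hx y hy hxy =>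
    eq_of_coe_eq_of_abs_sub_lt (hg.injective hxy)
      (abs_lt.2 ⟨by linarith [hx.1, hy.2], by linarith [hx.2, hy.1]⟩)
  have hjump : ∀ t ∈ Icc (0 : ℝ) 1, ∃ l r : ℤˣ,
      (∀ᶠ t' in 𝓝[<] t, s t' * direction 𝒜 c t' = l) ∧
      (∀ᶠ t' in 𝓝[>] t, s t' * direction 𝒜 c t' = r) ∧
      (IsCrossing γ (c t) → l * r = if GoesStraightAt γ g (c t) then -1 else 1) ∧
      (¬ IsCrossing γ (c t) → l = s t * direction 𝒜 c t ∧ r = s t * direction 𝒜 c t) := by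
    intro t ht
    -- A section on the longer interval [-1, 2] satisfies its relation on a full neighbourhood of
    -- every t in [0, 1], the ends included.
    have hst : ∀ᶠ t' in 𝓝 t, s t' = s t * turnSign 𝒜 (c t) (c t') := by
      have h1 := hs t ⟨by linarith [ht.1], by linarith [ht.2]⟩
      rwa [nhdsWithin_eq_nhds.2 (Icc_mem_nhds (by linarith [ht.1]) (by linarith [ht.2]))] at h1
    obtain ⟨l, r, k, k', ε, ε', hk, hk', hε, hε', hεη, hεη', hR, hL, hl, hr, h1, h2⟩ :=
      exists_jump 𝒜 hγ hc hcs (by norm_num : (0 : ℝ) < 1 / 3) (hinj t) hst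
    refine ⟨l, r, hl, hr, fun hcr => ?_, h2⟩
    rw [h1 hcr]
    simp only [hc_def, goesStraightAt_iff 𝒜 hg (by norm_num) hε hε' hεη hεη' hk hR hL]
  choose! Lf Rf hLf hRf hcross hncross using hjump
  set S : Set ℝ := {t ∈ Ioo (0 : ℝ) 1 | IsCrossing γ (c t) ∧ GoesStraightAt γ g (c t)} with hS
  have hinjc : InjOn c (Ico 0 1) := injOn_closedCurve hg.injective
  have hinjS : InjOn c S := hinjc.mono fun t (ht : t ∈ S) =>
    show t ∈ Ico (0 : ℝ) 1 from ⟨ht.1.1.le, ht.1.2⟩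
  have himage : c '' S = {p : M | IsCrossing γ p ∧ p ∈ range g ∧ GoesStraightAt γ g p} := by
    ext p
    constructor
    · rintro ⟨t, ht, rfl⟩
      exact ⟨ht.2.1, mem_range_self _, ht.2.2⟩
    · rintro ⟨h1, h2, h3⟩
      rw [← image_closedCurve g] at h2
      obtain ⟨t, ht, rfl⟩ := h2
      refine ⟨t, ⟨⟨ht.1.lt_of_ne ?_, ht.2.lt_of_ne ?_⟩, h1, h3⟩, rfl⟩
      · rintro rfl; exact hg0 h1
      · rintro rfl
        apply hg0
        rw [closedCurve_zero_eq_one g]; exact h1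
  have hSfin : S.Finite := by
    refine Set.Finite.of_finite_image ?_ hinjS
    rw [himage]
    exact (finite_setOf_isCrossing hγ).subset fun p hp => hp.1
  have hcount : straightCount γ g = hSfin.toFinset.card := by
    rw [straightCount, ← himage, hinjS.ncard_image, ncard_eq_toFinset_card S hSfin]
  have hmain := mul_eq_prod_jumps (zero_lt_one (α := ℝ))
    (F := fun t => s t * direction 𝒜 c t) hSfin.toFinset
    (fun t ht => ((hSfin.mem_toFinset).1 ht).1) hLf hRf (fun t ht htS => by
      by_cases hcr : IsCrossing γ (c t)
      · have htI : t ∈ Ioo (0 : ℝ) 1 := by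
          refine ⟨ht.1.lt_of_ne ?_, ht.2.lt_of_ne ?_⟩
          · rintro rfl; exact hg0 hcr
          · rintro rfl
            apply hg0
            rw [closedCurve_zero_eq_one g]; exact hcr
        have h1 : ¬ GoesStraightAt γ g (c t) := fun h =>
          htS (hSfin.mem_toFinset.2 ⟨htI, hcr, h⟩)
        have h2 := hcross t ht hcr
        rw [if_neg h1] at h2
        exact (by decide : ∀ x y : ℤˣ, x * y = 1 → x = y) _ _ h2
      · rw [(hncross t ht hcr).1, (hncross t ht hcr).2])
  have hg1 : ¬ IsCrossing γ (c 1) := by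
    simp only [hc_def, ← closedCurve_zero_eq_one g]; exact hg0
  -- The direction is periodic, so it cancels between the two ends and only `s 0 * s 1` is left.
  have hdir : direction 𝒜 c 1 = direction 𝒜 c 0 := by
    have := direction_add_one 𝒜 (g := g) 0
    rwa [zero_add] at this
  rw [(hncross 0 ⟨le_rfl, zero_le_one⟩ hg0).2, (hncross 1 ⟨zero_le_one, le_rfl⟩ hg1).1, hdir,
    mul_mul_mul_comm, Int.units_mul_self, mul_one] at hmain
  rw [hmain, hcount, ← Finset.prod_const]
  refine Finset.prod_congr rfl fun t ht => ?_
  obtain ⟨h1, h2, h3⟩ := hSfin.mem_toFinset.1 ht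
  rw [hcross t ⟨h1.1.le, h1.2.le⟩ h2, if_pos h3]

/-- For a simple closed curve in the union of the family, the local colourings match along the
curve if and only if the condition on orientations and crossings holds. -/
theorem exists_good_colorSign_iff [Finite ι] [IsManifold (𝓡 2) ∞ M] (hγ : IsAdmissible γ)
    {g : UnitAddCircle → M} (hg : IsSimpleClosedCurveIn γ g) :
    (∃ s, Good (colorSign 𝒜) (range g) s) ↔
      (ChangesLocalOrientation g ↔ Odd (straightCount γ g)) := by
  -- move the initial point away from the crossings
  obtain ⟨a, ha⟩ : ∃ a : UnitAddCircle, ¬ IsCrossing γ (g a) := by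
    by_contra! h
    have h1 : (g ⁻¹' {p | IsCrossing γ p}).Finite :=
      (finite_setOf_isCrossing hγ).preimage hg.injective.injOn
    have h2 : g ⁻¹' {p | IsCrossing γ p} = univ := eq_univ_of_forall h
    rw [h2] at h1
    have h3 : (Ico (0 : ℝ) 1).Finite := Set.Finite.of_finite_image (h1.subset (subset_univ _))
      injOn_coe_unitAddCircle
    exact (Ico_infinite zero_lt_one) h3
  set g' : UnitAddCircle → M := fun x => g (x + a) with hg'_def
  have hrange : range g' = range g := (Equiv.addRight a).surjective.range_comp g
  have hg' : IsSimpleClosedCurveIn γ g' :=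
    ⟨hg.continuous.comp (continuous_add_const a), fun x y h => add_right_cancel (hg.injective h),
      hrange ▸ hg.subset⟩
  have hcount : straightCount γ g' = straightCount γ g := by
    simp only [straightCount, GoesStraightAt, hrange]
  have hg0 : ¬ IsCrossing γ (g' ((0 : ℝ) : UnitAddCircle)) := by
    simp only [hg'_def]
    rw [show ((0 : ℝ) : UnitAddCircle) = 0 from rfl, zero_add]; exact ha
  have hc := continuous_closedCurve hg'.continuous
  obtain ⟨s₁, hs₁⟩ := exists_good_Icc (by norm_num : (-1 : ℝ) ≤ 2)
    ((isCocycleOn_colorSign 𝒜 hγ).comp (K := Icc (-1) 2) hc.continuousOn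
      fun t _ => hg'.mem_support _)
  obtain ⟨v, w, hvw⟩ := exists_isFrameOn hc (by norm_num : (-1 : ℝ) ≤ 2)
  have hs₂ := hvw.good hc
  set s₂ : ℝ → ℤˣ := fun t => sgn (det₂ (v t) (w t))
  have hprod := hs₁.mul hs₂
  simp only [colorSign_mul_frameSign] at hprod
  have hmon := monodromy_turnSign 𝒜 hγ hg' hg0 hprod
  have hsub : Icc (0 : ℝ) 1 ⊆ Icc (-1) 2 := Icc_subset_Icc (by norm_num) (by norm_num)
  have h1 := exists_good_range_iff hg'.continuous hg'.injective (hs₁.mono hsub)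
  have h2 := exists_good_range_iff hg'.continuous hg'.injective (hs₂.mono hsub)
  rw [hrange] at h1 h2
  rw [changesLocalOrientation_iff hg.continuous hg.injective, h1, h2, ← hcount]
  have h3 : (s₁ 0 * s₁ 1) * (s₂ 0 * s₂ 1) = (-1) ^ straightCount γ g' := by
    rw [← hmon]; exact mul_mul_mul_comm _ _ _ _
  have h4 : ∀ x y : ℤˣ, x = y ↔ x * y = 1 := by decide
  rw [h4 (s₁ 0), h4 (s₂ 0)]
  rcases Int.units_eq_one_or (s₁ 0 * s₁ 1) with e1 | e1 <;>
    rcases Int.units_eq_one_or (s₂ 0 * s₂ 1) with e2 | e2 <;>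
    rcases Nat.even_or_odd (straightCount γ g') with e3 | e3 <;>
    simp only [e1, e2, e3.neg_one_pow] at h3 ⊢
  all_goals first
    | (exfalso; revert h3; decide)
    | simp [e3, Nat.not_odd_iff_even]

end Monodromy

/-! ### Simple arcs, their concatenation, and closed curves -/

section Arcs

variable {X : Type*}

open Classical in
/-- The path which follows `f` until time `a` and `h` afterwards. -/
noncomputable def concat (f h : ℝ → X) (a t : ℝ) : X := if t ≤ a then f t else h (t - a)

theorem concat_of_le {f h : ℝ → X} {a t : ℝ} (ht : t ≤ a) : concat f h a t = f t := if_pos ht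

theorem concat_of_ge {f h : ℝ → X} {a t : ℝ} (hfh : f a = h 0) (ht : a ≤ t) :
    concat f h a t = h (t - a) := by
  rcases ht.eq_or_lt with rfl | ht
  · rw [concat_of_le le_rfl, sub_self, hfh]
  · exact if_neg ht.not_ge

theorem concat_image {f h : ℝ → X} {a b : ℝ} (ha : 0 ≤ a) (hb : 0 ≤ b) (hfh : f a = h 0) :
    concat f h a '' Icc 0 (a + b) = f '' Icc 0 a ∪ h '' Icc 0 b := by
  rw [← Icc_union_Icc_eq_Icc ha (by linarith : a ≤ a + b), image_union]
  congr 1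
  · exact image_congr fun t ht => concat_of_le ht.2
  · ext x
    constructor
    · rintro ⟨t, ht, rfl⟩
      exact ⟨t - a, ⟨by linarith [ht.1], by linarith [ht.2]⟩, (concat_of_ge hfh ht.1).symm⟩
    · rintro ⟨t, ht, rfl⟩
      refine ⟨t + a, ⟨by linarith [ht.1], by linarith [ht.2]⟩, ?_⟩
      rw [concat_of_ge hfh (by linarith [ht.1]), add_sub_cancel_right]

variable [TopologicalSpace X]

theorem continuousOn_concat {f h : ℝ → X} {a b : ℝ} (ha : 0 ≤ a) (hb : 0 ≤ b) (hfh : f a = h 0)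
    (hf : ContinuousOn f (Icc 0 a)) (hh : ContinuousOn h (Icc 0 b)) :
    ContinuousOn (concat f h a) (Icc 0 (a + b)) := by
  rw [← Icc_union_Icc_eq_Icc ha (by linarith : a ≤ a + b)]
  refine ContinuousOn.union_of_isClosed ?_ ?_ isClosed_Icc isClosed_Icc
  · exact hf.congr fun t ht => concat_of_le ht.2
  · refine (hh.comp (f := fun t => t - a) (by fun_prop) ?_).congr fun t ht => concat_of_ge hfh ht.1
    exact fun t ht => ⟨by linarith [ht.1], by linarith [ht.2]⟩

/-- Two points are joined by a simple arc (or are equal) in `A`. -/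
def ArcJoined (A : Set X) (x y : X) : Prop :=
  ∃ L : ℝ, 0 ≤ L ∧ ∃ f : ℝ → X, ContinuousOn f (Icc 0 L) ∧ InjOn f (Icc 0 L) ∧ f 0 = x ∧ f L = y ∧
    MapsTo f (Icc 0 L) A

variable {A B : Set X} {x y z : X}

theorem ArcJoined.refl (hx : x ∈ A) : ArcJoined A x x :=
  ⟨0, le_rfl, fun _ => x, continuousOn_const, by simp, rfl, rfl, fun _ _ => hx⟩

theorem ArcJoined.mono (h : ArcJoined A x y) (hAB : A ⊆ B) : ArcJoined B x y := by
  obtain ⟨L, hL, f, h1, h2, h3, h4, h5⟩ := h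
  exact ⟨L, hL, f, h1, h2, h3, h4, h5.mono_right hAB⟩

theorem ArcJoined.symm (h : ArcJoined A x y) : ArcJoined A y x := by
  obtain ⟨L, hL, f, h1, h2, h3, h4, h5⟩ := h
  have hm : MapsTo (fun t => L - t) (Icc 0 L) (Icc 0 L) := fun t ht =>
    ⟨by linarith [ht.2], by linarith [ht.1]⟩
  refine ⟨L, hL, fun t => f (L - t), h1.comp (f := fun t => L - t) (by fun_prop) hm, ?_, by simpa,
    by simpa, h5.comp hm⟩
  intro s hs t ht hst
  have := h2 (hm hs) (hm ht) hst
  linarith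

/-- The concatenation of two arcs may meet itself. Leaving the first arc where it first meets the
second restores injectivity; the Hausdorff property makes the set of meeting times compact. -/
theorem ArcJoined.trans [T2Space X] (h : ArcJoined A x y) (h' : ArcJoined A y z) :
    ArcJoined A x z := by
  obtain ⟨L, hL, f, f1, f2, f3, f4, f5⟩ := h
  obtain ⟨K, hK, k, k1, k2, k3, k4, k5⟩ := h'
  -- the first time at which the first arc meets the second one
  have hcl : IsClosed (k '' Icc 0 K) := (isCompact_Icc.image_of_continuousOn k1).isClosed
  have hS : IsCompact (Icc 0 L ∩ f ⁻¹' (k '' Icc 0 K)) :=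
    isCompact_Icc.of_isClosed_subset (f1.preimage_isClosed_of_isClosed isClosed_Icc hcl)
      inter_subset_left
  obtain ⟨a, ⟨haL, u, hu, hua⟩, hmin⟩ := hS.exists_isLeast
    ⟨L, ⟨hL, le_rfl⟩, 0, ⟨le_rfl, hK⟩, by rw [k3, f4]⟩
  have hsub : Icc 0 a ⊆ Icc 0 L := Icc_subset_Icc le_rfl haL.2
  have hm : MapsTo (fun t => u + t) (Icc 0 (K - u)) (Icc 0 K) := fun t ht =>
    ⟨by linarith [ht.1, hu.1], by linarith [ht.2]⟩
  have hKu : 0 ≤ K - u := by linarith [hu.2]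
  have hfh : f a = (fun t => k (u + t)) 0 := by simpa using hua.symm
  refine ⟨a + (K - u), by linarith [haL.1], concat f (fun t => k (u + t)) a,
    continuousOn_concat haL.1 hKu hfh (f1.mono hsub)
      (k1.comp (f := fun t => u + t) (by fun_prop) hm), ?_, ?_, ?_, ?_⟩
  · have key : ∀ s t, s ∈ Icc 0 (a + (K - u)) → t ∈ Icc 0 (a + (K - u)) → s < t →
        concat f (fun t => k (u + t)) a s ≠ concat f (fun t => k (u + t)) a t := by
      intro s t hs ht hst heq
      rcases le_or_gt t a with hta | hta
      · rw [concat_of_le hta, concat_of_le (hst.le.trans hta)] at heq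
        exact hst.ne (f2 (hsub ⟨hs.1, hst.le.trans hta⟩) (hsub ⟨ht.1, hta⟩) heq)
      · have htm : u + (t - a) ∈ Icc 0 K := hm ⟨by linarith, by linarith [ht.2]⟩
        rw [concat_of_ge hfh hta.le] at heq
        rcases le_or_gt a s with hsa | hsa
        · rw [concat_of_ge hfh hsa] at heq
          have := k2 (hm ⟨by linarith, by linarith [hs.2]⟩) htm heq
          linarith
        · rw [concat_of_le hsa.le] at heq
          have := hmin ⟨hsub ⟨hs.1, hsa.le⟩, _, htm, heq.symm⟩
          linarith
    intro s hs t ht hst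
    rcases lt_trichotomy s t with h | h | h
    · exact absurd hst (key s t hs ht h)
    · exact h
    · exact absurd hst.symm (key t s ht hs h)
  · rw [concat_of_le haL.1, f3]
  · rw [concat_of_ge hfh (by linarith), add_sub_cancel_left, add_sub_cancel, k4]
  · rw [mapsTo_iff_image_subset, concat_image haL.1 hKu hfh]
    refine union_subset ?_ ?_
    · exact (f5.mono_left hsub).image_subset
    · exact (k5.comp hm).image_subset

theorem ArcJoined.of_image {f : ℝ → X} {L t : ℝ} (ht : 0 ≤ t) (htL : t ≤ L)
    (hf : ContinuousOn f (Icc 0 L)) (hinj : InjOn f (Icc 0 t)) :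
    ArcJoined (f '' Icc 0 L) (f 0) (f t) :=
  ⟨t, ht, f, hf.mono (Icc_subset_Icc le_rfl htL), hinj, rfl, rfl, fun _ hs =>
    mem_image_of_mem f ⟨hs.1, hs.2.trans htL⟩⟩

/-- A closed path without other self-intersections is a simple closed curve. -/
theorem exists_closedCurve {f : ℝ → X} {L : ℝ} (hL : 0 < L) (hf : ContinuousOn f (Icc 0 L))
    (hinj : InjOn f (Ico 0 L)) (hclosed : f 0 = f L) :
    ∃ g : UnitAddCircle → X, Continuous g ∧ Function.Injective g ∧ range g = f '' Icc 0 L := by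
  set h : ℝ → X := fun t => f (L * t)
  have hm : MapsTo (fun t => L * t) (Icc 0 1) (Icc 0 L) := fun t ht =>
    ⟨mul_nonneg hL.le ht.1, mul_le_of_le_one_right hL.le ht.2⟩
  have hm' : MapsTo (fun t => L * t) (Ico 0 1) (Ico 0 L) := fun t ht =>
    ⟨mul_nonneg hL.le ht.1, mul_lt_of_lt_one_right hL ht.2⟩
  have hval : ∀ t ∈ Ico (0 : ℝ) 1, AddCircle.liftIco 1 0 h (t : UnitAddCircle) = h t := fun t ht =>
    AddCircle.liftIco_zero_coe_apply ht
  refine ⟨AddCircle.liftIco 1 0 h, ?_, ?_, ?_⟩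
  · refine AddCircle.liftIco_zero_continuous (by simpa [h] using hclosed) ?_
    exact hf.comp (f := fun t => L * t) (by fun_prop) hm
  · intro x y hxy
    obtain ⟨s, hs, rfl⟩ := AddCircle.eq_coe_Ico x
    obtain ⟨t, ht, rfl⟩ := AddCircle.eq_coe_Ico y
    rw [hval s hs, hval t ht] at hxy
    rw [mul_left_cancel₀ hL.ne' (hinj (hm' hs) (hm' ht) hxy)]
  · ext x
    constructor
    · rintro ⟨y, rfl⟩
      obtain ⟨s, hs, rfl⟩ := AddCircle.eq_coe_Ico y
      rw [hval s hs]
      exact ⟨L * s, hm ⟨hs.1, hs.2.le⟩, rfl⟩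
    · rintro ⟨t, ht, rfl⟩
      rcases ht.2.eq_or_lt with rfl | hlt
      · refine ⟨((0 : ℝ) : UnitAddCircle), ?_⟩
        rw [hval 0 ⟨le_rfl, zero_lt_one⟩, ← hclosed]
        simp [h]
      · refine ⟨((t / L : ℝ) : UnitAddCircle), ?_⟩
        rw [hval _ ⟨div_nonneg ht.1 hL.le, (div_lt_one hL).2 hlt⟩]
        simp only [h]
        rw [mul_div_cancel₀ _ hL.ne']

end Arcs

/-! ### Extending a section over one more arc -/

section Graph

variable {X : Type*} [TopologicalSpace X] {δ : X → X → ℤˣ} {Γ A : Set X}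

/-- A closed part of `Γ` on which the local system has a section, and of which the classes of
points joined by arcs are separated. -/
structure HasSectionOn (δ : X → X → ℤˣ) (Γ A : Set X) : Prop where
  closed : IsClosed A
  subset : A ⊆ Γ
  exists_good : ∃ s, Good δ A s
  exists_label : ∃ φ : X → X, (∀ p ∈ A, ∀ᶠ q in 𝓝[A] p, φ q = φ p) ∧
    ∀ x ∈ A, ∀ y ∈ A, φ x = φ y → ArcJoined A x y

theorem Good.exists_eq_at {s : X → ℤˣ} (h : Good δ A s) (x : X) (c : ℤˣ) :
    ∃ s', Good δ A s' ∧ s' x = c :=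
  ⟨_, h.mul_const (s x * c), by rw [← mul_assoc, Int.units_mul_self, one_mul]⟩

-- There are three situations. A loop is a simple closed curve, so it carries a section. If both
-- ends lie in A with the same label, an arc in A closes the new arc to a simple closed curve; along
-- the old arc the two sections differ by a constant sign, so they match at both ends. Otherwise the
-- new arc has a section of its own, and a mismatch at the far end is repaired by changing the old
-- section on the label class of that end, which does not contain the near end.
open Classical in
theorem HasSectionOn.exists_glueable [T2Space X] (hδ : IsCocycleOn δ Γ)
    (hcurves : ∀ g : UnitAddCircle → X, Continuous g → Function.Injective g → range g ⊆ Γ →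
      ∃ s, Good δ (range g) s)
    (hA : HasSectionOn δ Γ A) {f : ℝ → X} {L : ℝ} (hL : 0 < L) (hf : ContinuousOn f (Icc 0 L))
    (hinj : InjOn f (Ico 0 L)) (hinj' : InjOn f (Ioc 0 L)) (hfΓ : MapsTo f (Icc 0 L) Γ)
    (hf0 : f 0 ∈ A) (hfA : ∀ t ∈ Ioo 0 L, f t ∉ A) :
    ∃ s r, Good δ A s ∧ Good δ (f '' Icc 0 L) r ∧ s (f 0) = r (f 0) ∧
      (f L ∈ A → s (f L) = r (f L)) := by
  obtain ⟨s, hs⟩ := hA.exists_good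
  obtain ⟨φ, hφ, hφ'⟩ := hA.exists_label
  have h0 : (0 : ℝ) ∈ Icc 0 L := ⟨le_rfl, hL.le⟩
  have hLm : L ∈ Icc 0 L := ⟨hL.le, le_rfl⟩
  by_cases hcl : f 0 = f L
  · obtain ⟨g, g1, g2, g3⟩ := exists_closedCurve hL hf hinj hcl
    obtain ⟨r, hr⟩ := hcurves g g1 g2 (g3 ▸ hfΓ.image_subset)
    rw [g3] at hr
    obtain ⟨r', hr', h⟩ := hr.exists_eq_at (f 0) (s (f 0))
    exact ⟨s, r', hs, hr', h.symm, fun _ => by rw [← hcl, h]⟩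
  have hinjI : InjOn f (Icc 0 L) := by
    intro a ha b hb hab
    rcases ha.2.eq_or_lt with rfl | ha'
    · rcases hb.1.eq_or_lt with rfl | hb'
      · exact absurd hab.symm hcl
      · exact hinj' ⟨hL, le_rfl⟩ ⟨hb', hb.2⟩ hab
    · rcases hb.2.eq_or_lt with rfl | hb'
      · rcases ha.1.eq_or_lt with rfl | ha''
        · exact absurd hab hcl
        · exact hinj' ⟨ha'', ha.2⟩ ⟨hL, le_rfl⟩ hab
      · exact hinj ⟨ha.1, ha'⟩ ⟨hb.1, hb'⟩ hab
  by_cases hsame : f L ∈ A ∧ φ (f L) = φ (f 0)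
  · -- the new arc closes up to a simple closed curve
    obtain ⟨K, hK, h, k1, k2, k3, k4, k5⟩ := hφ' _ hsame.1 _ hf0 hsame.2
    have hKpos : 0 < K := hK.lt_of_ne fun h => hcl (by rw [← k4, ← k3, h])
    have hfh : f L = h 0 := k3.symm
    have hdisj : ∀ a ∈ Ico 0 L, ∀ b ∈ Ico 0 K, f a ≠ h b := by
      intro a ha b hb hab
      rcases ha.1.eq_or_lt with rfl | ha'
      · rw [← k4] at hab
        exact hb.2.ne' (k2 ⟨hK, le_rfl⟩ ⟨hb.1, hb.2.le⟩ hab)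
      · exact hfA a ⟨ha', ha.2⟩ (hab ▸ k5 ⟨hb.1, hb.2.le⟩)
    have hinjC : InjOn (concat f h L) (Ico 0 (L + K)) := by
      intro a ha b hb hab
      rcases lt_or_ge a L with haL | haL <;> rcases lt_or_ge b L with hbL | hbL
      · rw [concat_of_le haL.le, concat_of_le hbL.le] at hab
        exact hinjI ⟨ha.1, haL.le⟩ ⟨hb.1, hbL.le⟩ hab
      · rw [concat_of_le haL.le, concat_of_ge hfh hbL] at hab
        exact absurd hab (hdisj a ⟨ha.1, haL⟩ _ ⟨by linarith, by linarith [hb.2]⟩)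
      · rw [concat_of_ge hfh haL, concat_of_le hbL.le] at hab
        exact absurd hab.symm (hdisj b ⟨hb.1, hbL⟩ _ ⟨by linarith, by linarith [ha.2]⟩)
      · rw [concat_of_ge hfh haL, concat_of_ge hfh hbL] at hab
        have := k2 ⟨by linarith, by linarith [ha.2]⟩ ⟨by linarith, by linarith [hb.2]⟩ hab
        linarith
    obtain ⟨g, g1, g2, g3⟩ := exists_closedCurve (by linarith) (continuousOn_concat hL.le hK hfh hf k1)
      hinjC (by rw [concat_of_le hL.le, concat_of_ge hfh (by linarith), add_sub_cancel_left, k4])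
    rw [concat_image hL.le hK hfh] at g3
    obtain ⟨r, hr⟩ := hcurves g g1 g2 (g3 ▸ union_subset hfΓ.image_subset
      (k5.image_subset.trans hA.subset))
    rw [g3] at hr
    obtain ⟨r', hr', h'⟩ := hr.exists_eq_at (f 0) (s (f 0))
    refine ⟨s, r', hs, hr'.mono subset_union_left, h'.symm, fun _ => ?_⟩
    have hconn : IsPreconnected (h '' Icc 0 K) := isPreconnected_Icc.image h k1
    have := (hs.mono k5.image_subset).mul_eq (hr'.mono subset_union_right) hconn
      (mem_image_of_mem h ⟨le_rfl, hK⟩) (mem_image_of_mem h ⟨hK, le_rfl⟩)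
    rw [k3, k4, h', Int.units_mul_self] at this
    exact (by decide : ∀ x y : ℤˣ, x * y = 1 → x = y) _ _ this
  · obtain ⟨r, hr⟩ := exists_good_image_of_injOn hL.le hf hinjI hδ hfΓ
    obtain ⟨r', hr', h⟩ := hr.exists_eq_at (f 0) (s (f 0))
    by_cases hLA : f L ∈ A
    · have hne : φ (f L) ≠ φ (f 0) := fun h => hsame ⟨hLA, h⟩
      refine ⟨_, r', hs.mul_locConst (s' := fun x => if φ x = φ (f L) then s (f L) * r' (f L) else 1)
        (fun p hp => ?_), hr', ?_, fun _ => ?_⟩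
      · filter_upwards [hφ p hp] with q hq
        rw [hq]
      · rw [if_neg hne.symm, mul_one, h]
      · rw [if_pos rfl, ← mul_assoc, Int.units_mul_self, one_mul]
    · exact ⟨s, r', hs, hr', h.symm, fun h => absurd h hLA⟩

open Classical in
/-- An arc, or a loop, can be added to a closed part of `Γ` with a section. -/
theorem HasSectionOn.union_arc [T2Space X] (hδ : IsCocycleOn δ Γ)
    (hcurves : ∀ g : UnitAddCircle → X, Continuous g → Function.Injective g → range g ⊆ Γ →
      ∃ s, Good δ (range g) s)
    (hA : HasSectionOn δ Γ A) {f : ℝ → X} {L : ℝ} (hL : 0 < L) (hf : ContinuousOn f (Icc 0 L))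
    (hinj : InjOn f (Ico 0 L)) (hinj' : InjOn f (Ioc 0 L)) (hfΓ : MapsTo f (Icc 0 L) Γ)
    (hf0 : f 0 ∈ A) (hfA : ∀ t ∈ Ioo 0 L, f t ∉ A) :
    HasSectionOn δ Γ (A ∪ f '' Icc 0 L) := by
  have hBcl : IsClosed (f '' Icc 0 L) := (isCompact_Icc.image_of_continuousOn hf).isClosed
  have hinter : ∀ x ∈ A ∩ f '' Icc 0 L, x = f 0 ∨ (x = f L ∧ f L ∈ A) := by
    rintro _ ⟨hxA, t, ht, rfl⟩
    rcases ht.1.eq_or_lt with rfl | h1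
    · exact Or.inl rfl
    rcases ht.2.eq_or_lt with rfl | h2
    · exact Or.inr ⟨rfl, hxA⟩
    · exact absurd hxA (hfA t ⟨h1, h2⟩)
  refine ⟨hA.closed.union hBcl, union_subset hA.subset hfΓ.image_subset, ?_, ?_⟩
  · obtain ⟨s, r, hs, hr, h1, h2⟩ := hA.exists_glueable hδ hcurves hL hf hinj hinj' hfΓ hf0 hfA
    obtain ⟨q, hq, -⟩ := hs.glue hA.closed hBcl hr (fun x hx => by
      rcases hinter x hx with rfl | ⟨rfl, h⟩
      · exact h1
      · exact h2 h)
    exact ⟨q, hq⟩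
  · obtain ⟨φ, hφ, hφ'⟩ := hA.exists_label
    -- The new arc merges the class of its far end, when that end lies in A, into the class of `f
    -- 0`. The arc itself receives the same label.
    set ψ : X → X := fun x => if f L ∈ A ∧ φ x = φ (f L) then φ (f 0) else φ x with hψ
    set χ : X → X := fun x => if x ∈ A then ψ x else φ (f 0) with hχ
    have hχA : ∀ x ∈ A, χ x = ψ x := fun x hx => if_pos hx
    have hχB : ∀ x ∈ f '' Icc 0 L, χ x = φ (f 0) := by
      intro x hx
      by_cases hxA : x ∈ A
      · rw [hχA x hxA]
        rcases hinter x ⟨hxA, hx⟩ with rfl | ⟨rfl, h⟩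
        · by_cases hc : f L ∈ A ∧ φ (f 0) = φ (f L)
          · exact if_pos hc
          · exact if_neg hc
        · exact if_pos ⟨h, rfl⟩
      · exact if_neg hxA
    refine ⟨χ, eventually_union_of_closed (P := fun p q => χ q = χ p) hA.closed hBcl
      (fun p hp => ?_) (fun p hp => ?_), ?_⟩
    · filter_upwards [hφ p hp, self_mem_nhdsWithin] with q hq hqA
      rw [hχA q hqA, hχA p hp]
      simp only [hψ, hq]
    · filter_upwards [self_mem_nhdsWithin] with q hq
      rw [hχB q hq, hχB p hp]
    · have hB : ∀ x ∈ f '' Icc 0 L, ArcJoined (A ∪ f '' Icc 0 L) (f 0) x := by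
        rintro _ ⟨t, ht, rfl⟩
        by_cases h : f t = f 0
        · rw [h]; exact ArcJoined.refl (Or.inl hf0)
        refine (ArcJoined.of_image ht.1 ht.2 hf ?_).mono subset_union_right
        intro a ha b hb hab
        have aux : ∀ u ∈ Icc 0 t, f u = f 0 → u = 0 := by
          intro u hu hu0
          by_contra hne
          rcases (hu.2.trans ht.2).eq_or_lt with rfl | hlt
          · obtain rfl : u = t := le_antisymm hu.2 ht.2
            exact h hu0
          · exact hne (hinj ⟨hu.1, hlt⟩ ⟨le_rfl, hL⟩ hu0)
        rcases ha.1.eq_or_lt with rfl | ha'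
        · exact (aux b hb hab.symm).symm
        rcases hb.1.eq_or_lt with rfl | hb'
        · exact aux a ha hab
        · exact hinj' ⟨ha', ha.2.trans ht.2⟩ ⟨hb', hb.2.trans ht.2⟩ hab
      have hmain : ∀ x ∈ A ∪ f '' Icc 0 L, χ x = φ (f 0) → ArcJoined (A ∪ f '' Icc 0 L) (f 0) x := by
        rintro x (hx | hx) hxφ
        · rw [hχA x hx] at hxφ
          by_cases hc : f L ∈ A ∧ φ x = φ (f L)
          · exact (hB _ ⟨L, ⟨hL.le, le_rfl⟩, rfl⟩).trans
              ((hφ' _ hc.1 _ hx hc.2.symm).mono subset_union_left)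
          · rw [hψ] at hxφ
            simp only [if_neg hc] at hxφ
            exact (hφ' _ hf0 _ hx hxφ.symm).mono subset_union_left
        · exact hB x hx
      have hother : ∀ x ∈ A ∪ f '' Icc 0 L, χ x ≠ φ (f 0) → x ∈ A ∧ χ x = φ x := by
        rintro x (hx | hx) hxφ
        · refine ⟨hx, ?_⟩
          rw [hχA x hx] at hxφ ⊢
          by_cases hc : f L ∈ A ∧ φ x = φ (f L)
          · exact absurd (if_pos hc) hxφ
          · exact if_neg hc
        · exact absurd (hχB x hx) hxφ
      intro x hx y hy hxy
      by_cases hc : χ x = φ (f 0)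
      · exact (hmain x hx hc).symm.trans (hmain y hy (hxy ▸ hc))
      · obtain ⟨h1, h2⟩ := hother x hx hc
        obtain ⟨h3, h4⟩ := hother y hy (hxy ▸ hc)
        exact (hφ' x h1 y h3 (by rw [← h2, ← h4, hxy])).mono subset_union_left

theorem HasSectionOn.of_finite [T1Space X] (hδ : IsCocycleOn δ Γ) (hA : A.Finite) (hAΓ : A ⊆ Γ) :
    HasSectionOn δ Γ A := by
  have hev : ∀ p, ∀ᶠ q in 𝓝[A] p, q = p := by
    intro p
    filter_upwards [self_mem_nhdsWithin, mem_nhdsWithin_of_mem_nhds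
      ((hA.subset (sdiff_subset (t := {p}))).isClosed.isOpen_compl.mem_nhds (by simp))] with q h1 h2
    by_contra h
    exact h2 ⟨h1, h⟩
  refine ⟨hA.isClosed, hAΓ, ⟨fun _ => 1, fun p hp => ?_⟩, id, fun p _ => hev p, fun x hx y _ hxy => ?_⟩
  · have h1 := ((hδ p (hAΓ hp)).self_of_nhdsWithin (hAΓ hp)).self_of_nhdsWithin (hAΓ hp)
    filter_upwards [hev p] with q hq
    rw [hq, one_mul]
    exact (mul_eq_left.1 h1.symm).symm
  · obtain rfl : x = y := hxy
    exact ArcJoined.refl hx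

end Graph

/-! ### From simple closed curves to the whole union -/

section Family

variable {M : Type*} [TopologicalSpace M] [ChartedSpace Plane M] [IsManifold (𝓡 2) ∞ M]
  [T2Space M] {ι : Type*} [Finite ι] {γ : ι → UnitAddCircle → M}

theorem IsAdmissible.finite_crossing_times (hγ : IsAdmissible γ) (i : ι) :
    {t ∈ Ico (0 : ℝ) 1 | IsCrossing γ (γ i (t : UnitAddCircle))}.Finite := by
  have h1 : {x : ι × UnitAddCircle | IsCrossing γ (γ x.1 x.2)}.Finite := by
    have : {x : ι × UnitAddCircle | IsCrossing γ (γ x.1 x.2)} =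
        ⋃ p ∈ {p : M | IsCrossing γ p}, {x : ι × UnitAddCircle | γ x.1 x.2 = p} := by
      ext x; simp
    rw [this]
    exact (finite_setOf_isCrossing hγ).biUnion fun p hp =>
      finite_of_encard_eq_coe (k := 2) hp
  refine Set.Finite.of_finite_image (f := fun t : ℝ => (i, (t : UnitAddCircle)))
    (h1.subset ?_) ?_
  · rintro _ ⟨t, ht, rfl⟩
    exact ht.2
  · intro s hs t ht hst
    exact injOn_coe_unitAddCircle hs.1 ht.1 (congrArg Prod.snd hst)

variable {δ : M → M → ℤˣ} {A : Set M}

/-- A section extends along an interval of a curve of the family. -/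
theorem HasSectionOn.union_curve (hγ : IsAdmissible γ) (hδ : IsCocycleOn δ (support γ))
    (hcurves : ∀ g : UnitAddCircle → M, Continuous g → Function.Injective g →
      range g ⊆ support γ → ∃ s, Good δ (range g) s) (i : ι) (n : ℕ) :
    ∀ (a b : ℝ), 0 ≤ a → a < b → b ≤ 1 →
    {t ∈ Ioo a b | IsCrossing γ (γ i (t : UnitAddCircle))}.ncard = n →
    ∀ A, HasSectionOn δ (support γ) A → γ i (a : UnitAddCircle) ∈ A →
    (∀ t ∈ Ioo a b, ¬ IsCrossing γ (γ i (t : UnitAddCircle)) → γ i (t : UnitAddCircle) ∉ A) →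
    HasSectionOn δ (support γ) (A ∪ (fun t : ℝ => γ i (t : UnitAddCircle)) '' Icc a b) := by
  induction n using Nat.strong_induction_on with
  | _ n ih =>
  intro a b ha hab hb hn A hA hAa hAab
  have hcont : Continuous fun t : ℝ => γ i (t : UnitAddCircle) :=
    continuous_closedCurve (hγ.continuous i)
  have hfin : ∀ u v : ℝ, 0 ≤ u → v ≤ 1 → {t ∈ Ioo u v | IsCrossing γ (γ i (t : UnitAddCircle))}.Finite :=
    fun u v hu hv => (hγ.finite_crossing_times i).subset fun t ht =>
      ⟨⟨hu.trans ht.1.1.le, ht.1.2.trans_le hv⟩, ht.2⟩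
  by_cases hex : ∃ c ∈ Ioo a b, IsCrossing γ (γ i (c : UnitAddCircle))
  · obtain ⟨c, hc, hcr⟩ := hex
    have hlt : ∀ u v : ℝ, a ≤ u → v ≤ b → c ∉ Ioo u v →
        {t ∈ Ioo u v | IsCrossing γ (γ i (t : UnitAddCircle))}.ncard < n := by
      intro u v hu hv hcuv
      rw [← hn]
      refine ncard_lt_ncard ?_ (hfin a b ha hb)
      refine ⟨fun t ht => ⟨⟨hu.trans_lt ht.1.1, ht.1.2.trans_le hv⟩, ht.2⟩, fun h => ?_⟩
      exact hcuv (h ⟨hc, hcr⟩).1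
    have h1 := ih _ (hlt a c le_rfl hc.2.le fun h => lt_irrefl _ h.2) a c ha hc.1
      (hc.2.le.trans hb) rfl A hA hAa fun t ht => hAab t ⟨ht.1, ht.2.trans hc.2⟩
    have h2 := ih _ (hlt c b hc.1.le le_rfl fun h => lt_irrefl _ h.1) c b (ha.trans hc.1.le) hc.2
      hb rfl _ h1 (Or.inr ⟨c, ⟨hc.1.le, le_rfl⟩, rfl⟩) (by
        rintro t ht htc (h | ⟨u, hu, hut⟩)
        · exact hAab t ⟨hc.1.trans ht.1, ht.2⟩ htc h
        · have := hγ.eq_of_curve_eq htc hut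
            (abs_lt.2 ⟨by linarith [hu.1, ht.2], by linarith [hu.2, ht.1]⟩)
          linarith [hu.2, ht.1])
    rwa [union_assoc, ← image_union, Icc_union_Icc_eq_Icc hc.1.le hc.2.le] at h2
  · push Not at hex
    -- Without interior crossings each interior point is passed only once, so the piece is an arc,
    -- or a loop if its ends coincide.
    have hkey : ∀ s t : ℝ, s ∈ Icc 0 (b - a) → t ∈ Ioo 0 (b - a) →
        γ i ((a + s : ℝ) : UnitAddCircle) = γ i ((a + t : ℝ) : UnitAddCircle) → s = t := by
      intro s t hs ht hst
      have := hγ.eq_of_curve_eq (hex (a + t) ⟨by linarith [ht.1], by linarith [ht.2]⟩) hst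
        (abs_lt.2 ⟨by linarith [hs.1, ht.2], by linarith [hs.2, ht.1]⟩)
      linarith
    have himage : (fun t : ℝ => γ i ((a + t : ℝ) : UnitAddCircle)) '' Icc 0 (b - a) =
        (fun t : ℝ => γ i (t : UnitAddCircle)) '' Icc a b := by
      ext x
      constructor
      · rintro ⟨t, ht, rfl⟩
        exact ⟨a + t, ⟨by linarith [ht.1], by linarith [ht.2]⟩, rfl⟩
      · rintro ⟨t, ht, rfl⟩
        exact ⟨t - a, ⟨by linarith [ht.1], by linarith [ht.2]⟩, by simp⟩
    have h := hA.union_arc hδ hcurves (f := fun t : ℝ => γ i ((a + t : ℝ) : UnitAddCircle))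
      (L := b - a) (by linarith) (hcont.comp (continuous_const.add continuous_id)).continuousOn
      (fun s hs t ht hst => by
        rcases ht.1.eq_or_lt with rfl | ht'
        · rcases hs.1.eq_or_lt with rfl | hs'
          · rfl
          · exact (hkey _ _ ⟨le_rfl, by linarith⟩ ⟨hs', hs.2⟩ hst.symm).symm
        · exact hkey _ _ ⟨hs.1, hs.2.le⟩ ⟨ht', ht.2⟩ hst)
      (fun s hs t ht hst => by
        rcases ht.2.eq_or_lt with rfl | ht'
        · rcases hs.2.eq_or_lt with rfl | hs'
          · rfl
          · exact (hkey _ _ ⟨ht.1.le, ht.2⟩ ⟨hs.1, hs'⟩ hst.symm).symm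
        · exact hkey _ _ ⟨hs.1.le, hs.2⟩ ⟨ht.1, ht'⟩ hst)
      (fun t _ => mem_iUnion.2 ⟨i, mem_range_self _⟩) (by simpa using hAa)
      (fun t ht => hAab _ ⟨by linarith [ht.1], by linarith [ht.2]⟩
        (hex _ ⟨by linarith [ht.1], by linarith [ht.2]⟩))
    rwa [himage] at h

/-- If the local system has a section along every simple closed curve, then it has a section on
the whole union of the family. -/
theorem IsAdmissible.exists_good_support (hγ : IsAdmissible γ) (hδ : IsCocycleOn δ (support γ))
    (hcurves : ∀ g : UnitAddCircle → M, Continuous g → Function.Injective g →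
      range g ⊆ support γ → ∃ s, Good δ (range g) s) :
    ∃ s, Good δ (support γ) s := by
  classical
  have := Fintype.ofFinite ι
  -- The base points of all curves are included from the start, so that every curve begins in the
  -- part already treated.
  set A₀ : Set M := range fun i => γ i ((0 : ℝ) : UnitAddCircle)
  have hA₀ : A₀ ⊆ support γ := by
    rintro _ ⟨i, rfl⟩; exact mem_iUnion.2 ⟨i, mem_range_self _⟩
  have key : ∀ S : Finset ι, HasSectionOn δ (support γ) (A₀ ∪ ⋃ i ∈ S, range (γ i)) := by
    intro S
    induction S using Finset.induction_on with
    | empty =>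
      simp only [Finset.notMem_empty, iUnion_false, iUnion_empty, union_empty]
      exact HasSectionOn.of_finite hδ (finite_range _) hA₀
    | insert i S hi ih =>
      have h := HasSectionOn.union_curve hγ hδ hcurves i _ 0 1 le_rfl zero_lt_one le_rfl rfl _ ih
        (Or.inl ⟨i, rfl⟩) (by
          rintro t ht htc (⟨j, hj⟩ | h)
          · have h1 := hγ.eq_of_not_isCrossing htc hj rfl
            have := eq_of_coe_eq_of_abs_sub_lt h1.2
              (abs_lt.2 ⟨by linarith [ht.2], by linarith [ht.1]⟩)
            exact ht.1.ne this
          · obtain ⟨j, hjS, x, hx⟩ := mem_iUnion₂.1 h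
            have h1 := hγ.eq_of_not_isCrossing htc hx rfl
            exact hi (h1.1 ▸ hjS))
      rw [image_closedCurve, union_assoc] at h
      rwa [Finset.set_biUnion_insert, union_comm (range (γ i))]
  have h := key Finset.univ
  have hall : A₀ ∪ ⋃ i ∈ (Finset.univ : Finset ι), range (γ i) = support γ := by
    simp only [Finset.mem_univ, iUnion_true]
    exact union_eq_right.2 hA₀
  rw [hall] at h
  exact h.exists_good

end Family

/-! ### Constancy around a point from constancy at nearby points of the curves -/

section Extension

theorem norm_axis_add_axis_lt {x y ρ : ℝ} (hx : |x| < ρ / 2) (hy : |y| < ρ / 2) :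
    ‖axis 0 x + axis 1 y‖ < ρ := by
  refine (norm_add_le _ _).trans_lt ?_
  simp only [axis, PiLp.norm_single, Real.norm_eq_abs]
  linarith

variable {M : Type*} [TopologicalSpace M] [ChartedSpace Plane M]
  {ι : Type*} {γ : ι → UnitAddCircle → M}

namespace IsStraightChart

variable {p : M} {e : OpenPartialHomeomorph M Plane} {r : ℝ} {b : Fin 2 → ι × ℝ}
  (h : IsStraightChart γ p e r b)

include h

/-- If a function is constant off the curves near each point of an axis, then it takes the same
values on both sides of that axis. -/
theorem exists_pos_eq {Y : Type*} {f : M → Y} {k k' : Fin 2} (hkk' : k' ≠ k) {x : ℝ}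
    (hx0 : x ≠ 0) (hx : |x| < r)
    (hc : ∃ c, ∀ᶠ z in 𝓝 (e.symm (axis k x)), z ∉ support γ → f z = c) {ε : ℝ} (hε : 0 < ε) :
    ∃ w, 0 < w ∧ w < ε ∧ f (e.symm (axis k x + axis k' w)) = f (e.symm (axis k x + axis k' (-w))) := by
  obtain ⟨c, hc⟩ := hc
  have hcont : Continuous fun w : ℝ => axis k x + axis k' w := by
    have : (fun w : ℝ => axis k x + axis k' w) = fun w => axis k x + w • axis k' 1 := by
      funext w; congr 1; ext i; simp [axis, PiLp.single_apply]
    rw [this]; fun_prop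
  have h0 : axis k x + axis k' 0 = axis k x := by simp
  have hsymm : ContinuousAt (fun w : ℝ => e.symm (axis k x + axis k' w)) 0 := by
    refine ContinuousAt.comp ?_ hcont.continuousAt
    rw [h0]; exact e.continuousAt_symm (h.axis_mem_target hx)
  have e1 : ∀ᶠ w in 𝓝 (0 : ℝ), e.symm (axis k x + axis k' w) ∉ support γ →
      f (e.symm (axis k x + axis k' w)) = c :=
    hsymm.eventually (p := fun z => z ∉ support γ → f z = c) (by simp only [h0]; exact hc)
  have e2 : ∀ᶠ w in 𝓝 (0 : ℝ), axis k x + axis k' w ∈ e.target :=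
    hcont.continuousAt.eventually (p := fun y => y ∈ e.target)
      (e.open_target.mem_nhds (by simp only [h0]; exact h.axis_mem_target hx))
  obtain ⟨δ, hδ, hall⟩ := Metric.eventually_nhds_iff.1 (e1.and e2)
  have hoff : ∀ w : ℝ, w ≠ 0 → axis k x + axis k' w ∈ e.target →
      e.symm (axis k x + axis k' w) ∉ support γ := by
    intro w hw ht
    rw [h.mem_support_iff (e.map_target ht), e.right_inv ht]
    rcases Fin.exists_fin_two.1 ⟨k, rfl⟩ with rfl | rfl <;>
      rcases Fin.exists_fin_two.1 ⟨k', rfl⟩ with rfl | rfl <;> simp_all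
  set w := min δ ε / 2
  have hw : 0 < w := by have := lt_min hδ hε; simp only [w]; linarith
  have hwδ : w < δ := by have := min_le_left δ ε; have := lt_min hδ hε; simp only [w]; linarith
  have hwε : w < ε := by have := min_le_right δ ε; have := lt_min hδ hε; simp only [w]; linarith
  have hp := hall (y := w) (by rwa [Real.dist_eq, sub_zero, abs_of_pos hw])
  have hm := hall (y := -w) (by rwa [Real.dist_eq, sub_zero, abs_neg, abs_of_pos hw])
  exact ⟨w, hw, hwε, by rw [hp.1 (hoff w hw.ne' hp.2), hm.1 (hoff (-w) (neg_ne_zero.2 hw.ne') hm.2)]⟩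

/-- A function which is locally constant off the curves and constant off the curves near all points
of the curves close to `p`, other than `p`, is constant off the curves near `p`. -/
theorem eventually_const {Y : Type*} {f : M → Y}
    (hf : ∀ᶠ x in 𝓝 p, x ∉ support γ → ∀ᶠ y in 𝓝 x, f y = f x)
    (hq : ∀ᶠ q in 𝓝 p, q ∈ support γ → q ≠ p → ∃ c, ∀ᶠ x in 𝓝 q, x ∉ support γ → f x = c) :
    ∃ c, ∀ᶠ x in 𝓝 p, x ∉ support γ → f x = c := by
  obtain ⟨ρ₁, hρ₁, hρ₁r, hS⟩ := h.eq_on_sectors hf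
  obtain ⟨ρ₂, hρ₂, hρ₂r, hQ⟩ := h.exists_norm_lt hq
  have hQ' : ∀ k, IsAxisAt γ p k → ∀ x : ℝ, x ≠ 0 → |x| < ρ₂ →
      ∃ c, ∀ᶠ z in 𝓝 (e.symm (axis k x)), z ∉ support γ → f z = c := by
    intro k hk x hx0 hx
    refine hQ _ (by simpa [axis] using hx) (h.symm_axis_mem_support hk (hx.trans_le hρ₂r)) ?_
    intro heq
    have h1 := e.right_inv (h.axis_mem_target (k := k) (hx.trans_le hρ₂r))
    rw [heq, h.map_self] at h1
    exact hx0 (by simpa using (congrArg (fun v : Plane => v k) h1).symm)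
  by_cases hc : IsCrossing γ p
  · set ρ := min ρ₁ ρ₂
    have hρ : 0 < ρ := lt_min hρ₁ hρ₂
    set F : ℝ → ℝ → Y := fun x y => f (e.symm (axis 0 x + axis 1 y))
    -- the values in one quadrant agree
    have hquad : ∀ x y x' y' : ℝ, |x| < ρ / 2 → |y| < ρ / 2 → |x'| < ρ / 2 → |y'| < ρ / 2 →
        0 < x * x' → 0 < y * y' → F x y = F x' y' := by
      intro x y x' y' hx hy hx' hy' hxx hyy
      have hlin : ∀ (k : Fin 2) (z : ℝ), IsLinearMap ℝ (fun v : Plane => z * v k) := fun k z =>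
        ⟨fun v w => by simp [mul_add], fun c v => by simp; ring⟩
      have hxne : x ≠ 0 := by rintro rfl; simp at hxx
      have hyne : y ≠ 0 := by rintro rfl; simp at hyy
      have hmem : ∀ u v : ℝ, |u| < ρ / 2 → |v| < ρ / 2 → axis 0 u + axis 1 v ∈ Metric.ball (0 : Plane) ρ₁ :=
        fun u v hu hv => by
          rw [mem_ball_zero_iff]
          exact (norm_axis_add_axis_lt hu hv).trans_le (min_le_left _ _)
      refine hS (Metric.ball 0 ρ₁ ∩ ({v : Plane | 0 < x * v 0} ∩ {v : Plane | 0 < y * v 1}))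
        inter_subset_left ((convex_ball _ _).inter ((convex_halfSpace_gt (hlin 0 x) 0).inter
          (convex_halfSpace_gt (hlin 1 y) 0))) ?_ _ ⟨hmem x y hx hy, ?_, ?_⟩ _
          ⟨hmem x' y' hx' hy', ?_, ?_⟩
      · rintro v ⟨hv, hv0, hv1⟩ hvs
        have hvt : v ∈ e.target := by
          rw [h.target]; exact Metric.ball_subset_ball hρ₁r hv
        rw [h.mem_support_iff (e.map_target hvt), e.right_inv hvt] at hvs
        have hv0 : 0 < x * v 0 := hv0
        have hv1 : 0 < y * v 1 := hv1
        rcases hvs with h | ⟨-, h⟩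
        · rw [h] at hv1; simp at hv1
        · rw [h] at hv0; simp at hv0
      · simpa using mul_self_pos.2 hxne
      · simpa using mul_self_pos.2 hyne
      · simpa using hxx
      · simpa using hyy
    -- the values on both sides of each axis agree
    have hρ2 : ρ / 2 < ρ₂ := by have := min_le_right ρ₁ ρ₂; simp only [ρ] at hρ ⊢; linarith
    have hsq : ∀ {x : ℝ}, x ≠ 0 → 0 < x * x := fun hx => mul_self_pos.2 hx
    have href1 : ∀ x y : ℝ, x ≠ 0 → 0 < y → |x| < ρ / 2 → |y| < ρ / 2 → F x y = F x (-y) := by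
      intro x y hx hy hxr hyr
      obtain ⟨w, hw, hwr, heq⟩ := h.exists_pos_eq (k := 0) (k' := 1) (by decide) hx
        ((hxr.trans hρ2).trans_le hρ₂r) (hQ' 0 (Or.inl rfl) x hx (hxr.trans hρ2)) (half_pos hρ)
      have hwr' : |w| < ρ / 2 := by rwa [abs_of_pos hw]
      rw [hquad x y x w hxr hyr hxr hwr' (hsq hx) (mul_pos hy hw),
        hquad x (-y) x (-w) hxr (by rwa [abs_neg]) hxr (by rwa [abs_neg]) (hsq hx)
          (by rw [neg_mul_neg]; exact mul_pos hy hw)]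
      exact heq
    have href0 : ∀ x y : ℝ, 0 < x → y ≠ 0 → |x| < ρ / 2 → |y| < ρ / 2 → F x y = F (-x) y := by
      intro x y hx hy hxr hyr
      obtain ⟨w, hw, hwr, heq⟩ := h.exists_pos_eq (k := 1) (k' := 0) (by decide) hy
        ((hyr.trans hρ2).trans_le hρ₂r) (hQ' 1 (Or.inr hc) y hy (hyr.trans hρ2)) (half_pos hρ)
      have hwr' : |w| < ρ / 2 := by rwa [abs_of_pos hw]
      rw [hquad x y w y hxr hyr hwr' hyr (mul_pos hx hw) (hsq hy),
        hquad (-x) y (-w) y (by rwa [abs_neg]) hyr (by rwa [abs_neg]) hyr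
          (by rw [neg_mul_neg]; exact mul_pos hx hw) (hsq hy)]
      rw [add_comm (axis 1 y), add_comm (axis 1 y)] at heq
      exact heq
    refine ⟨F (ρ / 4) (ρ / 4), ?_⟩
    have h4 : |ρ / 4| < ρ / 2 := by rw [abs_of_pos (by linarith)]; linarith
    filter_upwards [h.eventually_norm_lt (half_pos hρ)] with x hx hxs
    rw [h.mem_support_iff hx.1] at hxs
    push Not at hxs
    have hx1 := hxs.1
    have hx0 := hxs.2 hc
    have hr0 : |e x 0| < ρ / 2 := (PiLp.norm_apply_le (e x) 0).trans_lt hx.2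
    have hr1 : |e x 1| < ρ / 2 := (PiLp.norm_apply_le (e x) 1).trans_lt hx.2
    have hFx : f x = F (e x 0) (e x 1) := by
      have : e x = axis 0 (e x 0) + axis 1 (e x 1) := by
        ext i; fin_cases i <;> simp
      simp only [F]
      rw [← this, e.left_inv hx.1]
    -- Reflections in the axes carry every point into the positive quadrant, where the function has
    -- one value.
    have hstep1 : F (e x 0) (e x 1) = F (e x 0) |e x 1| := by
      rcases hx1.lt_or_gt with hlt | hlt
      · rw [abs_of_neg hlt, href1 _ (-(e x 1)) hx0 (neg_pos.2 hlt) hr0 (by rwa [abs_neg]), neg_neg]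
      · rw [abs_of_pos hlt]
    have hstep0 : F (e x 0) |e x 1| = F |e x 0| |e x 1| := by
      rcases hx0.lt_or_gt with hlt | hlt
      · rw [abs_of_neg hlt, href0 (-(e x 0)) _ (neg_pos.2 hlt) (abs_ne_zero.2 hx1)
          (by rwa [abs_neg]) (by rwa [abs_abs]), neg_neg]
      · rw [abs_of_pos hlt]
    rw [hFx, hstep1, hstep0]
    exact hquad _ _ _ _ (by rwa [abs_abs]) (by rwa [abs_abs]) h4 h4
      (mul_pos (abs_pos.2 hx0) (by linarith)) (mul_pos (abs_pos.2 hx1) (by linarith))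
  · obtain ⟨u, v, ρ₃, hρ₃, hρ₃r, hside⟩ := h.exists_sides hc hf
    set ρ := min ρ₃ ρ₂
    have hρ : 0 < ρ := lt_min hρ₃ hρ₂
    have hx : |ρ / 4| < ρ / 2 := by rw [abs_of_pos (by linarith)]; linarith
    have hρ2 : ρ / 2 < ρ₂ := by have := min_le_right ρ₃ ρ₂; simp only [ρ] at hρ ⊢; linarith
    obtain ⟨w, hw, hwr, heq⟩ := h.exists_pos_eq (k := 0) (k' := 1) (by decide)
      (show ρ / 4 ≠ 0 by linarith) ((hx.trans hρ2).trans_le hρ₂r)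
      (hQ' 0 (Or.inl rfl) (ρ / 4) (by linarith) (hx.trans hρ2)) (half_pos hρ)
    have hval : ∀ y : ℝ, |y| < ρ / 2 → axis 0 (ρ / 4) + axis 1 y ∈ e.target ∧
        ‖axis 0 (ρ / 4) + axis 1 y‖ < ρ₃ := fun y hy => by
      have h1 := (norm_axis_add_axis_lt hx hy).trans_le (min_le_left ρ₃ ρ₂)
      exact ⟨by rw [h.target, mem_ball_zero_iff]; exact h1.trans_le hρ₃r, h1⟩
    have hw1 := hval w (by rwa [abs_of_pos hw])
    have hw2 := hval (-w) (by rwa [abs_neg, abs_of_pos hw])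
    have hu := (hside _ (e.map_target hw1.1) (by rw [e.right_inv hw1.1]; exact hw1.2)).1
      (by rw [e.right_inv hw1.1]; simpa using hw)
    have hv := (hside _ (e.map_target hw2.1) (by rw [e.right_inv hw2.1]; exact hw2.2)).2
      (by rw [e.right_inv hw2.1]; simpa using hw)
    have huv : u = v := by rw [← hu, ← hv, heq]
    refine ⟨u, ?_⟩
    filter_upwards [h.eventually_norm_lt hρ₃] with x hx hxs
    rw [h.mem_support_iff hx.1] at hxs
    push Not at hxs
    rcases hxs.1.lt_or_gt with h1 | h1
    · rw [(hside x hx.1 hx.2).2 h1, huv]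
    · rw [(hside x hx.1 hx.2).1 h1]

end IsStraightChart

end Extension

/-! ### From a checkerboard colouring to a section -/

section Checkerboard

variable {M : Type*} [TopologicalSpace M]

theorem IsCell.subset {K C : Set M} (hC : IsCell K C) : C ⊆ Kᶜ := by
  obtain ⟨x, -, rfl⟩ := hC
  exact connectedComponentIn_subset _ _

theorem IsCell.eq_connectedComponentIn {K C : Set M} (hC : IsCell K C) {x : M} (hx : x ∈ C) :
    connectedComponentIn Kᶜ x = C := by
  obtain ⟨y, -, rfl⟩ := hC
  exact (connectedComponentIn_eq hx).symm

theorem eventually_connectedComponentIn_eq [LocallyConnectedSpace M] {U : Set M} (hU : IsOpen U)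
    {x : M} (hx : x ∈ U) :
    ∀ᶠ y in 𝓝 x, connectedComponentIn U y = connectedComponentIn U x := by
  filter_upwards [hU.connectedComponentIn.mem_nhds (mem_connectedComponentIn hx)] with y hy
  exact (connectedComponentIn_eq hy).symm

variable [ChartedSpace Plane M] {ι : Type*} {γ : ι → UnitAddCircle → M}

theorem IsAdmissible.isCompact_support [IsManifold (𝓡 2) ∞ M] [Finite ι] (hγ : IsAdmissible γ) :
    IsCompact (support γ) :=
  isCompact_iUnion fun i => isCompact_range (hγ.continuous i)

variable (𝒜 : StraightAtlas γ)

theorem localColor_of_not_isCrossing {p : M} (hp : ¬ IsCrossing γ p) (x : M) :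
    localColor 𝒜 p x = sgn (𝒜.e p x 1) := by
  rw [localColor, if_neg hp, mul_one]

/-- A function which takes different values on two cells at a point of an edge is a local
colouring there. -/
theorem exists_eq_mul_localColor {p : M} (hp : p ∈ support γ) (hpc : ¬ IsCrossing γ p)
    {σ : M → ℤˣ} (hσ : ∀ x ∉ support γ, ∀ᶠ y in 𝓝 x, σ y = σ x) {C C' : Set M} {c c' : ℤˣ}
    (hC : C ⊆ (support γ)ᶜ) (hC' : C' ⊆ (support γ)ᶜ) (hpC : p ∈ closure C) (hpC' : p ∈ closure C')
    (hc : ∀ x ∈ C, σ x = c) (hc' : ∀ x ∈ C', σ x = c') (hne : c ≠ c') :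
    ∃ d, ∀ᶠ x in 𝓝 p, x ∉ support γ → σ x = d * localColor 𝒜 p x := by
  have hP := 𝒜.isStraight p hp
  obtain ⟨u, v, ρ, hρ, hρr, hside⟩ := hP.exists_sides hpc (Filter.Eventually.of_forall hσ)
  have hval : ∀ {D : Set M} {d : ℤˣ}, D ⊆ (support γ)ᶜ → p ∈ closure D → (∀ x ∈ D, σ x = d) →
      d = u ∨ d = v := by
    intro D d hD hpD hd
    obtain ⟨x, hx, hxD⟩ := mem_closure_iff_nhds.1 hpD _ (hP.eventually_norm_lt hρ)
    have hx1 : 𝒜.e p x 1 ≠ 0 := fun h => hD hxD ((hP.mem_support_iff hx.1).2 (Or.inl h))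
    rw [← hd x hxD]
    rcases hx1.lt_or_gt with h | h
    · exact Or.inr ((hside x hx.1 hx.2).2 h)
    · exact Or.inl ((hside x hx.1 hx.2).1 h)
  -- Near p each cell must meet one of the two sides. If both sides had the same value, the two
  -- cells would have the same colour.
  have huv : v = -u := by
    refine Int.units_ne_iff_eq_neg.1 ?_
    rintro rfl
    exact hne (((or_self_iff.1 (hval hC hpC hc))).trans (or_self_iff.1 (hval hC' hpC' hc')).symm)
  refine ⟨u, ?_⟩
  filter_upwards [hP.eventually_norm_lt hρ] with x hx hxs
  have hx1 : 𝒜.e p x 1 ≠ 0 := fun h => hxs ((hP.mem_support_iff hx.1).2 (Or.inl h))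
  rw [localColor_of_not_isCrossing 𝒜 hpc]
  rcases hx1.lt_or_gt with h | h
  · rw [(hside x hx.1 hx.2).2 h, sgn_of_neg h, huv, mul_neg, mul_one]
  · rw [(hside x hx.1 hx.2).1 h, sgn_of_pos h, mul_one]

/-- A function which is a local colouring near all but finitely many points of the edges is a local
colouring near every point of the curves. -/
theorem exists_eq_mul_localColor_of_finite [T2Space M] (hγ : IsAdmissible γ) [IsManifold (𝓡 2) ∞ M]
    {σ : M → ℤˣ} (hσ : ∀ x ∉ support γ, ∀ᶠ y in 𝓝 x, σ y = σ x) {V : Set M} (hV : V.Finite)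
    (h : ∀ q ∈ support γ \ V, ¬ IsCrossing γ q →
      ∃ d, ∀ᶠ x in 𝓝 q, x ∉ support γ → σ x = d * localColor 𝒜 q x) {p : M}
    (hp : p ∈ support γ) :
    ∃ d, ∀ᶠ x in 𝓝 p, x ∉ support γ → σ x = d * localColor 𝒜 p x := by
  have hP := 𝒜.isStraight p hp
  -- The ratio of σ to the local colouring at p is constant near every other nearby point of the
  -- curves: finiteness of V keeps its remaining points away from p, and crossings are isolated. The
  -- extension lemma then covers p itself.
  obtain ⟨d, hd⟩ := hP.eventually_const (f := fun x => σ x * localColor 𝒜 p x) (by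
      filter_upwards [hP.eventually_mem] with x hx hxs
      filter_upwards [hσ x hxs, localColor_locConst 𝒜 hp hx hxs] with y h1 h2
      rw [h1, h2]) (by
      have hVp : (V \ {p})ᶜ ∈ 𝓝 p :=
        (hV.subset sdiff_subset).isClosed.isOpen_compl.mem_nhds fun h => h.2 rfl
      filter_upwards [hVp, hP.eventually_mem] with q hqV hqs hq hqp
      have hqV' : q ∉ V := fun h => hqV ⟨h, hqp⟩
      obtain ⟨d, hd⟩ := h q ⟨hq, hqV'⟩ (hP.not_isCrossing hqs hqp)
      refine ⟨d * colorSign 𝒜 p q, ?_⟩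
      filter_upwards [hd, localColor_transition 𝒜 hγ hp hq hqs] with x h1 h2 hxs
      rw [h1 hxs, h2 hxs, mul_mul_mul_comm, Int.units_mul_self, mul_one])
  refine ⟨d, ?_⟩
  filter_upwards [hd] with x hx hxs
  rw [← hx hxs, mul_assoc, Int.units_mul_self, mul_one]

/-- Signs which relate a function to the local colourings form a section of the double covering of
local colourings. -/
theorem good_of_eq_mul_localColor [IsManifold (𝓡 2) ∞ M] (hγ : IsAdmissible γ) {σ : M → ℤˣ}
    {s : M → ℤˣ}
    (h : ∀ p ∈ support γ, ∀ᶠ x in 𝓝 p, x ∉ support γ → σ x = s p * localColor 𝒜 p x) :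
    Good (colorSign 𝒜) (support γ) s := by
  intro p hp
  have hP := 𝒜.isStraight p hp
  filter_upwards [mem_nhdsWithin_of_mem_nhds hP.eventually_mem, self_mem_nhdsWithin,
    mem_nhdsWithin_of_mem_nhds (h p hp).eventually_nhds] with q hqs hq h1
  obtain ⟨x, hx, h1, h2, h3⟩ := ((𝒜.isStraight q hq).frequently_notMem.and_eventually
    (h1.and ((h q hq).and (localColor_transition 𝒜 hγ hp hq hqs)))).exists
  have := (h2 hx).symm.trans (h1 hx)
  rw [h3 hx, ← mul_assoc] at this
  exact mul_right_cancel this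

/-- Colouring each point off Γ by its cell gives a locally constant function that alternates across
the edges. The vertices in V need not be the crossings: finiteness of V suffices, since exceptional
points are filled in by continuity. -/
theorem exists_good_of_isCheckerboard [T2Space M] [IsManifold (𝓡 2) ∞ M] [Finite ι] (hγ : IsAdmissible γ)
    {V : Set M} (hV : V.Finite) {χ : Set M → Bool} (hχ : IsCheckerboard (support γ) V χ) :
    ∃ s, Good (colorSign 𝒜) (support γ) s := by
  have : LocallyConnectedSpace M := ChartedSpace.locallyConnectedSpace Plane M
  set σ : M → ℤˣ := fun x => if χ (connectedComponentIn (support γ)ᶜ x) then 1 else -1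
  have hσ : ∀ x ∉ support γ, ∀ᶠ y in 𝓝 x, σ y = σ x := fun x hx => by
    filter_upwards [eventually_connectedComponentIn_eq
      hγ.isCompact_support.isClosed.isOpen_compl hx] with y hy
    simp only [σ, hy]
  have h : ∀ p, ∃ d, p ∈ support γ →
      ∀ᶠ x in 𝓝 p, x ∉ support γ → σ x = d * localColor 𝒜 p x := by
    intro p
    by_cases hp : p ∈ support γ
    · obtain ⟨d, hd⟩ := exists_eq_mul_localColor_of_finite 𝒜 hγ hσ hV (fun q hq hqc => by
        obtain ⟨C, C', hC, hC', hqC, hqC', hne⟩ := hχ q hq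
        refine exists_eq_mul_localColor 𝒜 hq.1 hqc hσ hC.subset hC'.subset hqC hqC'
          (c := if χ C then 1 else -1) (c' := if χ C' then 1 else -1)
          (fun x hx => by simp only [σ, hC.eq_connectedComponentIn hx])
          (fun x hx => by simp only [σ, hC'.eq_connectedComponentIn hx]) ?_
        cases h1 : χ C <;> cases h2 : χ C' <;> simp_all) hp
      exact ⟨d, fun _ => hd⟩
    · exact ⟨1, fun h => absurd h hp⟩
  choose s hs using h
  exact ⟨s, good_of_eq_mul_localColor 𝒜 hγ hs⟩

end Checkerboard

/-! ### Connectedness of a disc near its boundary -/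

section Disc

theorem isPreconnected_annulus (r : ℝ) (hr : 0 ≤ r) :
    IsPreconnected {y : Plane | r < ‖y‖ ∧ ‖y‖ < 1} := by
  have h1 : IsConnected (Metric.sphere (0 : Plane) 1) := by
    refine isConnected_sphere ?_ 0 zero_le_one
    rw [← Module.finrank_eq_rank]
    simp
  have h2 : IsPreconnected ((fun q : ℝ × Plane => q.1 • q.2) '' Ioo r 1 ×ˢ Metric.sphere 0 1) :=
    (isPreconnected_Ioo.prod h1.isPreconnected).image _ (by fun_prop)
  convert h2 using 1
  ext y
  constructor
  · rintro ⟨hy1, hy2⟩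
    have hy : ‖y‖ ≠ 0 := (hr.trans_lt hy1).ne'
    exact ⟨(‖y‖, ‖y‖⁻¹ • y), ⟨⟨hy1, hy2⟩, by simp [norm_smul, inv_mul_cancel₀ hy]⟩,
      smul_inv_smul₀ hy y⟩
  · rintro ⟨⟨t, v⟩, ⟨⟨ht1, ht2⟩, hv⟩, rfl⟩
    have hv : ‖v‖ = 1 := by simpa using hv
    have : ‖t • v‖ = t := by rw [norm_smul, hv, mul_one, Real.norm_of_nonneg (hr.trans ht1.le)]
    simp only [mem_ofPred_eq, this]
    exact ⟨ht1, ht2⟩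

/-- A compact subset of an open disc lies in a compact subset with connected complement. -/
theorem exists_isCompact_isPreconnected_diff {X : Type*} [TopologicalSpace X] {C K : Set X}
    (h : C ≃ₜ Metric.ball (0 : Plane) 1) (hK : IsCompact K) (hKC : K ⊆ C) :
    ∃ K', IsCompact K' ∧ K ⊆ K' ∧ K' ⊆ C ∧ IsPreconnected (C \ K') := by
  set f : C → Plane := fun x => h x
  have hf : Continuous f := continuous_subtype_val.comp h.continuous
  have hK1 : IsCompact (f '' (Subtype.val ⁻¹' K)) :=
    (IsInducing.subtypeVal.isCompact_preimage' hK (by simpa using hKC)).image hf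
  obtain ⟨r, hr1, hr⟩ := exists_lt_subset_ball hK1.isClosed
    (show f '' (Subtype.val ⁻¹' K) ⊆ Metric.ball 0 1 by rintro _ ⟨x, -, rfl⟩; exact (h x).2)
  -- The radius supplied by compactness may be negative, while the annulus is shown to be connected
  -- for nonnegative inner radius.
  set r' := max r 0
  have hr'1 : r' < 1 := max_lt hr1 one_pos
  set φ : Metric.ball (0 : Plane) 1 → X := fun y => h.symm y
  have hφ : Continuous φ := continuous_subtype_val.comp h.symm.continuous
  refine ⟨φ '' (Subtype.val ⁻¹' Metric.closedBall 0 r'), ?_, ?_, ?_, ?_⟩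
  · refine (IsInducing.subtypeVal.isCompact_preimage' (isCompact_closedBall _ _) ?_).image hφ
    rw [Subtype.range_coe]
    exact Metric.closedBall_subset_ball hr'1
  · intro x hx
    have hx' : ‖f ⟨x, hKC hx⟩‖ < r := by simpa using hr ⟨⟨x, hKC hx⟩, hx, rfl⟩
    exact ⟨h ⟨x, hKC hx⟩, mem_closedBall_zero_iff.2 (hx'.le.trans (le_max_left r 0)), by simp [φ]⟩
  · rintro _ ⟨y, -, rfl⟩
    exact (h.symm y).2
  · have hpre : IsPreconnected
        (Subtype.val ⁻¹' {y : Plane | r' < ‖y‖} : Set (Metric.ball (0 : Plane) 1)) := by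
      rw [← IsInducing.subtypeVal.isPreconnected_image]
      convert isPreconnected_annulus r' (le_max_right _ _) using 1
      ext y
      simp [and_comm]
    convert hpre.image φ hφ.continuousOn using 1
    ext x
    constructor
    · rintro ⟨hx, hxK⟩
      refine ⟨h ⟨x, hx⟩, ?_, by simp [φ]⟩
      by_contra hlt
      exact hxK ⟨h ⟨x, hx⟩, by simpa using not_lt.1 hlt, by simp [φ]⟩
    · rintro ⟨y, hy, rfl⟩
      refine ⟨(h.symm y).2, ?_⟩
      rintro ⟨y', hy', heq⟩
      obtain rfl : y' = y := h.symm.injective (Subtype.ext heq)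
      have h1 : ‖(y' : Plane)‖ ≤ r' := by simpa using hy'
      exact (show r' < ‖(y' : Plane)‖ from hy).not_ge h1

variable {M : Type*} [TopologicalSpace M] [LocallyConnectedSpace M]

/-- Components of the open complement are open, so a limit point off K lies in a component that
meets C, and hence in C. -/
theorem IsCell.closure_subset {K C : Set M} (hK : IsClosed K) (hC : IsCell K C) :
    closure C ⊆ C ∪ K := by
  intro y hy
  by_cases hyK : y ∈ K
  · exact Or.inr hyK
  · left
    obtain ⟨z, hz, hzC⟩ := mem_closure_iff.1 hy _ hK.isOpen_compl.connectedComponentIn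
      (mem_connectedComponentIn hyK)
    rw [← hC.eq_connectedComponentIn hzC, ← connectedComponentIn_eq hz]
    exact mem_connectedComponentIn hyK

/-- A function which is locally constant near the boundary of a disc is constant near its
boundary. -/
theorem IsCell.exists_eq_near [T2Space M] [CompactSpace M] {K C : Set M} (hK : IsClosed K)
    (hC : IsCell K C) (h : C ≃ₜ Metric.ball (0 : Plane) 1) {Y : Type*} [Nonempty Y] {σ : M → Y}
    (hσ : ∀ p ∈ K, ∀ᶠ x in 𝓝 p, x ∉ K → ∀ᶠ z in 𝓝 x, σ z = σ x) :
    ∃ c, ∀ p ∈ K, ∀ᶠ x in 𝓝 p, x ∈ C → σ x = c := by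
  set U : Set M := {y | ∀ᶠ x in 𝓝 y, x ∉ K → ∀ᶠ z in 𝓝 x, σ z = σ x}
  have hU : IsOpen U := isOpen_setOfPred_eventually_nhds
  -- Passing to the closure adds only points of K, which lie in U. So the part of C where local
  -- constancy might fail is closed, hence compact.
  have hcore : C \ U = closure C \ U := by
    refine (sdiff_subset_sdiff_left subset_closure).antisymm ?_
    rintro x ⟨hx, hxU⟩
    exact ⟨(hC.closure_subset hK hx).resolve_right fun h => hxU (hσ x h), hxU⟩
  have hcomp : IsCompact (C \ U) := by
    rw [hcore]
    exact (isClosed_closure.inter hU.isClosed_compl).isCompact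
  obtain ⟨K', hK', hUK', hK'C, hconn⟩ := exists_isCompact_isPreconnected_diff h hcomp sdiff_subset
  have hloc : ∀ x ∈ C \ K', ∀ᶠ z in 𝓝[C \ K'] x, σ z = σ x := fun x hx => by
    have hxU : x ∈ U := by
      by_contra h
      exact hx.2 (hUK' ⟨hx.1, h⟩)
    exact (hxU.self_of_nhds (hC.subset hx.1)).filter_mono nhdsWithin_le_nhds
  have hnear : ∀ p ∈ K, ∀ᶠ x in 𝓝 p, x ∉ K' := fun p hp =>
    hK'.isClosed.isOpen_compl.mem_nhds fun h => hC.subset (hK'C h) hp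
  rcases (C \ K').eq_empty_or_nonempty with hemp | ⟨x₀, hx₀⟩
  · refine ⟨Classical.arbitrary Y, fun p hp => ?_⟩
    filter_upwards [hnear p hp] with x hx hxC
    exact absurd (show x ∈ C \ K' from ⟨hxC, hx⟩) (by rw [hemp]; exact id)
  · refine ⟨σ x₀, fun p hp => ?_⟩
    filter_upwards [hnear p hp] with x hx hxC
    exact eq_of_eventually_eq hconn hloc ⟨hxC, hx⟩ hx₀

end Disc

/-! ### Points on both sides of an edge -/

section Sides

theorem IsCrossing.mem_support {M ι : Type*} {γ : ι → UnitAddCircle → M} {p : M} (hp : IsCrossing γ p) : p ∈ support γ := by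
  obtain ⟨x, hx⟩ := Set.nonempty_of_encard_ne_zero (by rw [show _ = _ from hp]; decide)
  exact mem_iUnion.2 ⟨x.1, x.2, hx⟩

variable {M : Type*} [TopologicalSpace M] [ChartedSpace Plane M] {ι : Type*}
  {γ : ι → UnitAddCircle → M}

/-- There are points on either side of an edge near each of its points. -/
theorem IsStraightChart.frequently_pos {p : M} {e : OpenPartialHomeomorph M Plane} {r : ℝ}
    {b : Fin 2 → ι × ℝ} (h : IsStraightChart γ p e r b) {d : ℝ} (hd : |d| = 1) :
    ∃ᶠ x in 𝓝 p, 0 < d * e x 1 := by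
  rw [Filter.frequently_iff]
  intro U hU
  obtain ⟨ρ, hρ, hρr, hP⟩ := h.exists_norm_lt (P := fun x => x ∈ U) hU
  have hy : |d * (ρ / 2)| < ρ := by rw [abs_mul, hd, one_mul, abs_of_pos (half_pos hρ)]; linarith
  refine ⟨e.symm (axis 1 (d * (ρ / 2))), hP _ (by rwa [axis, PiLp.norm_single, Real.norm_eq_abs]), ?_⟩
  rw [e.right_inv (h.axis_mem_target (hy.trans_le hρr)), axis_apply_self, ← mul_assoc]
  refine mul_pos (mul_self_pos.2 ?_) (half_pos hρ)
  rintro rfl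
  simp at hd

end Sides

/-! ### From a section to a checkerboard colouring of the cells -/

section Extension

variable {M : Type*} [TopologicalSpace M] [ChartedSpace Plane M] [T2Space M]
  [IsManifold (𝓡 2) ∞ M] {ι : Type*} {γ : ι → UnitAddCircle → M} (𝒜 : StraightAtlas γ)

/-- A section of the double covering of local colourings gives a colouring near the curves. -/
theorem exists_eq_mul_localColor_of_good [Finite ι] (hγ : IsAdmissible γ) {s : M → ℤˣ}
    (hs : Good (colorSign 𝒜) (support γ) s) :
    ∃ σ : M → ℤˣ, ∀ p ∈ support γ, ∀ᶠ x in 𝓝 p, x ∉ support γ → σ x = s p * localColor 𝒜 p x := by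
  classical
  have : LocallyCompactSpace M := Manifold.locallyCompact_of_finiteDimensional (𝓡 2)
  -- Closed neighbourhoods ensure that near q only those W containing q are relevant, and on these
  -- the signed local colourings agree near q.
  have hN : ∀ p, ∃ W ∈ 𝓝 p, IsClosed W ∧ (p ∈ support γ → ∀ q ∈ W, q ∈ support γ →
      ∀ᶠ x in 𝓝 q, x ∉ support γ → s p * localColor 𝒜 p x = s q * localColor 𝒜 q x) := by
    intro p
    by_cases hp : p ∈ support γ
    · have : {q | q ∈ support γ → ∀ᶠ x in 𝓝 q, x ∉ support γ →
          s p * localColor 𝒜 p x = s q * localColor 𝒜 q x} ∈ 𝓝 p := by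
        filter_upwards [(𝒜.isStraight p hp).eventually_mem, eventually_nhdsWithin_iff.1 (hs p hp)]
          with q hqs h1 hq
        filter_upwards [localColor_transition 𝒜 hγ hp hq hqs] with x h2 hx
        rw [h2 hx, h1 hq, mul_assoc]
      obtain ⟨W, hW, hWc, hWs⟩ := exists_mem_nhds_isClosed_subset this
      exact ⟨W, hW, hWc, fun _ q hq => hWs hq⟩
    · exact ⟨univ, Filter.univ_mem, isClosed_univ, fun h => absurd h hp⟩
  choose W hW hWc hWs using hN
  obtain ⟨t, ht, hcov⟩ := hγ.isCompact_support.elim_nhds_subcover (fun p => interior (W p))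
    fun p _ => interior_mem_nhds.2 (hW p)
  -- The choice of p is immaterial near Γ, where all admissible choices give the same colour.
  -- Outside the finite cover the value 1 is arbitrary.
  refine ⟨fun x => if h : ∃ p ∈ t, x ∈ W p then s h.choose * localColor 𝒜 h.choose x else 1,
    fun q hq => ?_⟩
  obtain ⟨p₀, hp₀, hq₀⟩ := mem_iUnion₂.1 (hcov hq)
  have hall : ∀ᶠ x in 𝓝 q, ∀ p ∈ t, x ∈ W p → x ∉ support γ →
      s p * localColor 𝒜 p x = s q * localColor 𝒜 q x := by
    rw [Filter.eventually_all_finset]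
    intro p hp
    by_cases hqp : q ∈ W p
    · filter_upwards [hWs p (ht p hp) q hqp hq] with x hx _ using hx
    · filter_upwards [(hWc p).isOpen_compl.mem_nhds hqp] with x hx h using absurd h hx
  filter_upwards [hall, isOpen_interior.mem_nhds hq₀] with x hx hxW hxs
  have hex : ∃ p ∈ t, x ∈ W p := ⟨p₀, hp₀, interior_subset hxW⟩
  rw [dif_pos hex]
  exact hx _ hex.choose_spec.1 hex.choose_spec.2 hxs

theorem IsAdmissible.isFourValentGraph [Finite ι] (hγ : IsAdmissible γ) :
    IsFourValentGraph (support γ) {p | IsCrossing γ p} where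
  compact := hγ.isCompact_support
  connected := hγ.connected
  finite := finite_setOf_isCrossing hγ
  nonempty := hγ.exists_crossing
  subset := fun p hp => IsCrossing.mem_support hp
  vertex := by
    intro p hp
    obtain ⟨𝒜⟩ := hγ.nonempty_straightAtlas
    have hP := 𝒜.isStraight p (IsCrossing.mem_support hp)
    refine ⟨𝒜.e p, hP.mem, hP.map_self, fun x hx => ?_⟩
    rw [hP.mem_support_iff hx, or_comm, and_iff_right (show IsCrossing γ p from hp)]
  edge := by
    rintro p ⟨hp, hpc⟩
    obtain ⟨𝒜⟩ := hγ.nonempty_straightAtlas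
    have hP := 𝒜.isStraight p hp
    refine ⟨𝒜.e p, hP.mem, hP.map_self, fun x hx => ?_⟩
    rw [hP.mem_support_iff hx, or_iff_left fun h => hpc h.1]

/-- A section of the double covering of local colourings gives a checkerboard colouring of discs. -/
theorem exists_isCheckerboard_of_good [CompactSpace M] [Finite ι] (hγ : IsAdmissible γ)
    (hcells : CellsAreDiscs (support γ)) {s : M → ℤˣ} (hs : Good (colorSign 𝒜) (support γ) s) :
    ∃ χ, IsCheckerboard (support γ) {p | IsCrossing γ p} χ := by
  classical
  have : LocallyConnectedSpace M := ChartedSpace.locallyConnectedSpace Plane M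
  have hcl := hγ.isCompact_support.isClosed
  obtain ⟨σ, hσ⟩ := exists_eq_mul_localColor_of_good 𝒜 hγ hs
  have hloc : ∀ p ∈ support γ, ∀ᶠ x in 𝓝 p, x ∉ support γ → ∀ᶠ z in 𝓝 x, σ z = σ x := by
    intro p hp
    filter_upwards [(hσ p hp).eventually_nhds, (𝒜.isStraight p hp).eventually_mem]
      with x hx hxs hxΓ
    filter_upwards [hx, localColor_locConst 𝒜 hp hxs hxΓ, hcl.isOpen_compl.mem_nhds hxΓ]
      with z h1 h2 h3
    rw [h1 h3, hx.self_of_nhds hxΓ, h2]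
  -- Here the cells must be discs: a disc is connected near its boundary, so the colouring near Γ
  -- assigns one value to each cell.
  have hc : ∀ C, ∃ c, IsCell (support γ) C →
      ∀ p ∈ support γ, ∀ᶠ x in 𝓝 p, x ∈ C → σ x = c := by
    intro C
    by_cases hC : IsCell (support γ) C
    · obtain ⟨h⟩ := hcells C hC
      obtain ⟨c, hc⟩ := hC.exists_eq_near hcl h hloc
      exact ⟨c, fun _ => hc⟩
    · exact ⟨1, fun h => absurd h hC⟩
  choose c hc using hc
  refine ⟨fun C => decide (c C = 1), ?_⟩
  rintro p ⟨hp, hpc⟩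
  have hP := 𝒜.isStraight p hp
  obtain ⟨u, v, ρ, hρ, -, hside⟩ := hP.exists_sides hpc
    (f := connectedComponentIn (support γ)ᶜ)
    (Filter.Eventually.of_forall fun x hx => eventually_connectedComponentIn_eq hcl.isOpen_compl hx)
  -- The number d, which is 1 or -1, selects a side of the edge. The cell on that side has colour `s
  -- p * sgn d`, so the cells on the two sides have opposite colours and are in particular distinct.
  have key : ∀ (d : ℝ) (C : Set M), |d| = 1 → (∀ x ∈ (𝒜.e p).source, ‖𝒜.e p x‖ < ρ →
      0 < d * 𝒜.e p x 1 → connectedComponentIn (support γ)ᶜ x = C) →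
      IsCell (support γ) C ∧ p ∈ closure C ∧ c C = s p * sgn d := by
    intro d C hd hC
    have hd0 : d ≠ 0 := by rintro rfl; simp at hd
    have hfr : ∃ᶠ x in 𝓝 p, (x ∉ support γ ∧ x ∈ C) ∧ IsCell (support γ) C ∧
        sgn (𝒜.e p x 1) = sgn d := by
      refine ((hP.frequently_pos hd).and_eventually (hP.eventually_norm_lt hρ)).mono ?_
      rintro x ⟨h1, h2, h3⟩
      have hne : 𝒜.e p x 1 ≠ 0 := right_ne_zero_of_mul h1.ne'
      have hxs : x ∉ support γ := by
        rw [hP.mem_support_iff h2]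
        exact fun h => h.elim hne fun h => hpc h.1
      have hxC := hC x h2 h3 h1
      refine ⟨⟨hxs, ?_⟩, ⟨x, hxs, hxC.symm⟩, ?_⟩
      · rw [← hxC]; exact mem_connectedComponentIn hxs
      · rw [sgn_eq_sgn_iff hne hd0, mul_comm]; exact h1
    have hcell := hfr.exists.choose_spec.2.1
    refine ⟨hcell, mem_closure_iff_frequently.2 (hfr.mono fun x hx => hx.1.2), ?_⟩
    obtain ⟨x, ⟨⟨h1, h2⟩, -, h3⟩, h4, h5⟩ :=
      (hfr.and_eventually ((hc C hcell p hp).and (hσ p hp))).exists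
    rw [← h4 h2, h5 h1, localColor_of_not_isCrossing 𝒜 hpc, h3]
  obtain ⟨hu1, hu2, hu3⟩ := key 1 u (by simp) fun x h1 h2 h3 => (hside x h1 h2).1 (by simpa using h3)
  obtain ⟨hv1, hv2, hv3⟩ := key (-1) v (by simp) fun x h1 h2 h3 =>
    (hside x h1 h2).2 (by simpa using h3)
  refine ⟨u, v, hu1, hv1, hu2, hv2, ?_⟩
  rw [sgn_of_pos one_pos, mul_one] at hu3
  rw [sgn_of_neg (by norm_num)] at hv3
  rcases Int.units_eq_one_or (s p) with h | h <;> simp [hu3, hv3, h]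

end Extension

end SurfaceAtom

/-! ### The criterion for atoms -/

theorem mainTheorem4 {M : Type*} [TopologicalSpace M] [T2Space M] [CompactSpace M]
    [ConnectedSpace M] [ChartedSpace SurfaceAtom.Plane M] [IsManifold (𝓡 2) ∞ M]
    {ι : Type*} [Finite ι] (γ : ι → UnitAddCircle → M)
    (hγ : SurfaceAtom.IsAdmissible γ)
    (hcells : SurfaceAtom.CellsAreDiscs (SurfaceAtom.support γ)) :
    SurfaceAtom.IsAtom (SurfaceAtom.support γ) ↔
      ∀ g : UnitAddCircle → M, SurfaceAtom.IsSimpleClosedCurveIn γ g →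
        (SurfaceAtom.ChangesLocalOrientation g ↔ Odd (SurfaceAtom.straightCount γ g)) := by
  obtain ⟨𝒜⟩ := hγ.nonempty_straightAtlas
  constructor
  · rintro ⟨-, V, hV, χ, hχ⟩ g hg
    obtain ⟨s, hs⟩ := SurfaceAtom.exists_good_of_isCheckerboard 𝒜 hγ hV.finite hχ
    exact (SurfaceAtom.exists_good_colorSign_iff 𝒜 hγ hg).1 ⟨s, hs.mono hg.subset⟩
  · intro h
    obtain ⟨s, hs⟩ := hγ.exists_good_support (SurfaceAtom.isCocycleOn_colorSign 𝒜 hγ) fun g h1 h2 h3 =>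
      (SurfaceAtom.exists_good_colorSign_iff 𝒜 hγ ⟨h1, h2, h3⟩).2 (h g ⟨h1, h2, h3⟩)
    obtain ⟨χ, hχ⟩ := SurfaceAtom.exists_isCheckerboard_of_good 𝒜 hγ hcells hs
    exact ⟨hcells, _, hγ.isFourValentGraph, χ, hχ⟩
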